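/- Fix $\ell>0$ and work in the real Hilbert spaces $L^2(0,\ell)$ and $\mathbb R^2$. Let $A_{\min}u=u''$ with domain $C_c^\infty(0,\ell)$. For $u\in H^1(0,\ell)$ put $\gamma_0u=(u(0),u(\ell))$, for $u\in H^2(0,\ell)$ put $\gamma_1u=(u'(0),-u'(\ell))$, and let $u_\#=(0\vee u)\wedge1$ (componentwise on $\mathbb R^2$). Let $\mathsf E(\mathbb R^2)$ be the set of pairs $(\Pi,B)$ with $\Pi$ an orthogonal projection in $\mathbb R^2$ and $B$ a self-adjoint operator in its range $\mathscr R(\Pi)$. For $(\Pi,B)\in\mathsf E(\mathbb R^2)$ let $$\tilde A_{(\Pi,B)}u=u'',\qquad \mathscr D(\tilde A_{(\Pi,B)})=\{u\in H^2(0,\ell):\gamma_0u\in\mathscr R(\Pi),\ \Pi\gamma_1u=B\gamma_0u\},$$ let $f_{\Pi,B}(\xi,\zeta)=B\xi\cdot\zeta$ with domain $\mathscr R(\Pi)$, and let $$\tilde F_{(\Pi,B)}(u,v)=\int_0^\ell u'v'\,dx+f_{\Pi,B}(\gamma_0u,\gamma_0v),\qquad \mathscr D(\tilde F_{(\Pi,B)})=\{u\in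 H^1(0,\ell):\gamma_0u\in\mathscr R(\Pi)\}.$$ A Dirichlet form is a closed, symmetric, positive bilinear form $F$ (not necessarily densely defined) such that $u\in\mathscr D(F)$ implies $u_\#\in\mathscr D(F)$ and $F(u_\#,u_\#)\le F(u,u)$. A Markovian extension of $A_{\min}$ is a self-adjoint extension $A\le0$ such that $0\le u\le1$ a.e. implies $0\le e^{tA}u\le1$ a.e. for all $t>0$. Call $(\Pi,B)\in\mathsf E(\mathbb R^2)$ admissible if one of the following holds: (1) $\Pi=0$; (2) $\Pi=\mathsf 1$ and $B=\begin{pmatrix}b_{11}&b_{12}\\ b_{12}&b_{22}\end{pmatrix}$ with $b_{11}+b_{12}\ge0$, $b_{12}+b_{22}\ge0$, $b_{12}\le0$; (3) $\Pi=v\otimes v$ with $v\in\{(\tfrac1{\sqrt2},\tfrac1{\sqrt2}),(1,0),(0,1)\}$ and $B$ is multiplication by a number $b\ge0$. Then an operator $A$ in $L^2(0,\ell)$ is a Markovian extension of $A_{\min}$ if and only if $A=\tilde A_{(\Pi,B)}$ for some admissible $(\Pi,B)$. Moreover, for every $(\Pi,B)\in\mathsf E(\mathbb R^2)$: $\tilde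 A_{(\Pi,B)}$ is a Markovian extension of $A_{\min}$ if and only if $(\Pi,B)$ is admissible; $\tilde F_{(\Pi,B)}$ is the closed, lower bounded bilinear form associated with $-\tilde A_{(\Pi,B)}$; $\tilde F_{(\Pi,B)}$ is a Dirichlet form on $L^2(0,\ell)$ if and only if $f_{\Pi,B}$ is a Dirichlet form on $\mathbb R^2$; and the latter holds if and only if $(\Pi,B)$ is admissible. -/

import Mathlib

open MeasureTheory Set Filter Topology
open scoped ContDiff RealInnerProductSpace

noncomputable section

namespace IntervalMarkov

/-! ### Symmetric bilinear forms with a domain, on a real Hilbert space -/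

/-- The unit contraction `t ↦ t_# = (0 ∨ t) ∧ 1`. -/
def cut (t : ℝ) : ℝ := min (max 0 t) 1

theorem cut_zero : cut 0 = 0 := by simp [cut]

theorem lipschitzWith_cut : LipschitzWith 1 cut :=
  (LipschitzWith.id.const_max 0).min_const 1

/-- A bilinear form `F : D(F) × D(F) → ℝ`, whose domain `D(F)` is a linear subspace of the real
Hilbert space `H`, not necessarily dense. -/
structure FormOn (H : Type*) [NormedAddCommGroup H] [InnerProductSpace ℝ H] where
  domain : Submodule ℝ H
  form : domain →ₗ[ℝ] domain →ₗ[ℝ] ℝ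

namespace FormOn

variable {H : Type*} [NormedAddCommGroup H] [InnerProductSpace ℝ H]

def IsSymm (F : FormOn H) : Prop := ∀ u v : F.domain, F.form u v = F.form v u

def IsNonneg (F : FormOn H) : Prop := ∀ u : F.domain, 0 ≤ F.form u u

def IsLowerBounded (F : FormOn H) : Prop :=
  ∃ c : ℝ, ∀ u : F.domain, -c * ‖(u : H)‖ ^ 2 ≤ F.form u u

/-- `F` is closed: if `uₙ ∈ D(F)` converges to `u` in `H` and `F(uₙ - uₘ, uₙ - uₘ) → 0`,
then `u ∈ D(F)` and `F(uₙ - u, uₙ - u) → 0`. -/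
def IsClosed (F : FormOn H) : Prop :=
  ∀ (s : ℕ → F.domain) (u : H),
    Tendsto (fun n => (s n : H)) atTop (𝓝 u) →
    Tendsto (fun p : ℕ × ℕ => F.form (s p.1 - s p.2) (s p.1 - s p.2)) atTop (𝓝 0) →
    ∃ hu : u ∈ F.domain, Tendsto (fun n => F.form (s n - ⟨u, hu⟩) (s n - ⟨u, hu⟩)) atTop (𝓝 0)

/-- Markovian forms: positive symmetric forms such that `u ∈ D(F)` implies `u_# ∈ D(F)` and
`F(u_#, u_#) ≤ F(u, u)`. The map `u ↦ u_#` of the Hilbert space `H` is the argument `sharp`. -/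
def IsMarkovian (sharp : H → H) (F : FormOn H) : Prop :=
  F.IsSymm ∧ F.IsNonneg ∧
    ∀ u : F.domain, ∃ h : sharp u ∈ F.domain, F.form ⟨sharp u, h⟩ ⟨sharp u, h⟩ ≤ F.form u u

/-- Dirichlet forms: closed Markovian forms (not necessarily densely defined). -/
def IsDirichlet (sharp : H → H) (F : FormOn H) : Prop := F.IsMarkovian sharp ∧ F.IsClosed

/-- `F` is the form associated with the operator `-A`: it is a densely defined, symmetric, lower
bounded, closed form, and `A u = w` if and only if `u ∈ D(F)` and `F(u, v) = ⟨-w, v⟩` for all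
`v ∈ D(F)`. -/
def IsFormOfNeg (F : FormOn H) (A : H →ₗ.[ℝ] H) : Prop :=
  Dense (F.domain : Set H) ∧ F.IsSymm ∧ F.IsLowerBounded ∧ F.IsClosed ∧
    ∀ u w : H, (u, w) ∈ A.graph ↔
      ∃ hu : u ∈ F.domain, ∀ v : F.domain, F.form ⟨u, hu⟩ v = ⟪-w, (v : H)⟫

end FormOn

/-! ### Self-adjoint and Markovian extensions -/

section Extensions

variable {H : Type*} [NormedAddCommGroup H] [InnerProductSpace ℝ H] [CompleteSpace H]

/-- `T t = e^{tA}`, `t ≥ 0`, is the strongly continuous semigroup with generator `A`. -/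
structure IsSemigroupOf (A : H →ₗ.[ℝ] H) (T : ℝ → H →L[ℝ] H) : Prop where
  zero : T 0 = ContinuousLinearMap.id ℝ H
  add : ∀ s t : ℝ, 0 ≤ s → 0 ≤ t → T (s + t) = (T s).comp (T t)
  continuousOn : ∀ u : H, ContinuousOn (fun t => T t u) (Ici 0)
  generator : ∀ u w : H,
    (u, w) ∈ A.graph ↔ Tendsto (fun t : ℝ => t⁻¹ • (T t u - u)) (𝓝[>] 0) (𝓝 w)

/-- The self-adjoint extensions of `S`. -/
def selfAdjointExt (S : H →ₗ.[ℝ] H) : Set (H →ₗ.[ℝ] H) := {A | S ≤ A ∧ IsSelfAdjoint A}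

variable {X : Type*} [MeasurableSpace X] {μ : Measure X}

/-- A negative self-adjoint operator `A` on `L²(X, μ)` is Markovian if `0 ≤ u ≤ 1` a.e. implies
`0 ≤ e^{tA} u ≤ 1` a.e. for all `t > 0`. (A semigroup is determined by its generator, so there is
exactly one `T` as below.) -/
def IsMarkovianOp (A : Lp ℝ 2 μ →ₗ.[ℝ] Lp ℝ 2 μ) : Prop :=
  IsSelfAdjoint A ∧ (∀ u : A.domain, ⟪A u, (u : Lp ℝ 2 μ)⟫ ≤ 0) ∧
    ∃ T : ℝ → Lp ℝ 2 μ →L[ℝ] Lp ℝ 2 μ, IsSemigroupOf A T ∧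
      ∀ u : Lp ℝ 2 μ, (∀ᵐ x ∂μ, 0 ≤ u x ∧ u x ≤ 1) →
        ∀ t : ℝ, 0 < t → ∀ᵐ x ∂μ, 0 ≤ T t u x ∧ T t u x ≤ 1

/-- The Markovian self-adjoint extensions of `S`. -/
def markovianExt (S : Lp ℝ 2 μ →ₗ.[ℝ] Lp ℝ 2 μ) : Set (Lp ℝ 2 μ →ₗ.[ℝ] Lp ℝ 2 μ) :=
  {A | A ∈ selfAdjointExt S ∧ IsMarkovianOp A}

/-- `u ↦ u_#` on `L²(X, μ)`. -/
def sharpL2 (u : Lp ℝ 2 μ) : Lp ℝ 2 μ := lipschitzWith_cut.compLp cut_zero u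

end Extensions

/-! ### Sobolev spaces and traces on the interval `(0, ℓ)` -/

/-- The real Hilbert space `L²(0, ℓ)`. -/
abbrev L2 (ℓ : ℝ) : Type := Lp ℝ 2 (volume.restrict (Ioo 0 ℓ))

/-- The Euclidean plane `ℝ²`. -/
abbrev E2 : Type := EuclideanSpace ℝ (Fin 2)

/-- `u ↦ u_#` on `ℝ²`, regarded as `L²` of a two-point set with the counting measure. -/
def sharpE2 (ξ : E2) : E2 := WithLp.toLp 2 fun i => cut (ξ i)

/-- The test functions `C_c^∞(0, ℓ)`. -/
structure IsTest (ℓ : ℝ) (φ : ℝ → ℝ) : Prop where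
  contDiff : ContDiff ℝ ∞ φ
  hasCompactSupport : HasCompactSupport φ
  tsupport_subset : tsupport φ ⊆ Ioo 0 ℓ

namespace IsTest

variable {ℓ : ℝ} {φ ψ : ℝ → ℝ}

theorem derivTest (h : IsTest ℓ φ) : IsTest ℓ (deriv φ) where
  contDiff := by
    have := h.contDiff
    exact (contDiff_infty_iff_deriv.1 this).2
  hasCompactSupport := h.hasCompactSupport.deriv
  tsupport_subset := (tsupport_deriv_subset (𝕜 := ℝ)).trans h.tsupport_subset

theorem memLp (h : IsTest ℓ φ) : MemLp φ 2 (volume.restrict (Ioo 0 ℓ)) :=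
  (h.contDiff.continuous.memLp_of_hasCompactSupport h.hasCompactSupport).restrict _

theorem add (h : IsTest ℓ φ) (h' : IsTest ℓ ψ) : IsTest ℓ (φ + ψ) where
  contDiff := h.contDiff.add h'.contDiff
  hasCompactSupport := h.hasCompactSupport.add h'.hasCompactSupport
  tsupport_subset := (tsupport_add φ ψ).trans (union_subset h.tsupport_subset h'.tsupport_subset)

theorem const_smul (c : ℝ) (h : IsTest ℓ φ) : IsTest ℓ (c • φ) where
  contDiff := h.contDiff.const_smul c
  hasCompactSupport := h.hasCompactSupport.smul_left (f := fun _ => c)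
  tsupport_subset := (tsupport_smul_subset_right (fun _ => c) φ).trans h.tsupport_subset

theorem zero : IsTest ℓ 0 where
  contDiff := contDiff_const
  hasCompactSupport := HasCompactSupport.zero
  tsupport_subset := by simp

end IsTest

/-- `w` is the weak (distributional) derivative of `u` on `(0, ℓ)`. -/
def IsWeakDeriv (ℓ : ℝ) (u w : L2 ℓ) : Prop :=
  ∀ φ : ℝ → ℝ, IsTest ℓ φ →
    ∫ x in Ioo 0 ℓ, u x * deriv φ x = -∫ x in Ioo 0 ℓ, w x * φ x

section Weak

variable {ℓ : ℝ}

theorem integrable_mul_test (u : L2 ℓ) {φ : ℝ → ℝ} (h : IsTest ℓ φ) :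
    Integrable (fun x => u x * φ x) (volume.restrict (Ioo 0 ℓ)) :=
  (Lp.memLp u).integrable_mul h.memLp

theorem IsWeakDeriv.add {u u' w w' : L2 ℓ} (h : IsWeakDeriv ℓ u w) (h' : IsWeakDeriv ℓ u' w') :
    IsWeakDeriv ℓ (u + u') (w + w') := by
  intro φ hφ
  have e1 : ∫ x in Ioo 0 ℓ, (u + u' : L2 ℓ) x * deriv φ x
      = ∫ x in Ioo 0 ℓ, (u x * deriv φ x + u' x * deriv φ x) := by
    refine integral_congr_ae ?_
    filter_upwards [Lp.coeFn_add u u'] with x hx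
    rw [hx, Pi.add_apply, add_mul]
  have e2 : ∫ x in Ioo 0 ℓ, (w + w' : L2 ℓ) x * φ x
      = ∫ x in Ioo 0 ℓ, (w x * φ x + w' x * φ x) := by
    refine integral_congr_ae ?_
    filter_upwards [Lp.coeFn_add w w'] with x hx
    rw [hx, Pi.add_apply, add_mul]
  rw [e1, e2, integral_add (integrable_mul_test u hφ.derivTest) (integrable_mul_test u' hφ.derivTest),
    integral_add (integrable_mul_test w hφ) (integrable_mul_test w' hφ), h φ hφ, h' φ hφ]
  ring

theorem IsWeakDeriv.smul (c : ℝ) {u w : L2 ℓ} (h : IsWeakDeriv ℓ u w) :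
    IsWeakDeriv ℓ (c • u) (c • w) := by
  intro φ hφ
  have e1 : ∫ x in Ioo 0 ℓ, (c • u : L2 ℓ) x * deriv φ x
      = ∫ x in Ioo 0 ℓ, c * (u x * deriv φ x) := by
    refine integral_congr_ae ?_
    filter_upwards [Lp.coeFn_smul c u] with x hx
    rw [hx, Pi.smul_apply, smul_eq_mul, mul_assoc]
  have e2 : ∫ x in Ioo 0 ℓ, (c • w : L2 ℓ) x * φ x
      = ∫ x in Ioo 0 ℓ, c * (w x * φ x) := by
    refine integral_congr_ae ?_
    filter_upwards [Lp.coeFn_smul c w] with x hx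
    rw [hx, Pi.smul_apply, smul_eq_mul, mul_assoc]
  rw [e1, e2, integral_const_mul, integral_const_mul, h φ hφ]
  ring

theorem integral_zero_mul (g : ℝ → ℝ) : ∫ x in Ioo 0 ℓ, (0 : L2 ℓ) x * g x = 0 := by
  refine integral_eq_zero_of_ae ?_
  filter_upwards [Lp.coeFn_zero ℝ 2 (volume.restrict (Ioo 0 ℓ))] with x hx
  rw [hx, Pi.zero_apply, zero_mul]

theorem isWeakDeriv_zero : IsWeakDeriv ℓ 0 0 := by
  intro φ hφ
  rw [integral_zero_mul, integral_zero_mul, neg_zero]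

/-- An integrable function on `(0, ℓ)` that is orthogonal to all test functions vanishes. -/
theorem ae_eq_zero_of_test {f : ℝ → ℝ} (hf : IntegrableOn f (Ioo 0 ℓ))
    (h : ∀ φ : ℝ → ℝ, IsTest ℓ φ → ∫ x in Ioo 0 ℓ, f x * φ x = 0) :
    f =ᵐ[volume.restrict (Ioo 0 ℓ)] 0 := by
  have := isOpen_Ioo.ae_eq_zero_of_integral_contDiff_smul_eq_zero (μ := volume)
    hf.locallyIntegrableOn (by
      intro g h1 h2 h3
      refine Eq.trans ?_ (h g ⟨h1, h2, h3⟩)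
      have e := setIntegral_eq_integral_of_forall_compl_eq_zero (μ := volume) (s := Ioo 0 ℓ)
        (f := fun x => g x • f x) (by
          intro x hx
          rw [image_eq_zero_of_notMem_tsupport (fun hx' => hx (h3 hx')), zero_smul])
      rw [← e]
      simp only [smul_eq_mul, mul_comm])
  exact (ae_restrict_iff' measurableSet_Ioo).2 this

theorem integrableOn_coe (u : L2 ℓ) : IntegrableOn (u : ℝ → ℝ) (Ioo 0 ℓ) :=
  (Lp.memLp u).integrable (by norm_num)

theorem IsWeakDeriv.unique {u w w' : L2 ℓ} (h : IsWeakDeriv ℓ u w) (h' : IsWeakDeriv ℓ u w') :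
    w = w' := by
  have h0 : IsWeakDeriv ℓ 0 (w + (-1 : ℝ) • w') := by
    have := h.add (h'.smul (-1))
    simpa using this
  have : w + (-1 : ℝ) • w' = 0 := by
    refine Lp.eq_zero_iff_ae_eq_zero.2 (ae_eq_zero_of_test (integrableOn_coe _) ?_)
    intro φ hφ
    have h1 := h0 φ hφ
    rw [integral_zero_mul] at h1
    linarith
  simpa [← sub_eq_add_neg, sub_eq_zero] using this

/-- A test function with vanishing integral is the derivative of a test function. -/
theorem IsTest.exists_primitive {θ : ℝ → ℝ} (h : IsTest ℓ θ) (h0 : ∫ x, θ x = 0) :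
    ∃ φ, IsTest ℓ φ ∧ deriv φ = θ := by
  obtain ⟨a, b, ha, hb, hab⟩ : ∃ a b : ℝ, 0 < a ∧ b < ℓ ∧ tsupport θ ⊆ Icc a b := by
    rcases (tsupport θ).eq_empty_or_nonempty with he | hne
    · exact ⟨1, ℓ - 1, one_pos, by linarith, by simp [he]⟩
    · obtain ⟨a, ha⟩ := h.hasCompactSupport.isCompact.exists_isLeast hne
      obtain ⟨b, hb⟩ := h.hasCompactSupport.isCompact.exists_isGreatest hne
      exact ⟨a, b, (h.tsupport_subset ha.1).1, (h.tsupport_subset hb.1).2,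
        fun x hx => ⟨ha.2 hx, hb.2 hx⟩⟩
  have hz : ∀ x, x ∉ Icc a b → θ x = 0 := fun x hx =>
    image_eq_zero_of_notMem_tsupport fun hx' => hx (hab hx')
  have hcont := h.contDiff.continuous
  have hd : ∀ x, HasDerivAt (fun x => ∫ t in (0 : ℝ)..x, θ t) (θ x) x := fun x =>
    intervalIntegral.integral_hasDerivAt_right (hcont.intervalIntegrable _ _)
      hcont.stronglyMeasurable.stronglyMeasurableAtFilter hcont.continuousAt
  have hderiv : deriv (fun x => ∫ t in (0 : ℝ)..x, θ t) = θ := funext fun x => (hd x).deriv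
  have hsupp : tsupport (fun x => ∫ t in (0 : ℝ)..x, θ t) ⊆ Icc a b := by
    refine closure_minimal ?_ isClosed_Icc
    intro x hx
    by_contra hx'
    apply hx
    rcases lt_or_ge x a with hxa | hxa
    · refine intervalIntegral.integral_zero_ae (Eventually.of_forall fun t ht => hz t ?_)
      intro ht'
      have := ht.2
      have h3 : max 0 x < a := max_lt ha hxa
      linarith [ht'.1]
    · have hxb : b < x := lt_of_not_ge fun hxb => hx' ⟨hxa, hxb⟩
      refine (intervalIntegral.integral_eq_integral_of_support_subset ?_).trans h0
      intro t ht
      have : t ∈ Icc a b := by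
        by_contra ht'
        exact ht (hz t ht')
      exact ⟨ha.trans_le this.1, this.2.trans hxb.le⟩
  refine ⟨_, ⟨?_, ?_, ?_⟩, hderiv⟩
  · exact contDiff_infty_iff_deriv.2 ⟨fun x => (hd x).differentiableAt, hderiv.symm ▸ h.contDiff⟩
  · exact isCompact_Icc.of_isClosed_subset (isClosed_tsupport _) hsupp
  · exact hsupp.trans fun x hx => ⟨ha.trans_le hx.1, hx.2.trans_lt hb⟩

theorem exists_test_integral_eq_one (hℓ : 0 < ℓ) : ∃ ψ, IsTest ℓ ψ ∧ ∫ x, ψ x = 1 := by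
  let f : ContDiffBump (ℓ / 2) := ⟨ℓ / 8, ℓ / 4, by positivity, by linarith⟩
  refine ⟨f.normed volume, ⟨f.contDiff_normed, f.hasCompactSupport_normed, ?_⟩, f.integral_normed⟩
  rw [f.tsupport_normed_eq, Real.closedBall_eq_Icc]
  intro x hx
  have h1 : ℓ / 2 - ℓ / 4 ≤ x := hx.1
  have h2 : x ≤ ℓ / 2 + ℓ / 4 := hx.2
  exact ⟨by linarith, by linarith⟩

theorem IsTest.setIntegral_eq {ψ : ℝ → ℝ} (h : IsTest ℓ ψ) :
    ∫ x in Ioo 0 ℓ, ψ x = ∫ x, ψ x :=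
  setIntegral_eq_integral_of_forall_compl_eq_zero fun _ hx =>
    image_eq_zero_of_notMem_tsupport fun hx' => hx (h.tsupport_subset hx')

/-- The one-dimensional Sobolev embedding `H¹(0, ℓ) ⊆ C[0, ℓ]`. -/
theorem IsWeakDeriv.exists_continuousOn (hℓ : 0 < ℓ) {u w : L2 ℓ} (h : IsWeakDeriv ℓ u w) :
    ∃ g : ℝ → ℝ, ContinuousOn g (Icc 0 ℓ) ∧ u =ᵐ[volume.restrict (Ioo 0 ℓ)] g := by
  have hw : IntervalIntegrable (w : ℝ → ℝ) volume 0 ℓ :=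
    (intervalIntegrable_iff_integrableOn_Ioo_of_le hℓ.le).2 (integrableOn_coe w)
  set W : ℝ → ℝ := fun x => ∫ t in (0 : ℝ)..x, w t with hW
  have hac : AbsolutelyContinuousOnInterval W 0 ℓ :=
    hw.absolutelyContinuousOnInterval_intervalIntegral left_mem_uIcc
  have hWc : ContinuousOn W (Icc 0 ℓ) := by simpa [uIcc_of_le hℓ.le] using hac.continuousOn
  have hWi : IntegrableOn W (Ioo 0 ℓ) :=
    (hWc.integrableOn_compact isCompact_Icc).mono_set Ioo_subset_Icc_self
  -- `W` has weak derivative `w`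
  have hWw : ∀ φ, IsTest ℓ φ → ∫ x in Ioo 0 ℓ, W x * deriv φ x = -∫ x in Ioo 0 ℓ, w x * φ x := by
    intro φ hφ
    have hφac : AbsolutelyContinuousOnInterval φ 0 ℓ :=
      ((hφ.contDiff.of_le (by exact_mod_cast le_top)).contDiffOn).absolutelyContinuousOnInterval
    have ibp := hac.integral_mul_deriv_eq_deriv_mul hφac
    have z0 : φ 0 = 0 := image_eq_zero_of_notMem_tsupport fun hx =>
      lt_irrefl _ (hφ.tsupport_subset hx).1
    have z1 : φ ℓ = 0 := image_eq_zero_of_notMem_tsupport fun hx =>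
      lt_irrefl _ (hφ.tsupport_subset hx).2
    have e : ∫ x in (0 : ℝ)..ℓ, deriv W x * φ x = ∫ x in (0 : ℝ)..ℓ, w x * φ x := by
      refine intervalIntegral.integral_congr_ae ?_
      filter_upwards [hw.ae_hasDerivAt_integral] with x hx hx'
      rw [(hx (uIoc_subset_uIcc hx') 0 left_mem_uIcc).deriv]
    rw [e, z0, z1, mul_zero, mul_zero, sub_zero, zero_sub,
      intervalIntegral.integral_of_le hℓ.le, intervalIntegral.integral_of_le hℓ.le,
      integral_Ioc_eq_integral_Ioo, integral_Ioc_eq_integral_Ioo] at ibp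
    exact ibp
  obtain ⟨ψ₀, hψ₀, hψ₀1⟩ := exists_test_integral_eq_one hℓ
  have hdiff : IntegrableOn (fun x => u x - W x) (Ioo 0 ℓ) := (integrableOn_coe u).sub hWi
  have hmul : ∀ (f : ℝ → ℝ), IntegrableOn f (Ioo 0 ℓ) → ∀ φ, IsTest ℓ φ →
      IntegrableOn (fun x => f x * φ x) (Ioo 0 ℓ) := by
    intro f hf φ hφ
    obtain ⟨C, hC⟩ := hφ.contDiff.continuous.bounded_above_of_compact_support hφ.hasCompactSupport
    exact Integrable.mul_bdd hf hφ.contDiff.continuous.aestronglyMeasurable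
      (Eventually.of_forall hC)
  set c : ℝ := ∫ x in Ioo 0 ℓ, (u x - W x) * ψ₀ x with hc
  have key : (fun x => u x - W x - c) =ᵐ[volume.restrict (Ioo 0 ℓ)] 0 := by
    refine ae_eq_zero_of_test (hdiff.sub (integrableOn_const (by simp))) ?_
    intro ψ hψ
    set m : ℝ := ∫ x, ψ x with hm
    have hθ : IsTest ℓ (ψ + (-m) • ψ₀) := hψ.add (hψ₀.const_smul _)
    have hψi : Integrable ψ := hψ.contDiff.continuous.integrable_of_hasCompactSupport
      hψ.hasCompactSupport
    have hψ₀i : Integrable ψ₀ := hψ₀.contDiff.continuous.integrable_of_hasCompactSupport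
      hψ₀.hasCompactSupport
    obtain ⟨φ, hφ, hφd⟩ := hθ.exists_primitive (by
      simp only [Pi.add_apply, Pi.smul_apply, smul_eq_mul]
      rw [integral_add hψi (hψ₀i.const_mul _), integral_const_mul, hψ₀1, ← hm]
      ring)
    have e1 : ∫ x in Ioo 0 ℓ, (u x - W x) * deriv φ x = 0 := by
      simp only [sub_mul]
      rw [integral_sub (hmul _ (integrableOn_coe u) _ hφ.derivTest) (hmul _ hWi _ hφ.derivTest),
        h φ hφ, hWw φ hφ, sub_self]
    have e2 : ∫ x in Ioo 0 ℓ, (u x - W x) * deriv φ x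
        = (∫ x in Ioo 0 ℓ, (u x - W x) * ψ x) - m * c := by
      rw [hφd, hc, ← integral_const_mul,
        ← integral_sub (hmul _ hdiff _ hψ) ((hmul _ hdiff _ hψ₀).const_mul m)]
      congr 1
      funext x
      simp only [Pi.add_apply, Pi.smul_apply, smul_eq_mul]
      ring
    have e3 : ∫ x in Ioo 0 ℓ, (u x - W x - c) * ψ x
        = (∫ x in Ioo 0 ℓ, (u x - W x) * ψ x) - c * m := by
      rw [hm, ← hψ.setIntegral_eq, ← integral_const_mul,
        ← integral_sub (hmul _ hdiff _ hψ) (hψi.restrict.const_mul c)]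
      congr 1
      funext x
      ring
    rw [e3]
    linarith
  refine ⟨fun x => W x + c, hWc.add continuousOn_const, ?_⟩
  filter_upwards [key] with x hx
  have : u x - W x - c = 0 := hx
  linarith

end Weak

/-- The Sobolev space `H¹(0, ℓ)`. -/
def H1 (ℓ : ℝ) : Submodule ℝ (L2 ℓ) where
  carrier := {u | ∃ w, IsWeakDeriv ℓ u w}
  add_mem' := fun ⟨w, h⟩ ⟨w', h'⟩ => ⟨w + w', h.add h'⟩
  zero_mem' := ⟨0, isWeakDeriv_zero⟩
  smul_mem' := fun c _ ⟨w, h⟩ => ⟨c • w, h.smul c⟩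

theorem isWeakDeriv_choose {ℓ : ℝ} (u : H1 ℓ) : IsWeakDeriv ℓ u (Classical.choose u.2) :=
  Classical.choose_spec u.2

/-- The weak derivative `d/dx : H¹(0, ℓ) → L²(0, ℓ)`. -/
def weakDeriv (ℓ : ℝ) : H1 ℓ →ₗ[ℝ] L2 ℓ where
  toFun u := Classical.choose u.2
  map_add' u v := (isWeakDeriv_choose (u + v)).unique
    ((isWeakDeriv_choose u).add (isWeakDeriv_choose v))
  map_smul' c u := (isWeakDeriv_choose (c • u)).unique ((isWeakDeriv_choose u).smul c)

theorem isWeakDeriv_weakDeriv {ℓ : ℝ} (u : H1 ℓ) : IsWeakDeriv ℓ u (weakDeriv ℓ u) :=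
  isWeakDeriv_choose u

theorem weakDeriv_eq {ℓ : ℝ} (u : H1 ℓ) {w : L2 ℓ} (h : IsWeakDeriv ℓ u w) :
    weakDeriv ℓ u = w :=
  (isWeakDeriv_choose u).unique h

/-- The Sobolev space `H²(0, ℓ)`: the `u ∈ H¹(0, ℓ)` with `u' ∈ H¹(0, ℓ)`. -/
def H2 (ℓ : ℝ) : Submodule ℝ (L2 ℓ) := ((H1 ℓ).comap (weakDeriv ℓ)).map (H1 ℓ).subtype

theorem H2_le_H1 (ℓ : ℝ) : H2 ℓ ≤ H1 ℓ := Submodule.map_subtype_le _ _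

/-- The inclusion of `H²(0, ℓ)` in `H¹(0, ℓ)`. -/
def H2toH1 (ℓ : ℝ) : H2 ℓ →ₗ[ℝ] H1 ℓ := Submodule.inclusion (H2_le_H1 ℓ)

theorem weakDeriv_mem_H1 {ℓ : ℝ} (u : H2 ℓ) : weakDeriv ℓ (H2toH1 ℓ u) ∈ H1 ℓ := by
  obtain ⟨u, v, hv, rfl⟩ := u
  exact hv

/-- The derivative `d/dx : H²(0, ℓ) → H¹(0, ℓ)`. -/
def derivH2 (ℓ : ℝ) : H2 ℓ →ₗ[ℝ] H1 ℓ :=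
  ((weakDeriv ℓ).comp (H2toH1 ℓ)).codRestrict (H1 ℓ) weakDeriv_mem_H1

/-- The second derivative `d²/dx² : H²(0, ℓ) → L²(0, ℓ)`. -/
def secondDeriv (ℓ : ℝ) : H2 ℓ →ₗ[ℝ] L2 ℓ := (weakDeriv ℓ).comp (derivH2 ℓ)

section Traces

variable (ℓ : ℝ) [hℓ : Fact (0 < ℓ)]

/-- `u ∈ H¹(0, ℓ)` has a continuous representative on `[0, ℓ]`. -/
theorem exists_contRep {ℓ : ℝ} [hℓ : Fact (0 < ℓ)] (u : H1 ℓ) :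
    ∃ g : ℝ → ℝ, ContinuousOn g (Icc 0 ℓ) ∧ (u : L2 ℓ) =ᵐ[volume.restrict (Ioo 0 ℓ)] g :=
  (isWeakDeriv_weakDeriv u).exists_continuousOn hℓ.out

/-- The continuous representative of `u ∈ H¹(0, ℓ)`; its values on `[0, ℓ]` are determined by `u`,
see `contRep_eq`. -/
def contRep {ℓ : ℝ} [Fact (0 < ℓ)] (u : H1 ℓ) : ℝ → ℝ := Classical.choose (exists_contRep u)

theorem contRep_eq {ℓ : ℝ} [hℓ : Fact (0 < ℓ)] (u : H1 ℓ) {g : ℝ → ℝ}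
    (hg : ContinuousOn g (Icc 0 ℓ)) (h : (u : L2 ℓ) =ᵐ[volume.restrict (Ioo 0 ℓ)] g) :
    EqOn (contRep u) g (Icc 0 ℓ) := by
  have hs := Classical.choose_spec (exists_contRep u)
  refine Measure.eqOn_Icc_of_ae_eq volume hℓ.out.ne ?_ hs.1 hg
  rw [← restrict_Ioo_eq_restrict_Icc]
  exact hs.2.symm.trans h

theorem contRep_add {ℓ : ℝ} [Fact (0 < ℓ)] (u v : H1 ℓ) :
    EqOn (contRep (u + v)) (contRep u + contRep v) (Icc 0 ℓ) := by
  have hu := Classical.choose_spec (exists_contRep u)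
  have hv := Classical.choose_spec (exists_contRep v)
  exact contRep_eq _ (hu.1.add hv.1) ((Lp.coeFn_add _ _).trans (hu.2.add hv.2))

theorem contRep_smul {ℓ : ℝ} [Fact (0 < ℓ)] (c : ℝ) (u : H1 ℓ) :
    EqOn (contRep (c • u)) (c • contRep u) (Icc 0 ℓ) := by
  have hu := Classical.choose_spec (exists_contRep u)
  exact contRep_eq _ (hu.1.const_smul c) ((Lp.coeFn_smul _ _).trans (hu.2.const_smul c))

/-- The trace `γ₀ : H¹(0, ℓ) → ℝ²`, `γ₀ u = (u(0), u(ℓ))`. -/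
def γ₀ : H1 ℓ →ₗ[ℝ] E2 where
  toFun u := !₂[contRep u 0, contRep u ℓ]
  map_add' u v := by
    rw [contRep_add u v (left_mem_Icc.2 hℓ.out.le), contRep_add u v (right_mem_Icc.2 hℓ.out.le)]
    ext i
    fin_cases i <;> rfl
  map_smul' c u := by
    rw [contRep_smul c u (left_mem_Icc.2 hℓ.out.le), contRep_smul c u (right_mem_Icc.2 hℓ.out.le)]
    ext i
    fin_cases i <;> rfl

/-- The trace `γ₁ : H²(0, ℓ) → ℝ²`, `γ₁ u = (u'(0), -u'(ℓ))`. -/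
def γ₁ : H2 ℓ →ₗ[ℝ] E2 where
  toFun u := !₂[γ₀ ℓ (derivH2 ℓ u) 0, -γ₀ ℓ (derivH2 ℓ u) 1]
  map_add' u v := by
    rw [map_add, map_add, PiLp.add_apply, PiLp.add_apply, neg_add]
    ext i
    fin_cases i <;> rfl
  map_smul' c u := by
    rw [map_smul, map_smul, PiLp.smul_apply, PiLp.smul_apply, ← smul_neg]
    ext i
    fin_cases i <;> rfl

end Traces

/-! ### The minimal operator -/

/-- `C_c^∞(0, ℓ)` as a subspace of `L²(0, ℓ)`. -/
def testSpace (ℓ : ℝ) : Submodule ℝ (L2 ℓ) where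
  carrier := {u | ∃ φ, IsTest ℓ φ ∧ u =ᵐ[volume.restrict (Ioo 0 ℓ)] φ}
  add_mem' := fun ⟨φ, h, e⟩ ⟨ψ, h', e'⟩ =>
    ⟨φ + ψ, h.add h', (Lp.coeFn_add _ _).trans (e.add e')⟩
  zero_mem' := ⟨0, IsTest.zero, Lp.coeFn_zero _ _ _⟩
  smul_mem' := fun c _ ⟨φ, h, e⟩ =>
    ⟨c • φ, h.const_smul c, (Lp.coeFn_smul _ _).trans (e.const_smul c)⟩

/-- The classical derivative of a test function is its weak derivative. -/
theorem IsTest.isWeakDeriv {ℓ : ℝ} {φ : ℝ → ℝ} (h : IsTest ℓ φ) {u w : L2 ℓ}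
    (hu : u =ᵐ[volume.restrict (Ioo 0 ℓ)] φ) (hw : w =ᵐ[volume.restrict (Ioo 0 ℓ)] deriv φ) :
    IsWeakDeriv ℓ u w := by
  intro ψ hψ
  have e1 : ∫ x in Ioo 0 ℓ, u x * deriv ψ x = ∫ x, φ x * deriv ψ x := by
    rw [← setIntegral_eq_integral_of_forall_compl_eq_zero (s := Ioo 0 ℓ)
      (f := fun x => φ x * deriv ψ x)]
    · refine integral_congr_ae ?_
      filter_upwards [hu] with x hx
      rw [hx]
    · intro x hx
      rw [image_eq_zero_of_notMem_tsupport (fun hx' => hx (h.tsupport_subset hx')), zero_mul]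
  have e2 : ∫ x in Ioo 0 ℓ, w x * ψ x = ∫ x, deriv φ x * ψ x := by
    rw [← setIntegral_eq_integral_of_forall_compl_eq_zero (s := Ioo 0 ℓ)
      (f := fun x => deriv φ x * ψ x)]
    · refine integral_congr_ae ?_
      filter_upwards [hw] with x hx
      rw [hx]
    · intro x hx
      rw [image_eq_zero_of_notMem_tsupport (fun hx' => hx (hψ.tsupport_subset hx')), mul_zero]
  rw [e1, e2]
  have dφ : Differentiable ℝ φ := h.contDiff.differentiable (by simp)
  have dψ : Differentiable ℝ ψ := hψ.contDiff.differentiable (by simp)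
  refine integral_mul_deriv_eq_deriv_mul_of_integrable (fun x _ => (dφ x).hasDerivAt)
    (fun x _ => (dψ x).hasDerivAt) ?_ ?_ ?_
  · exact (h.contDiff.continuous.mul hψ.derivTest.contDiff.continuous).integrable_of_hasCompactSupport
      h.hasCompactSupport.mul_right
  · exact (h.derivTest.contDiff.continuous.mul hψ.contDiff.continuous).integrable_of_hasCompactSupport
      hψ.hasCompactSupport.mul_left
  · exact (h.contDiff.continuous.mul hψ.contDiff.continuous).integrable_of_hasCompactSupport
      h.hasCompactSupport.mul_right

theorem testSpace_le_H2 (ℓ : ℝ) : testSpace ℓ ≤ H2 ℓ := by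
  rintro u ⟨φ, h, hu⟩
  have h1 : IsWeakDeriv ℓ u h.derivTest.memLp.toLp := h.isWeakDeriv hu (MemLp.coeFn_toLp _)
  have h2 : IsWeakDeriv ℓ h.derivTest.memLp.toLp h.derivTest.derivTest.memLp.toLp :=
    h.derivTest.isWeakDeriv (MemLp.coeFn_toLp _) (MemLp.coeFn_toLp _)
  refine ⟨⟨u, _, h1⟩, ?_, rfl⟩
  have : weakDeriv ℓ ⟨u, _, h1⟩ = h.derivTest.memLp.toLp := weakDeriv_eq _ h1
  change weakDeriv ℓ ⟨u, _, h1⟩ ∈ H1 ℓ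
  rw [this]
  exact ⟨_, h2⟩

/-- The minimal realization `A_min u = u''`, `D(A_min) = C_c^∞(0, ℓ)`, of `d²/dx²`. -/
def minimalOp (ℓ : ℝ) : L2 ℓ →ₗ.[ℝ] L2 ℓ where
  domain := testSpace ℓ
  toFun := (secondDeriv ℓ).comp (Submodule.inclusion (testSpace_le_H2 ℓ))

/-! ### The extensions and their forms -/

/-- The set `E(ℝ²)` of couples `(Π, B)`, with `Π` an orthogonal projection in `ℝ²` and `B` a
self-adjoint operator in the range of `Π`. -/
structure Couple where
  proj : E2 →L[ℝ] E2
  isStarProjection : IsStarProjection proj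
  op : proj.range →ₗ[ℝ] proj.range
  isSymmetric : op.IsSymmetric

namespace Couple

/-- The form `f_{Π,B}(ξ, ζ) = ⟨B ξ, ζ⟩` on `ℝ²`, with domain the range of `Π`. -/
def form (p : Couple) : FormOn E2 where
  domain := p.proj.range
  form := (innerₗ p.proj.range).comp p.op

/-- The unit vectors `e₀ = (1/√2, 1/√2)`, `e₁ = (1, 0)`, `e₂ = (0, 1)`. -/
def e : Fin 3 → E2 := ![!₂[1 / √2, 1 / √2], !₂[1, 0], !₂[0, 1]]

/-- One of the following holds: `Π = 0`; or `Π = 1` and `B` is a symmetric matrix `(bᵢⱼ)` with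
`b₁₁ + b₁₂ ≥ 0`, `b₁₂ + b₂₂ ≥ 0`, `b₁₂ ≤ 0`; or `Π = v ⊗ v` with `v ∈ {e₀, e₁, e₂}` and `B` is
the multiplication by a number `b ≥ 0`. -/
def IsAdmissible (p : Couple) : Prop :=
  p.proj = 0 ∨
  (p.proj = ContinuousLinearMap.id ℝ E2 ∧ ∃ b₁₁ b₁₂ b₂₂ : ℝ,
    (∀ ξ : p.proj.range, (p.op ξ : E2) =
      !₂[b₁₁ * (ξ : E2) 0 + b₁₂ * (ξ : E2) 1, b₁₂ * (ξ : E2) 0 + b₂₂ * (ξ : E2) 1]) ∧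
    0 ≤ b₁₁ + b₁₂ ∧ 0 ≤ b₁₂ + b₂₂ ∧ b₁₂ ≤ 0) ∨
  (∃ i : Fin 3, p.proj = InnerProductSpace.rankOne ℝ (e i) (e i) ∧
    ∃ b : ℝ, 0 ≤ b ∧ ∀ ξ : p.proj.range, p.op ξ = b • ξ)

variable (ℓ : ℝ) [hℓ : Fact (0 < ℓ)]

/-- The boundary conditions `γ₀ u ∈ R(Π)`, `Π γ₁ u = B γ₀ u`, for `u ∈ H²(0, ℓ)`. -/
def bcSpace (p : Couple) : Submodule ℝ (H2 ℓ) where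
  carrier := {u | ∃ h : γ₀ ℓ (H2toH1 ℓ u) ∈ p.proj.range,
    p.proj (γ₁ ℓ u) = p.op ⟨γ₀ ℓ (H2toH1 ℓ u), h⟩}
  add_mem' := by
    rintro u v ⟨hu, eu⟩ ⟨hv, ev⟩
    have h : γ₀ ℓ (H2toH1 ℓ (u + v)) ∈ p.proj.range := by
      rw [map_add, map_add]
      exact add_mem hu hv
    refine ⟨h, ?_⟩
    have : (⟨γ₀ ℓ (H2toH1 ℓ (u + v)), h⟩ : p.proj.range) = ⟨_, hu⟩ + ⟨_, hv⟩ :=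
      Subtype.ext (by simp)
    rw [this, map_add, map_add, map_add, eu, ev, Submodule.coe_add]
  zero_mem' := by
    have h : γ₀ ℓ (H2toH1 ℓ 0) ∈ p.proj.range := by
      rw [map_zero, map_zero]
      exact zero_mem _
    refine ⟨h, ?_⟩
    have : (⟨γ₀ ℓ (H2toH1 ℓ 0), h⟩ : p.proj.range) = 0 := Subtype.ext (by simp)
    rw [this, map_zero, map_zero, map_zero, Submodule.coe_zero]
  smul_mem' := by
    rintro c u ⟨hu, eu⟩
    have h : γ₀ ℓ (H2toH1 ℓ (c • u)) ∈ p.proj.range := by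
      rw [map_smul, map_smul]
      exact Submodule.smul_mem _ c hu
    refine ⟨h, ?_⟩
    have : (⟨γ₀ ℓ (H2toH1 ℓ (c • u)), h⟩ : p.proj.range) = c • ⟨_, hu⟩ := Subtype.ext (by simp)
    rw [this, map_smul, map_smul, map_smul, eu, Submodule.coe_smul]

/-- The operator `Ã_{(Π,B)} u = u''` with domain
`{u ∈ H²(0, ℓ) : γ₀ u ∈ R(Π), Π γ₁ u = B γ₀ u}`. -/
def extension (p : Couple) : L2 ℓ →ₗ.[ℝ] L2 ℓ where
  domain := (p.bcSpace ℓ).map (H2 ℓ).subtype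
  toFun := (secondDeriv ℓ).comp (Submodule.inclusion (Submodule.map_subtype_le _ _))

end Couple

/-- The form `F_N(u, v) = ⟨u', v'⟩`, `D(F_N) = H¹(0, ℓ)`. -/
def neumannForm (ℓ : ℝ) : FormOn (L2 ℓ) where
  domain := H1 ℓ
  form := (innerₗ (L2 ℓ)).compl₁₂ (weakDeriv ℓ) (weakDeriv ℓ)

section PlusTrace

variable (ℓ : ℝ) [hℓ : Fact (0 < ℓ)] (f : FormOn E2)

/-- The subspace `{u ∈ H¹(0, ℓ) : γ₀ u ∈ D(f)}` of `L²(0, ℓ)`. -/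
def traceDomain : Submodule ℝ (L2 ℓ) := (f.domain.comap (γ₀ ℓ)).map (H1 ℓ).subtype

/-- The inclusion `{u ∈ H¹(0, ℓ) : γ₀ u ∈ D(f)} → H¹(0, ℓ)`. -/
def traceDomainToH1 : traceDomain ℓ f →ₗ[ℝ] H1 ℓ :=
  Submodule.inclusion (Submodule.map_subtype_le _ _)

theorem γ₀_mem_domain (u : traceDomain ℓ f) : γ₀ ℓ (traceDomainToH1 ℓ f u) ∈ f.domain := by
  obtain ⟨u, v, hv, rfl⟩ := u
  exact hv

/-- The trace `γ₀ : {u ∈ H¹(0, ℓ) : γ₀ u ∈ D(f)} → D(f)`. -/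
def traceToDomain : traceDomain ℓ f →ₗ[ℝ] f.domain :=
  ((γ₀ ℓ).comp (traceDomainToH1 ℓ f)).codRestrict f.domain (γ₀_mem_domain ℓ f)

/-- The form `F_N(u, v) + f(γ₀ u, γ₀ v)`, with domain `{u ∈ H¹(0, ℓ) : γ₀ u ∈ D(f)}`. -/
def neumannPlusTrace : FormOn (L2 ℓ) where
  domain := traceDomain ℓ f
  form := (neumannForm ℓ).form.compl₁₂ (traceDomainToH1 ℓ f) (traceDomainToH1 ℓ f) +
    f.form.compl₁₂ (traceToDomain ℓ f) (traceToDomain ℓ f)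

end PlusTrace

end IntervalMarkov

end

open IntervalMarkov

/-!
The extensions are described by boundary relations, and the Markov property is read off from forms.

* Boundary conditions. A distributional solution `u ∈ L²(0, ℓ)` of `u'' = w` is in `H²(0, ℓ)`
  (`mem_H2_of_test`), so every self-adjoint extension of the minimal operator is a restriction of
  `d²/dx²` on `H²(0, ℓ)`. By Green's formula (`inner_secondDeriv_sub`) and the joint surjectivity of
  the traces (`exists_H2_traces`), such a restriction is self-adjoint exactly when the traces
  `(γ₀ u, γ₁ u)` of its domain form a Lagrangian subspace of `ℝ² × ℝ²`. The Lagrangian subspaces are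
  the relations `ξ ∈ R(Π)`, `Π η = B ξ` (`boundaryRel_iff`, `exists_of_lagrangian`). This gives
  `isSelfAdjoint_extension` and `exists_eq_extension`. The trace inequality `exists_norm_γ₀_sq_le`
  shows that the boundary term is a small perturbation of the Dirichlet integral, which makes
  `F_N + f` closed and lower bounded, and Green's formula identifies it as the form of the
  extension (`isFormOfNeg_extension`).

* Beurling–Deny. A self-adjoint `A ≤ 0` is Markovian if and only if its form is Markovian. If `F` is
  Markovian, then the resolvent vector `v = l (l - A)⁻¹ g` is the unique minimizer of
  `F(s, s) + l ‖s - g‖²`, and for `0 ≤ g ≤ 1` cutting `v` does not increase this functional; hence the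
  resolvents preserve the closed convex set `{0 ≤ u ≤ 1}`. The exponentials of the Yosida
  approximations are convex combinations of powers of resolvents, so the semigroup they converge to
  (`IsResolventFamily.exists_semigroup`) preserves that set as well. Conversely, invariance under the
  semigroup passes to the resolvents by looking at the time derivative of the semigroup at a
  resolvent vector (`IsSemigroupOf.resolvent_mem`), and the form is the increasing limit of
  `l ⟨u - l (l - A)⁻¹ u, u⟩`, each of which decreases when `u` is cut (`IsFormOfNeg.isMarkovian`).

* Admissibility. Cutting a function of `H¹(0, ℓ)` decreases its Dirichlet integral and commutes with
  the trace, so `F_N + f` is a Dirichlet form if `f` is. Conversely, every `ξ ∈ ℝ²` is the trace of a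
  function for which cutting gains at most `9/ℓ ‖ξ - ξ_#‖²` in the Dirichlet integral
  (`exists_H1_sharp_cheap`). If `F_N + f` is Markovian, then `f` is thus Markovian up to an error of
  second order in the distance of `ξ` to the unit square. Admissibility is a first order condition:
  testing with vectors such as `(1 + s, 1)` and `(1, -s)` and letting `s → 0` yields the
  inequalities on `B` (`Couple.IsAlmostMarkovian.isAdmissible`), and admissible couples have
  Dirichlet forms by an explicit decomposition into squares. So the properties "`F_N + f` is
  Dirichlet", "`f` is Dirichlet" and "`(Π, B)` is admissible" are equivalent.
-/

/-! ### Resolvents of dissipative self-adjoint operators -/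

namespace IntervalMarkov

section Resolvent

variable {H : Type*} [NormedAddCommGroup H] [InnerProductSpace ℝ H]
  {A : H →ₗ.[ℝ] H}

theorem mem_graph_iff_of_isSelfAdjoint [CompleteSpace H] (hA : IsSelfAdjoint A) (u w : H) :
    (u, w) ∈ A.graph ↔ ∀ a b, (a, b) ∈ A.graph → ⟪b, u⟫ = ⟪a, w⟫ := by
  have h := LinearPMap.adjoint_graph_eq_graph_adjoint hA.dense_domain
  rw [LinearPMap.isSelfAdjoint_def.1 hA] at h
  conv_lhs => rw [h, Submodule.mem_adjoint_iff]
  simp only [sub_eq_zero]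

theorem isSelfAdjoint_of_mem_graph_iff [CompleteSpace H] (hd : Dense (A.domain : Set H))
    (h : ∀ u w : H, (u, w) ∈ A.graph ↔ ∀ a b, (a, b) ∈ A.graph → ⟪b, u⟫ = ⟪a, w⟫) :
    IsSelfAdjoint A := by
  rw [LinearPMap.isSelfAdjoint_def]
  apply LinearPMap.eq_of_eq_graph
  rw [LinearPMap.adjoint_graph_eq_graph_adjoint hd]
  ext ⟨u, w⟩
  rw [Submodule.mem_adjoint_iff, h]
  simp only [sub_eq_zero]

/-- `A` is dissipative: `⟨A u, u⟩ ≤ 0` on the domain, expressed on the graph. -/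
def IsDissipative (A : H →ₗ.[ℝ] H) : Prop := ∀ u w : H, (u, w) ∈ A.graph → ⟪w, u⟫ ≤ 0

theorem isDissipative_iff : IsDissipative A ↔ ∀ u : A.domain, ⟪A u, (u : H)⟫ ≤ 0 := by
  refine ⟨fun h u => h _ _ (A.mem_graph u), fun h u w huw => ?_⟩
  obtain ⟨y, rfl, rfl⟩ := (LinearPMap.mem_graph_iff A).1 huw
  exact h y

/-- `J = l (l - A)⁻¹`: the vector `J g` solves `A v = l (v - g)`. -/
def IsResolvent (A : H →ₗ.[ℝ] H) (l : ℝ) (J : H →L[ℝ] H) : Prop :=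
  ∀ g : H, (J g, l • (J g - g)) ∈ A.graph

theorem resolvent_norm_le (hd : IsDissipative A) {l : ℝ} (hl : 0 < l) {v g : H}
    (h : (v, l • (v - g)) ∈ A.graph) : ‖v‖ ≤ ‖g‖ := by
  have h1 := hd _ _ h
  rw [inner_smul_left, inner_sub_left, real_inner_self_eq_norm_sq] at h1
  have h2 : ‖v‖ ^ 2 - ⟪g, v⟫ ≤ 0 := by
    by_contra! h3
    have := mul_pos hl h3
    simp at h1
    linarith
  have h3 := real_inner_le_norm g v
  by_contra! h4
  have : 0 < ‖v‖ := (norm_nonneg g).trans_lt h4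
  nlinarith

theorem resolvent_unique (hd : IsDissipative A) {l : ℝ} (hl : 0 < l) {v v' g : H}
    (h : (v, l • (v - g)) ∈ A.graph) (h' : (v', l • (v' - g)) ∈ A.graph) : v = v' := by
  have h2 : (v - v', l • ((v - v') - 0)) ∈ A.graph := by
    have := A.graph.sub_mem h h'
    rwa [Prod.mk_sub_mk, ← smul_sub, sub_sub_sub_cancel_right, ← sub_zero (l • (v - v')),
      ← smul_zero l, ← smul_sub] at this
  have := resolvent_norm_le hd hl h2
  rw [norm_zero, norm_le_zero_iff, sub_eq_zero] at this
  exact this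

/-- A dissipative self-adjoint operator is maximal dissipative: the range of `l - A` is closed by
dissipativity, and a vector orthogonal to it is an eigenvector for `l > 0`. -/
theorem exists_resolvent_apply [CompleteSpace H] (hA : IsSelfAdjoint A) (hd : IsDissipative A)
    {l : ℝ} (hl : 0 < l) (g : H) : ∃ v, (v, l • (v - g)) ∈ A.graph := by
  have hcl : IsClosed (A.graph : Set (H × H)) := hA.isClosed
  have : CompleteSpace A.graph := hcl.completeSpace_coe
  set f : A.graph →L[ℝ] H :=
    ((ContinuousLinearMap.fst ℝ H H) - l⁻¹ • ContinuousLinearMap.snd ℝ H H).comp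
      A.graph.subtypeL with hf
  have hfa : ∀ p : A.graph, f p = p.1.1 - l⁻¹ • p.1.2 := fun p => rfl
  have hmem : ∀ p : A.graph, (p.1.1, l • (p.1.1 - f p)) ∈ A.graph := by
    intro p
    rw [hfa, sub_sub_cancel, smul_inv_smul₀ hl.ne']
    exact p.2
  have hb : ∀ p : A.graph, ‖p‖ ≤ (1 + 2 * l) * ‖f p‖ := by
    intro p
    have h1 := resolvent_norm_le hd hl (hmem p)
    have h2 : p.1.2 = l • (p.1.1 - f p) := by
      rw [hfa, sub_sub_cancel, smul_inv_smul₀ hl.ne']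
    have h3 : ‖p.1.2‖ ≤ 2 * l * ‖f p‖ := by
      rw [h2, norm_smul, Real.norm_of_nonneg hl.le]
      have := norm_sub_le p.1.1 (f p)
      nlinarith
    have h4 := norm_nonneg (f p)
    change max ‖p.1.1‖ ‖p.1.2‖ ≤ _
    refine max_le ?_ ?_ <;> nlinarith
  have hanti : AntilipschitzWith (1 + 2 * l).toNNReal f := by
    refine f.antilipschitz_of_bound fun p => ?_
    rw [Real.coe_toNNReal _ (by positivity)]
    exact hb p
  have hrc : IsClosed (f.range : Set H) := by
    have := hanti.isClosed_range f.uniformContinuous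
    rwa [LinearMap.coe_range]
  have : CompleteSpace f.range := hrc.completeSpace_coe
  have htop : f.range = ⊤ := by
    rw [← Submodule.orthogonal_eq_bot_iff, Submodule.eq_bot_iff]
    intro z hz
    have hz' : (z, l • (z - 0)) ∈ A.graph := by
      rw [mem_graph_iff_of_isSelfAdjoint hA]
      intro a b hab
      have := (Submodule.mem_orthogonal _ _).1 hz (f ⟨(a, b), hab⟩) ⟨_, rfl⟩
      rw [hfa, inner_sub_left, inner_smul_left, sub_eq_zero] at this
      rw [sub_zero, inner_smul_right, this]
      simp [hl.ne']
    simpa using resolvent_norm_le hd hl hz'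
  obtain ⟨p, hp⟩ : g ∈ f.range := htop ▸ Submodule.mem_top
  refine ⟨p.1.1, ?_⟩
  have := hmem p
  rwa [show f p = g from hp] at this

theorem exists_isResolvent [CompleteSpace H] (hA : IsSelfAdjoint A) (hd : IsDissipative A)
    {l : ℝ} (hl : 0 < l) : ∃ J : H →L[ℝ] H, IsResolvent A l J ∧ ‖J‖ ≤ 1 := by
  choose J hJ using exists_resolvent_apply hA hd hl
  let J' : H →ₗ[ℝ] H :=
    { toFun := J
      map_add' := fun g g' => resolvent_unique hd hl (hJ _) (by
        have := A.graph.add_mem (hJ g) (hJ g')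
        rwa [Prod.mk_add_mk, ← smul_add, sub_add_sub_comm] at this)
      map_smul' := fun c g => resolvent_unique hd hl (hJ _) (by
        have := A.graph.smul_mem c (hJ g)
        rwa [Prod.smul_mk, smul_comm, smul_sub] at this) }
  have hb : ∀ g, ‖J' g‖ ≤ 1 * ‖g‖ := fun g => by
    rw [one_mul]
    exact resolvent_norm_le hd hl (hJ g)
  exact ⟨J'.mkContinuous 1 hb, hJ, LinearMap.mkContinuous_norm_le _ zero_le_one hb⟩

end Resolvent

end IntervalMarkov

/-! ### Yosida approximations -/

namespace IntervalMarkov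

section HilleYosida

variable {H : Type*} [NormedAddCommGroup H] [InnerProductSpace ℝ H]
  {A : H →ₗ.[ℝ] H}

/-- A dissipative, densely defined `A` together with contractions `J l = l (l - A)⁻¹`, `l > 0`. -/
structure IsResolventFamily (A : H →ₗ.[ℝ] H) (J : ℝ → H →L[ℝ] H) : Prop where
  dissipative : IsDissipative A
  dense : Dense (A.domain : Set H)
  resolvent : ∀ l, 0 < l → IsResolvent A l (J l)
  norm_le : ∀ l, 0 < l → ‖J l‖ ≤ 1

theorem exists_isResolventFamily [CompleteSpace H] (hA : IsSelfAdjoint A)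
    (hd : IsDissipative A) : ∃ J, IsResolventFamily A J := by
  choose! J hJ using fun l : ℝ => fun hl : 0 < l => exists_isResolvent hA hd hl
  exact ⟨J, hd, hA.dense_domain, fun l hl => (hJ l hl).1, fun l hl => (hJ l hl).2⟩

/-- The Yosida approximation `l (J - 1)` of the operator with resolvent `J = l (l - A)⁻¹`. -/
noncomputable def yosida (l : ℝ) (J : H →L[ℝ] H) : H →L[ℝ] H := l • (J - 1)

theorem yosida_apply (l : ℝ) (J : H →L[ℝ] H) (u : H) : yosida l J u = l • (J u - u) := rfl

/-- The semigroup of a Yosida approximation is a convex combination of the powers of the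
resolvent. -/
theorem exp_yosida_mem [CompleteSpace H] {J : H →L[ℝ] H} {K : Set H} (hK : Convex ℝ K)
    (hKc : IsClosed K) (hJ : ∀ k ∈ K, J k ∈ K) {l t : ℝ} (hl : 0 < l) (ht : 0 ≤ t) {k : H}
    (hk : k ∈ K) : NormedSpace.exp (t • yosida l J) k ∈ K := by
  let _ : NormedAlgebra ℚ (H →L[ℝ] H) := NormedAlgebra.restrictScalars ℚ ℝ _
  set c : ℝ := t * l with hc
  have hc0 : 0 ≤ c := by positivity
  have e1 : NormedSpace.exp (t • yosida l J) = Real.exp (-c) • NormedSpace.exp (c • J) := by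
    have h1 : t • yosida l J = algebraMap ℝ (H →L[ℝ] H) (-c) + c • J := by
      rw [yosida, smul_smul, smul_sub, Algebra.algebraMap_eq_smul_one, neg_smul]
      abel
    rw [h1, NormedSpace.exp_add_of_commute (Algebra.commute_algebraMap_left _ _),
      ← NormedSpace.algebraMap_exp_comm, ← Real.exp_eq_exp_ℝ, ← Algebra.smul_def]
  have e2 : HasSum (fun n : ℕ => (c ^ n / n.factorial) • (J ^ n) k) (NormedSpace.exp (c • J) k) := by
    have := (NormedSpace.exp_series_hasSum_exp' (𝕂 := ℝ) (c • J)).mapL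
      (ContinuousLinearMap.apply ℝ H k)
    refine this.congr_fun fun n => ?_
    simp [smul_pow, smul_smul, div_eq_inv_mul]
  have e3 : HasSum (fun n : ℕ => c ^ n / n.factorial) (Real.exp c) := by
    rw [Real.exp_eq_exp_ℝ]
    exact NormedSpace.expSeries_div_hasSum_exp c
  have hpow : ∀ n : ℕ, (J ^ n) k ∈ K := by
    intro n
    induction n with
    | zero => simpa using hk
    | succ n ih =>
      rw [pow_succ']
      exact hJ _ ih
  have hlim := (e3.tendsto_sum_nat.inv₀ (Real.exp_pos c).ne').smul e2.tendsto_sum_nat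
  rw [e1, smul_apply, Real.exp_neg]
  refine hKc.mem_of_tendsto hlim (eventually_atTop.2 ⟨1, fun N hN => ?_⟩)
  refine hK.centerMass_mem (fun i _ => by positivity) ?_ fun i _ => hpow i
  refine Finset.sum_pos' (fun i _ => by positivity) ⟨0, Finset.mem_range.2 hN, by simp⟩

namespace IsResolventFamily

variable {J : ℝ → H →L[ℝ] H}

theorem apply_sub (R : IsResolventFamily A J) {l : ℝ} (hl : 0 < l) {u w : H}
    (h : (u, w) ∈ A.graph) : J l (u - l⁻¹ • w) = u := by
  refine resolvent_unique R.dissipative hl (R.resolvent l hl _) ?_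
  rwa [sub_sub_cancel, smul_inv_smul₀ hl.ne']

theorem norm_apply_le (R : IsResolventFamily A J) {l : ℝ} (hl : 0 < l) (g : H) :
    ‖J l g‖ ≤ ‖g‖ := by
  simpa using (J l).le_of_opNorm_le (R.norm_le l hl) g

theorem yosida_eq (R : IsResolventFamily A J) {l : ℝ} (hl : 0 < l) {u w : H}
    (h : (u, w) ∈ A.graph) : yosida l (J l) u = J l w := by
  have := R.apply_sub hl h
  rw [map_sub, map_smul, sub_eq_iff_eq_add] at this
  rw [yosida_apply, this, add_sub_cancel_left, smul_inv_smul₀ hl.ne']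

theorem map_mem_graph (R : IsResolventFamily A J) {l : ℝ} (hl : 0 < l) {u w : H}
    (h : (u, w) ∈ A.graph) : (J l u, J l w) ∈ A.graph := by
  rw [← R.yosida_eq hl h, yosida_apply]
  exact R.resolvent l hl u

theorem commute (R : IsResolventFamily A J) {l m : ℝ} (hl : 0 < l) (hm : 0 < m) :
    Commute (J l) (J m) := by
  ext g
  have h1 := R.map_mem_graph hl (R.resolvent m hm g)
  have h2 := R.apply_sub hm h1
  rw [map_smul (J l), inv_smul_smul₀ hm.ne', ← map_sub (J l), sub_sub_cancel] at h2
  exact h2.symm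

theorem commute_yosida (R : IsResolventFamily A J) {l m : ℝ} (hl : 0 < l) (hm : 0 < m) :
    Commute (yosida l (J l)) (yosida m (J m)) := by
  refine Commute.smul_left (Commute.smul_right ?_ _) _
  exact ((R.commute hl hm).sub_right (Commute.one_right _)).sub_left
    ((Commute.one_left _).sub_right (Commute.one_right _))

theorem tendsto_apply (R : IsResolventFamily A J) (g : H) :
    Tendsto (fun n : ℕ => J (n + 1) g) atTop (𝓝 g) := by
  rw [Metric.tendsto_atTop]
  intro ε hε
  obtain ⟨u, hu, hgu⟩ := R.dense.exists_dist_lt g (show 0 < ε / 3 by positivity)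
  obtain ⟨N, hN⟩ := exists_nat_gt (‖A ⟨u, hu⟩‖ / (ε / 3))
  refine ⟨N, fun n hn => ?_⟩
  have hl : (0 : ℝ) < n + 1 := by positivity
  have h1 : ‖J (n + 1) u - u‖ < ε / 3 := by
    have h2 := R.yosida_eq hl (A.mem_graph ⟨u, hu⟩)
    rw [yosida_apply] at h2
    have h3 : (n + 1 : ℝ) * ‖J (n + 1) u - u‖ ≤ ‖A ⟨u, hu⟩‖ := by
      have := R.norm_apply_le hl (A ⟨u, hu⟩)
      rwa [← h2, norm_smul, Real.norm_of_nonneg hl.le] at this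
    rw [div_lt_iff₀ (by positivity)] at hN
    have h4 : (N : ℝ) ≤ n := by exact_mod_cast hn
    by_contra! h5
    nlinarith
  have h2 := R.norm_apply_le hl (g - u)
  rw [dist_eq_norm] at hgu ⊢
  have h3 : J (n + 1) g - g = J (n + 1) (g - u) + (J (n + 1) u - u) - (g - u) := by
    rw [map_sub]; abel
  rw [h3]
  have h4 := norm_sub_le (J (n + 1) (g - u) + (J (n + 1) u - u)) (g - u)
  have h5 := norm_add_le (J (n + 1) (g - u)) (J (n + 1) u - u)
  linarith

theorem tendsto_yosida (R : IsResolventFamily A J) {u w : H} (h : (u, w) ∈ A.graph) :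
    Tendsto (fun n : ℕ => yosida (n + 1) (J (n + 1)) u) atTop (𝓝 w) :=
  (R.tendsto_apply w).congr fun n => (R.yosida_eq (by positivity) h).symm

variable [CompleteSpace H]

theorem norm_exp_apply_le (R : IsResolventFamily A J) {l t : ℝ} (hl : 0 < l) (ht : 0 ≤ t)
    (u : H) : ‖NormedSpace.exp (t • yosida l (J l)) u‖ ≤ ‖u‖ := by
  have := exp_yosida_mem (J := J l) (convex_closedBall (0 : H) ‖u‖) Metric.isClosed_closedBall
    (fun k hk => by
      rw [mem_closedBall_zero_iff] at hk ⊢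
      exact (R.norm_apply_le hl k).trans hk) hl ht (k := u) (by simp)
  simpa using this

theorem hasDerivAt_exp_apply (B : H →L[ℝ] H) (u : H) (t : ℝ) :
    HasDerivAt (fun s : ℝ => NormedSpace.exp (s • B) u) (NormedSpace.exp (t • B) (B u)) t := by
  have := (hasDerivAt_exp_smul_const B t).clm_apply (hasDerivAt_const t u)
  simpa using this

/-- Duhamel's estimate for the semigroups of two Yosida approximations. -/
theorem norm_exp_sub_exp_le (R : IsResolventFamily A J) {l m t : ℝ} (hl : 0 < l) (hm : 0 < m)
    (ht : 0 ≤ t) (u : H) :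
    ‖NormedSpace.exp (t • yosida l (J l)) u - NormedSpace.exp (t • yosida m (J m)) u‖ ≤
      t * ‖yosida l (J l) u - yosida m (J m) u‖ := by
  set B := yosida l (J l) with hB
  set C := yosida m (J m) with hC
  have hcomm : Commute B C := R.commute_yosida hl hm
  have hd : ∀ s : ℝ, HasDerivAt
      (fun s : ℝ => NormedSpace.exp (s • B) (NormedSpace.exp ((t - s) • C) u))
      (NormedSpace.exp (s • B) (NormedSpace.exp ((t - s) • C) (B u - C u))) s := by
    intro s
    have h1 := hasDerivAt_exp_smul_const B s
    have h2 : HasDerivAt (fun s : ℝ => NormedSpace.exp ((t - s) • C) u)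
        ((-1 : ℝ) • NormedSpace.exp ((t - s) • C) (C u)) s :=
      (hasDerivAt_exp_apply C u (t - s)).scomp s ((hasDerivAt_id s).const_sub t)
    refine (h1.clm_apply h2).congr_deriv ?_
    have h3 : B (NormedSpace.exp ((t - s) • C) u) = NormedSpace.exp ((t - s) • C) (B u) := by
      have := (hcomm.smul_right (t - s)).exp_right
      exact DFunLike.congr_fun this u
    simp only [map_sub, map_neg, mul_apply_eq_comp, h3, neg_smul, one_smul]
    abel
  have := Convex.norm_image_sub_le_of_norm_hasDerivWithin_le (s := Icc 0 t) (x := 0) (y := t)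
    (fun s _ => (hd s).hasDerivWithinAt) (C := ‖B u - C u‖) (fun s hs => by
      refine (R.norm_exp_apply_le hl hs.1 _).trans (R.norm_exp_apply_le hm ?_ _)
      linarith [hs.2]) (convex_Icc 0 t) ⟨le_rfl, ht⟩ ⟨ht, le_rfl⟩
  simp only [sub_self, zero_smul, NormedSpace.exp_zero, sub_zero] at this
  rw [Real.norm_of_nonneg ht, mul_comm] at this
  exact this

theorem norm_exp_sub_le (R : IsResolventFamily A J) {l t : ℝ} (hl : 0 < l) (ht : 0 ≤ t) (u : H) :
    ‖NormedSpace.exp (t • yosida l (J l)) u - u‖ ≤ t * ‖yosida l (J l) u‖ := by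
  have := Convex.norm_image_sub_le_of_norm_hasDerivWithin_le (s := Icc 0 t) (x := 0) (y := t)
    (fun s _ => (hasDerivAt_exp_apply (yosida l (J l)) u s).hasDerivWithinAt)
    (C := ‖yosida l (J l) u‖) (fun s hs => R.norm_exp_apply_le hl hs.1 _)
    (convex_Icc 0 t) ⟨le_rfl, ht⟩ ⟨ht, le_rfl⟩
  rw [sub_zero, Real.norm_of_nonneg ht, mul_comm] at this
  simpa using this

theorem norm_exp_sub_sub_le (R : IsResolventFamily A J) {l t : ℝ} (hl : 0 < l) (ht : 0 ≤ t)
    (u w : H) :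
    ‖NormedSpace.exp (t • yosida l (J l)) u - u - t • yosida l (J l) u‖ ≤
      t * (2 * ‖yosida l (J l) u - w‖ + t * ‖yosida l (J l) w‖) := by
  set B := yosida l (J l) with hB
  have hd : ∀ s : ℝ, HasDerivAt (fun s : ℝ => NormedSpace.exp (s • B) u - s • B u)
      (NormedSpace.exp (s • B) (B u) - B u) s := by
    intro s
    exact ((hasDerivAt_exp_apply B u s).sub ((hasDerivAt_id s).smul_const (B u))).congr_deriv
      (by rw [one_smul])
  have := Convex.norm_image_sub_le_of_norm_hasDerivWithin_le (s := Icc 0 t) (x := 0) (y := t)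
    (fun s _ => (hd s).hasDerivWithinAt)
    (C := 2 * ‖B u - w‖ + t * ‖B w‖) (fun s hs => ?_)
    (convex_Icc 0 t) ⟨le_rfl, ht⟩ ⟨ht, le_rfl⟩
  · rw [sub_zero, Real.norm_of_nonneg ht, mul_comm] at this
    simpa [sub_right_comm] using this
  · have h1 : NormedSpace.exp (s • B) (B u) - B u =
        NormedSpace.exp (s • B) (B u - w) - (B u - w) + (NormedSpace.exp (s • B) w - w) := by
      rw [map_sub]; abel
    have h2 := R.norm_exp_apply_le hl hs.1 (B u - w)
    have h3 := R.norm_exp_sub_le hl hs.1 w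
    have h4 : s * ‖B w‖ ≤ t * ‖B w‖ := by gcongr; exact hs.2
    rw [h1]
    have h5 := norm_add_le (NormedSpace.exp (s • B) (B u - w) - (B u - w))
      (NormedSpace.exp (s • B) w - w)
    have h6 := norm_sub_le (NormedSpace.exp (s • B) (B u - w)) (B u - w)
    linarith

end IsResolventFamily

end HilleYosida

end IntervalMarkov

/-! ### The Hille–Yosida theorem and contractivity of semigroups -/

namespace IntervalMarkov

section HilleYosida

variable {H : Type*} [NormedAddCommGroup H] [InnerProductSpace ℝ H] [CompleteSpace H]
  {A : H →ₗ.[ℝ] H} {J : ℝ → H →L[ℝ] H}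

namespace IsResolventFamily

theorem cauchySeq_exp (R : IsResolventFamily A J) {t : ℝ} (ht : 0 ≤ t) (g : H) :
    CauchySeq fun n : ℕ => NormedSpace.exp (t • yosida (n + 1) (J (n + 1))) g := by
  rw [Metric.cauchySeq_iff]
  intro ε hε
  obtain ⟨u, hu, hgu⟩ := R.dense.exists_dist_lt g (show 0 < ε / 3 by positivity)
  have hB := (R.tendsto_yosida (A.mem_graph ⟨u, hu⟩)).cauchySeq
  obtain ⟨N, hN⟩ := Metric.cauchySeq_iff.1 hB (ε / 3 / (t + 1)) (by positivity)
  refine ⟨N, fun n hn m hm => ?_⟩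
  have h1 := hN n hn m hm
  have hn' : (0 : ℝ) < n + 1 := by positivity
  have hm' : (0 : ℝ) < m + 1 := by positivity
  rw [dist_eq_norm] at h1 hgu ⊢
  have h2 := R.norm_exp_sub_exp_le hn' hm' ht u
  have h3 : t * ‖yosida (n + 1 : ℝ) (J (n + 1)) u - yosida (m + 1 : ℝ) (J (m + 1)) u‖ ≤ ε / 3 := by
    rw [lt_div_iff₀ (by positivity)] at h1
    have := norm_nonneg (yosida (n + 1 : ℝ) (J (n + 1)) u - yosida (m + 1 : ℝ) (J (m + 1)) u)
    simp only at h1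
    nlinarith
  have h4 := R.norm_exp_apply_le hn' ht (g - u)
  have h5 := R.norm_exp_apply_le hm' ht (g - u)
  set S := NormedSpace.exp (t • yosida (n + 1 : ℝ) (J (n + 1)))
  set S' := NormedSpace.exp (t • yosida (m + 1 : ℝ) (J (m + 1)))
  have h6 : S g - S' g = S (g - u) + (S u - S' u) - S' (g - u) := by
    rw [map_sub, map_sub]; abel
  rw [h6]
  have h7 := norm_sub_le (S (g - u) + (S u - S' u)) (S' (g - u))
  have h8 := norm_add_le (S (g - u)) (S u - S' u)
  linarith

/-- The Yosida approximations of `e^{tA}` converge strongly. -/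
theorem exists_limit (R : IsResolventFamily A J) : ∃ T : ℝ → H →L[ℝ] H, ∀ t, 0 ≤ t → ∀ g,
    Tendsto (fun n : ℕ => NormedSpace.exp (t • yosida (n + 1) (J (n + 1))) g) atTop
      (𝓝 (T t g)) := by
  have : ∀ t : ℝ, ∃ T : H →L[ℝ] H, 0 ≤ t → ∀ g,
      Tendsto (fun n : ℕ => NormedSpace.exp (t • yosida (n + 1) (J (n + 1))) g) atTop
        (𝓝 (T g)) := by
    intro t
    by_cases ht : 0 ≤ t
    · choose f hf using fun g => cauchySeq_tendsto_of_complete (R.cauchySeq_exp ht g)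
      have hf' : Tendsto (fun (n : ℕ) g => NormedSpace.exp (t • yosida (n + 1) (J (n + 1))) g)
        atTop (𝓝 f) := tendsto_pi_nhds.2 hf
      exact ⟨continuousLinearMapOfTendsto _ hf', fun _ => hf⟩
    · exact ⟨0, fun h => absurd h ht⟩
  choose T hT using this
  exact ⟨T, hT⟩

/-- The Hille–Yosida theorem; the semigroup leaves invariant every closed convex set that the
resolvents leave invariant. -/
theorem exists_semigroup (R : IsResolventFamily A J) : ∃ T : ℝ → H →L[ℝ] H, IsSemigroupOf A T ∧
    ∀ K : Set H, Convex ℝ K → IsClosed K → (∀ l, 0 < l → ∀ k ∈ K, J l k ∈ K) →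
      ∀ t, 0 ≤ t → ∀ k ∈ K, T t k ∈ K := by
  obtain ⟨T, hT⟩ := R.exists_limit
  have hn : ∀ n : ℕ, (0 : ℝ) < n + 1 := fun n => by positivity
  have hnorm : ∀ t, 0 ≤ t → ∀ g, ‖T t g‖ ≤ ‖g‖ := fun t ht g =>
    le_of_tendsto (hT t ht g).norm (Eventually.of_forall fun n => R.norm_exp_apply_le (hn n) ht g)
  have hzero : T 0 = ContinuousLinearMap.id ℝ H := by
    ext g
    refine tendsto_nhds_unique (hT 0 le_rfl g) ?_
    simp
  have hadd : ∀ s t : ℝ, 0 ≤ s → 0 ≤ t → T (s + t) = (T s).comp (T t) := by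
    intro s t hs ht
    ext g
    refine tendsto_nhds_unique (hT (s + t) (add_nonneg hs ht) g) ?_
    let _ : NormedAlgebra ℚ (H →L[ℝ] H) := NormedAlgebra.restrictScalars ℚ ℝ _
    have h1 : ∀ n : ℕ, NormedSpace.exp ((s + t) • yosida (n + 1) (J (n + 1))) g =
        NormedSpace.exp (s • yosida (n + 1) (J (n + 1)))
          (NormedSpace.exp (t • yosida (n + 1) (J (n + 1))) g - T t g) +
        NormedSpace.exp (s • yosida (n + 1) (J (n + 1))) (T t g) := by
      intro n
      rw [add_smul, NormedSpace.exp_add_of_commute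
        (((Commute.refl _).smul_left s).smul_right t), mul_apply_eq_comp, map_sub, sub_add_cancel]
    have h2 : Tendsto (fun n : ℕ => NormedSpace.exp (s • yosida (n + 1) (J (n + 1)))
          (NormedSpace.exp (t • yosida (n + 1) (J (n + 1))) g - T t g)) atTop (𝓝 0) := by
      refine squeeze_zero_norm (fun n => R.norm_exp_apply_le (hn n) hs _) ?_
      simpa using ((hT t ht g).sub_const (T t g)).norm
    simp only [h1]
    simpa using h2.add (hT s hs (T t g))
  have hlip0 : ∀ u w, (u, w) ∈ A.graph → ∀ t, 0 ≤ t → ‖T t u - u‖ ≤ t * ‖w‖ := by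
    intro u w huw t ht
    exact le_of_tendsto_of_tendsto' ((hT t ht u).sub_const u).norm
      ((R.tendsto_yosida huw).norm.const_mul t) fun n => R.norm_exp_sub_le (hn n) ht u
  have hlip1 : ∀ u w, (u, w) ∈ A.graph → ∀ s t, 0 ≤ s → s ≤ t →
      ‖T t u - T s u‖ ≤ (t - s) * ‖w‖ := by
    intro u w huw s t hs hst
    have h1 : T t u - T s u = T s (T (t - s) u - u) := by
      rw [map_sub, ← ContinuousLinearMap.comp_apply, ← hadd s (t - s) hs (sub_nonneg.2 hst),
        add_sub_cancel]
    rw [h1]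
    exact (hnorm s hs _).trans (hlip0 u w huw _ (sub_nonneg.2 hst))
  have hlip : ∀ u w, (u, w) ∈ A.graph → ∀ s t, 0 ≤ s → 0 ≤ t →
      ‖T t u - T s u‖ ≤ |t - s| * ‖w‖ := by
    intro u w huw s t hs ht
    rcases le_total s t with h | h
    · rw [abs_of_nonneg (sub_nonneg.2 h)]
      exact hlip1 u w huw s t hs h
    · rw [abs_sub_comm, abs_of_nonneg (sub_nonneg.2 h), norm_sub_rev]
      exact hlip1 u w huw t s ht h
  have hcont : ∀ g, ContinuousOn (fun t => T t g) (Ici 0) := by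
    intro g
    rw [Metric.continuousOn_iff]
    intro s hs ε hε
    obtain ⟨u, hu, hgu⟩ := R.dense.exists_dist_lt g (show 0 < ε / 3 by positivity)
    refine ⟨ε / 3 / (‖A ⟨u, hu⟩‖ + 1), by positivity, fun t ht hts => ?_⟩
    have h1 := hlip u _ (A.mem_graph ⟨u, hu⟩) s t hs ht
    rw [dist_eq_norm] at hgu ⊢
    rw [Real.dist_eq, lt_div_iff₀ (by positivity)] at hts
    have h2 := abs_nonneg (t - s)
    have h3 := hnorm t ht (g - u)
    have h4 := hnorm s hs (g - u)
    have h6 : T t g - T s g = T t (g - u) + (T t u - T s u) - T s (g - u) := by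
      rw [map_sub, map_sub]; abel
    rw [h6]
    have h7 := norm_sub_le (T t (g - u) + (T t u - T s u)) (T s (g - u))
    have h8 := norm_add_le (T t (g - u)) (T t u - T s u)
    nlinarith
  have hgen : ∀ u w, (u, w) ∈ A.graph →
      Tendsto (fun t : ℝ => t⁻¹ • (T t u - u)) (𝓝[>] 0) (𝓝 w) := by
    intro u w huw
    have hest : ∀ w' z, (w', z) ∈ A.graph → ∀ t, 0 ≤ t →
        ‖T t u - u - t • w‖ ≤ t * (2 * ‖w - w'‖ + t * ‖z‖) := by
      intro w' z hz t ht
      refine le_of_tendsto_of_tendsto'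
        (((hT t ht u).sub_const u).sub ((R.tendsto_yosida huw).const_smul t)).norm
        (((((R.tendsto_yosida huw).sub_const w').norm.const_mul 2).add
          ((R.tendsto_yosida hz).norm.const_mul t)).const_mul t)
        fun n => R.norm_exp_sub_sub_le (hn n) ht u w'
    rw [Metric.tendsto_nhdsWithin_nhds]
    intro ε hε
    obtain ⟨w', hw', hww⟩ := R.dense.exists_dist_lt w (show 0 < ε / 4 by positivity)
    refine ⟨ε / 4 / (‖A ⟨w', hw'⟩‖ + 1), by positivity, fun t ht htd => ?_⟩
    have ht0 : 0 < t := ht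
    have h1 := hest w' _ (A.mem_graph ⟨w', hw'⟩) t ht0.le
    rw [dist_eq_norm] at hww ⊢
    rw [Real.dist_eq, sub_zero, abs_of_pos ht0, lt_div_iff₀ (by positivity)] at htd
    have h2 : t⁻¹ • (T t u - u) - w = t⁻¹ • (T t u - u - t • w) := by
      rw [smul_sub _ (T t u - u), inv_smul_smul₀ ht0.ne']
    rw [h2, norm_smul, norm_inv, Real.norm_of_nonneg ht0.le, inv_mul_lt_iff₀ ht0]
    refine h1.trans_lt (mul_lt_mul_of_pos_left ?_ ht0)
    nlinarith [norm_nonneg (A ⟨w', hw'⟩)]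
  refine ⟨T, ⟨hzero, hadd, hcont, fun u w => ⟨hgen u w, fun huw => ?_⟩⟩, ?_⟩
  · -- the generator extends `A` and is dissipative, while `1 - A` is onto
    have h1 := R.resolvent 1 one_pos (u - w)
    set v := J 1 (u - w) with hv
    rw [one_smul] at h1
    have h2 : Tendsto (fun t : ℝ => t⁻¹ • (T t (u - v) - (u - v))) (𝓝[>] 0) (𝓝 (u - v)) := by
      have := huw.sub (hgen _ _ h1)
      rw [show w - (v - (u - w)) = u - v by abel] at this
      refine this.congr fun t => ?_
      rw [← smul_sub, map_sub]
      congr 1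
      abel
    have h3 : ⟪u - v, u - v⟫ ≤ 0 := by
      refine le_of_tendsto (h2.inner tendsto_const_nhds) ?_
      filter_upwards [self_mem_nhdsWithin] with t ht
      have ht0 : 0 < t := ht
      rw [inner_smul_left, inner_sub_left, real_inner_self_eq_norm_sq]
      have h4 := real_inner_le_norm (T t (u - v)) (u - v)
      have h5 := hnorm t ht0.le (u - v)
      refine mul_nonpos_of_nonneg_of_nonpos (by simpa using ht0.le) ?_
      nlinarith [norm_nonneg (u - v)]
    have h4 : u = v := by
      rw [real_inner_self_eq_norm_sq] at h3
      have : ‖u - v‖ = 0 := by nlinarith [norm_nonneg (u - v)]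
      exact sub_eq_zero.1 (norm_eq_zero.1 this)
    rwa [← h4, sub_sub_cancel] at h1
  · intro K hK hKc hJ t ht k hk
    exact hKc.mem_of_tendsto (hT t ht k)
      (Eventually.of_forall fun n => exp_yosida_mem hK hKc (hJ _ (hn n)) (hn n) ht hk)

end IsResolventFamily

end HilleYosida

section Contraction

variable {H : Type*} [NormedAddCommGroup H] [InnerProductSpace ℝ H]
  {A : H →ₗ.[ℝ] H} {T : ℝ → H →L[ℝ] H}

theorem IsSemigroupOf.map_mem_graph (hT : IsSemigroupOf A T) {u w : H} (h : (u, w) ∈ A.graph)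
    {t : ℝ} (ht : 0 ≤ t) : (T t u, T t w) ∈ A.graph := by
  rw [hT.generator] at h ⊢
  have := ((T t).continuous.tendsto w).comp h
  refine this.congr' ?_
  filter_upwards [self_mem_nhdsWithin] with s hs
  have hs0 : 0 ≤ s := le_of_lt hs
  have h1 : T s (T t u) = T t (T s u) := by
    rw [← ContinuousLinearMap.comp_apply, ← hT.add s t hs0 ht, add_comm,
      hT.add t s ht hs0, ContinuousLinearMap.comp_apply]
  simp only [Function.comp_apply, map_smul, map_sub, h1]

/-- The semigroup of a dissipative operator is contractive: on the domain, `t ↦ ‖T t u‖²` has the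
right derivative `2 ⟨A T t u, T t u⟩ ≤ 0`. -/
theorem IsSemigroupOf.norm_apply_le (hT : IsSemigroupOf A T) (hd : IsDissipative A)
    (hA : Dense (A.domain : Set H)) {t : ℝ} (ht : 0 ≤ t) (g : H) : ‖T t g‖ ≤ ‖g‖ := by
  refine hA.induction (P := fun g => ‖T t g‖ ≤ ‖g‖) ?_
    (isClosed_le (T t).continuous.norm continuous_norm) g
  intro u hu
  obtain ⟨w, huw⟩ : ∃ w, (u, w) ∈ A.graph := ⟨_, A.mem_graph ⟨u, hu⟩⟩
  have hder : ∀ s ∈ Ico 0 t,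
      HasDerivWithinAt (fun s => ‖T s u‖ ^ 2) (2 * ⟪T s u, T s w⟫) (Ioi s) s := by
    intro s hs
    have h1 := (hT.generator _ _).1 (hT.map_mem_graph huw hs.1)
    have h2 : HasDerivWithinAt (fun s => T s u) (T s w) (Ioi s) s := by
      rw [hasDerivWithinAt_iff_tendsto_slope' (by simp)]
      have h3 : Tendsto (fun r => r - s) (𝓝[>] s) (𝓝[>] 0) := by
        refine tendsto_nhdsWithin_iff.2 ⟨?_, ?_⟩
        · have : Tendsto (fun r => r - s) (𝓝 s) (𝓝 (s - s)) := tendsto_id.sub_const s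
          rw [sub_self] at this
          exact this.mono_left nhdsWithin_le_nhds
        · filter_upwards [self_mem_nhdsWithin] with r hr
          exact mem_Ioi.2 (sub_pos.2 (mem_Ioi.1 hr))
      refine (h1.comp h3).congr' ?_
      filter_upwards [self_mem_nhdsWithin] with r hr
      have hr' : 0 ≤ r - s := sub_nonneg.2 (le_of_lt hr)
      rw [Function.comp_apply, slope_def_module, ← ContinuousLinearMap.comp_apply,
        ← hT.add _ _ hr' hs.1, sub_add_cancel]
    exact h2.norm_sq
  have hmain := image_le_of_liminf_slope_right_le_deriv_boundary (f := fun s => ‖T s u‖ ^ 2)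
    (a := 0) (b := t) (((hT.continuousOn u).mono Icc_subset_Ici_self).norm.pow 2)
    (B := fun _ => ‖T 0 u‖ ^ 2) (B' := fun _ => 0) le_rfl continuousOn_const
    (fun x _ => hasDerivWithinAt_const _ _ _) (fun s hs r hr => by
      refine (hasDerivWithinAt_Ioi_iff_Ici.1 (hder s hs)).liminf_right_slope_le ?_
      have := hd _ _ (hT.map_mem_graph huw hs.1)
      rw [real_inner_comm] at this
      linarith) (right_mem_Icc.2 ht)
  rw [hT.zero] at hmain
  exact (pow_le_pow_iff_left₀ (norm_nonneg _) (norm_nonneg _) two_ne_zero).1 hmain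

/-- If `P` is the projection to a set that the semigroup leaves invariant, then the resolvents
leave that set invariant. -/
theorem IsSemigroupOf.resolvent_mem (hT : IsSemigroupOf A T) (hd : IsDissipative A)
    (hA : Dense (A.domain : Set H)) {K : Set H} {P : H → H} (hPK : ∀ u, P u ∈ K)
    (hP : ∀ u, ∀ k ∈ K, ⟪k - P u, u - P u⟫ ≤ 0) (hTK : ∀ t, 0 < t → ∀ k ∈ K, T t k ∈ K)
    {l : ℝ} (hl : 0 < l) {v g : H} (h : (v, l • (v - g)) ∈ A.graph) (hg : g ∈ K) : v ∈ K := by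
  have h1 : ⟪l • (v - g), v - P v⟫ ≤ 0 := by
    refine le_of_tendsto (((hT.generator _ _).1 h).inner tendsto_const_nhds) ?_
    filter_upwards [self_mem_nhdsWithin] with t ht
    have ht0 : 0 < t := ht
    rw [inner_smul_left]
    refine mul_nonpos_of_nonneg_of_nonpos (by simpa using ht0.le) ?_
    have h2 := hP v _ (hTK t ht0 _ (hPK v))
    have h3 := real_inner_le_norm (T t (v - P v)) (v - P v)
    have h4 := hT.norm_apply_le hd hA ht0.le (v - P v)
    have h5 : T t v - v = T t (v - P v) + (T t (P v) - P v) - (v - P v) := by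
      rw [map_sub]; abel
    rw [h5, inner_sub_left, inner_add_left, real_inner_self_eq_norm_sq]
    nlinarith [norm_nonneg (v - P v)]
  have h2 := hP v g hg
  rw [inner_smul_left] at h1
  have h3 : ⟪v - g, v - P v⟫ ≤ 0 := by
    by_contra! h4
    exact absurd h1 (not_le.2 (mul_pos (by simpa using hl) h4))
  have h4 : v - g = (v - P v) - (g - P v) := by abel
  rw [h4, inner_sub_left, real_inner_self_eq_norm_sq] at h3
  have h5 : ‖v - P v‖ = 0 := by nlinarith [norm_nonneg (v - P v)]
  rw [sub_eq_zero.1 (norm_eq_zero.1 h5)]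
  exact hPK v

end Contraction

end IntervalMarkov

/-! ### Forms and resolvents -/

namespace IntervalMarkov

section Forms

variable {H : Type*} [NormedAddCommGroup H] [InnerProductSpace ℝ H]
  {A : H →ₗ.[ℝ] H} {F : FormOn H}

namespace FormOn

theorem form_sub_self (hs : F.IsSymm) (u v : F.domain) :
    F.form (u - v) (u - v) = F.form u u - 2 * F.form v u + F.form v v := by
  simp only [map_sub, LinearMap.sub_apply]
  rw [hs u v]
  ring

theorem form_sub_comm (u v : F.domain) :
    F.form (u - v) (u - v) = F.form (v - u) (v - u) := by
  rw [← neg_sub v u]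
  simp only [map_neg, LinearMap.neg_apply, neg_neg]

theorem form_le_add (hs : F.IsSymm) (hn : F.IsNonneg) (u v : F.domain) {ε : ℝ} (hε : 0 < ε) :
    F.form u v ≤ F.form u u / (2 * ε) + ε / 2 * F.form v v := by
  have h := hn (u - ε • v)
  rw [form_sub_self hs] at h
  simp only [map_smul, LinearMap.smul_apply, smul_eq_mul] at h
  rw [hs v u] at h
  have e : F.form u u / (2 * ε) + ε / 2 * F.form v v - F.form u v =
      (F.form u u - 2 * (ε * F.form u v) + ε * (ε * F.form v v)) / (2 * ε) := by
    field_simp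
    ring
  have : 0 ≤ (F.form u u - 2 * (ε * F.form u v) + ε * (ε * F.form v v)) / (2 * ε) := by positivity
  linarith

theorem IsFormOfNeg.form_resolvent (hF : F.IsFormOfNeg A) {l : ℝ} {v g : H}
    (h : (v, l • (v - g)) ∈ A.graph) :
    ∃ hv : v ∈ F.domain, ∀ φ : F.domain, F.form ⟨v, hv⟩ φ = l * ⟪g - v, (φ : H)⟫ := by
  obtain ⟨hv, h1⟩ := (hF.2.2.2.2 _ _).1 h
  refine ⟨hv, fun φ => ?_⟩
  rw [h1, ← smul_neg, neg_sub, real_inner_smul_left]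

/-- Completing the square: the solution `v` of `A v = l (v - g)` is the minimizer of
`s ↦ F(s, s) + l ‖s - g‖²`. -/
theorem form_add_norm_sq (hs : F.IsSymm) {l : ℝ} {g : H} {v : F.domain}
    (hv : ∀ φ : F.domain, F.form v φ = l * ⟪g - (v : H), (φ : H)⟫) (s : F.domain) :
    F.form s s + l * ‖(s : H) - g‖ ^ 2 = F.form v v + l * ‖(v : H) - g‖ ^ 2 +
      (F.form (s - v) (s - v) + l * ‖(s : H) - v‖ ^ 2) := by
  rw [form_sub_self hs, hv s, hv v]
  simp only [← real_inner_self_eq_norm_sq, inner_sub_left, inner_sub_right]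
  rw [real_inner_comm g (s : H), real_inner_comm g (v : H), real_inner_comm (s : H) (v : H)]
  ring

theorem form_add_norm_sq_eq {l : ℝ} {g : H} {v : F.domain}
    (hv : ∀ φ : F.domain, F.form v φ = l * ⟪g - (v : H), (φ : H)⟫) :
    F.form v v + l * ‖(v : H) - g‖ ^ 2 = l * ⟪g - (v : H), g⟫ := by
  rw [hv v]
  simp only [← real_inner_self_eq_norm_sq, inner_sub_left, inner_sub_right]
  rw [real_inner_comm g (v : H)]
  ring

/-- If `F` is Markovian and `sharp` does not increase the distance to `g`, then `sharp` fixes the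
minimizer of `F(s, s) + l ‖s - g‖²`. -/
theorem IsFormOfNeg.sharp_resolvent_eq (hF : F.IsFormOfNeg A) {sharp : H → H}
    (hM : F.IsMarkovian sharp) {l : ℝ} (hl : 0 < l) {v g : H} (h : (v, l • (v - g)) ∈ A.graph)
    (hg : ‖sharp v - g‖ ≤ ‖v - g‖) : sharp v = v := by
  obtain ⟨hs, hn, hM⟩ := hM
  obtain ⟨hv, hvφ⟩ := hF.form_resolvent h
  obtain ⟨hsv, hle⟩ := hM ⟨v, hv⟩
  have h1 := form_add_norm_sq hs hvφ ⟨sharp v, hsv⟩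
  have h2 := hn (⟨sharp v, hsv⟩ - ⟨v, hv⟩)
  simp only at h1
  have h3 : ‖sharp v - g‖ ^ 2 ≤ ‖v - g‖ ^ 2 := by gcongr
  have h4 : l * ‖sharp v - v‖ ^ 2 ≤ 0 := by nlinarith
  have h5 : ‖sharp v - v‖ ^ 2 ≤ 0 := by
    by_contra! h6
    exact absurd h4 (not_le.2 (mul_pos hl h6))
  have h6 : ‖sharp v - v‖ = 0 := by nlinarith [norm_nonneg (sharp v - v)]
  exact sub_eq_zero.1 (norm_eq_zero.1 h6)

theorem tendsto_sub_of_monotone_bddAbove {Φ : ℕ → ℝ} (hm : Monotone Φ) {C : ℝ}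
    (hC : ∀ n, Φ n ≤ C) :
    Tendsto (fun p : ℕ × ℕ => |Φ p.1 - Φ p.2|) atTop (𝓝 0) := by
  have h := tendsto_atTop_ciSup hm ⟨C, by rintro _ ⟨n, rfl⟩; exact hC n⟩
  have h1 : Tendsto (fun p : ℕ × ℕ => Φ p.1) atTop (𝓝 (⨆ i, Φ i)) := by
    rw [← prod_atTop_atTop_eq]
    exact h.comp tendsto_fst
  have h2 : Tendsto (fun p : ℕ × ℕ => Φ p.2) atTop (𝓝 (⨆ i, Φ i)) := by
    rw [← prod_atTop_atTop_eq]
    exact h.comp tendsto_snd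
  simpa using (h1.sub h2).abs

/-- If `sharp` is the projection to a set that the resolvents leave invariant, then the form is
Markovian. The approximating forms `Φ(u) = l ⟨u - J u, u⟩` satisfy `Φ(sharp u) ≤ Φ(u) ≤ F(u, u)`,
and they increase to `F(u, u)` as `l → ∞`; closedness yields `sharp u ∈ D(F)`. -/
theorem IsFormOfNeg.isMarkovian (hF : F.IsFormOfNeg A) (hn : F.IsNonneg) {J : ℝ → H →L[ℝ] H}
    (R : IsResolventFamily A J) {K : Set H} {sharp : H → H} (hK : ∀ u, sharp u ∈ K)
    (hP : ∀ u, ∀ k ∈ K, ⟪k - sharp u, u - sharp u⟫ ≤ 0)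
    (hJK : ∀ l, 0 < l → ∀ k ∈ K, J l k ∈ K) : F.IsMarkovian sharp := by
  have hs := hF.2.1
  refine ⟨hs, hn, fun u => ?_⟩
  set g := sharp u with hg
  have hl : ∀ n : ℕ, (0 : ℝ) < n + 1 := fun n => by positivity
  choose hv hvφ using fun l : {l : ℝ // 0 < l} => fun h : H =>
    hF.form_resolvent (R.resolvent l l.2 h)
  -- the approximating forms
  have hΦ0 : ∀ l : ℝ, 0 < l → ∀ h, 0 ≤ l * ⟪h - J l h, h⟫ := by
    intro l hl h
    have h1 := form_add_norm_sq_eq (hvφ ⟨l, hl⟩ h)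
    have h2 := hn ⟨J l h, hv ⟨l, hl⟩ h⟩
    simp only at h1
    rw [← h1]
    positivity
  have hsymm : ∀ l : ℝ, 0 < l → ∀ h k, ⟪J l h, k⟫ = ⟪h, J l k⟫ := by
    intro l hl h k
    have h1 := hvφ ⟨l, hl⟩ h ⟨_, hv ⟨l, hl⟩ k⟩
    rw [hs, hvφ ⟨l, hl⟩ k ⟨_, hv ⟨l, hl⟩ h⟩, inner_sub_left, inner_sub_left] at h1
    have h2 := mul_left_cancel₀ hl.ne' h1
    simp only at h2
    rw [real_inner_comm (J l h) (J l k), real_inner_comm (J l h) k] at h2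
    linarith
  have hΦle : ∀ l : ℝ, 0 < l → l * ⟪g - J l g, g⟫ ≤ F.form u u := by
    intro l hl
    have h1 : l * ⟪(u : H) - J l u, (u : H)⟫ ≤ F.form u u := by
      have h1 := form_add_norm_sq hs (hvφ ⟨l, hl⟩ u) u
      rw [form_add_norm_sq_eq (hvφ ⟨l, hl⟩ u)] at h1
      have h2 := hn (u - ⟨J l u, hv ⟨l, hl⟩ u⟩)
      have h3 : 0 ≤ l * ‖(u : H) - J l u‖ ^ 2 := by positivity
      simp only [sub_self, norm_zero] at h1
      nlinarith
    refine le_trans ?_ h1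
    have h2 := hΦ0 l hl (u - g)
    have h3 := hP u _ (hJK l hl _ (hK u))
    rw [← hg] at h3
    have h4 : l * ⟪(u : H) - J l u, (u : H)⟫ = l * ⟪g - J l g, g⟫ +
        l * ⟪(u - g : H) - J l (u - g), (u : H) - g⟫ - 2 * (l * ⟪J l g - g, (u : H) - g⟫) := by
      have e1 := hsymm l hl u g
      have e2 := real_inner_comm (J l g) (u : H)
      have e3 := real_inner_comm g (u : H)
      simp only [map_sub, inner_sub_left, inner_sub_right]
      rw [e1, ← e2, ← e3]
      ring
    nlinarith
  set v : ℕ → F.domain := fun n => ⟨J (n + 1) g, hv ⟨n + 1, hl n⟩ g⟩ with hvdef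
  have hvn : ∀ n φ, F.form (v n) φ = (n + 1) * ⟪g - (v n : H), (φ : H)⟫ := fun n φ =>
    hvφ ⟨n + 1, hl n⟩ g φ
  set Φ : ℕ → ℝ := fun n => (n + 1) * ⟪g - (v n : H), g⟫ with hΦ
  have hdiff : ∀ n m, n ≤ m → F.form (v m - v n) (v m - v n) ≤ Φ m - Φ n := by
    intro n m hnm
    have h1 := form_add_norm_sq hs (hvn n) (v m)
    rw [form_add_norm_sq_eq (hvn n)] at h1
    have h2 := form_add_norm_sq_eq (hvn m)
    have h3 : (n : ℝ) * ‖(v m : H) - g‖ ^ 2 ≤ m * ‖(v m : H) - g‖ ^ 2 := by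
      gcongr
    have h4 : 0 ≤ (n + 1 : ℝ) * ‖(v m : H) - v n‖ ^ 2 := by positivity
    simp only [hΦ]
    linarith
  have hmono : Monotone Φ := fun n m hnm => by
    have := hdiff n m hnm
    have := hn (v m - v n)
    linarith
  have hcauchy : Tendsto (fun p : ℕ × ℕ => F.form (v p.1 - v p.2) (v p.1 - v p.2)) atTop
      (𝓝 0) := by
    refine squeeze_zero (fun p => hn _) (fun p => ?_)
      (tendsto_sub_of_monotone_bddAbove hmono fun n => hΦle _ (hl n))
    rcases le_total p.1 p.2 with h | h
    · have h1 := hdiff _ _ h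
      rw [form_sub_comm, abs_sub_comm]
      exact h1.trans (le_abs_self _)
    · exact (hdiff _ _ h).trans (le_abs_self _)
  obtain ⟨hgF, hlim⟩ := hF.2.2.2.1 v g (R.tendsto_apply g) hcauchy
  refine ⟨hgF, ?_⟩
  have hε : ∀ ε : ℝ, 0 < ε →
      F.form ⟨g, hgF⟩ ⟨g, hgF⟩ ≤ F.form u u + ε / 2 * F.form ⟨g, hgF⟩ ⟨g, hgF⟩ := by
    intro ε hε
    have h1 : ∀ n, F.form ⟨g, hgF⟩ ⟨g, hgF⟩ ≤ F.form u u +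
        (F.form (v n - ⟨g, hgF⟩) (v n - ⟨g, hgF⟩) / (2 * ε) +
          ε / 2 * F.form ⟨g, hgF⟩ ⟨g, hgF⟩) := by
      intro n
      have h2 := form_le_add hs hn (⟨g, hgF⟩ - v n) ⟨g, hgF⟩ hε
      have h3 : F.form (v n) ⟨g, hgF⟩ ≤ F.form u u := (hvn n _).trans_le (hΦle _ (hl n))
      rw [form_sub_comm] at h2
      have h4 : F.form (⟨g, hgF⟩ - v n) ⟨g, hgF⟩ =
          F.form ⟨g, hgF⟩ ⟨g, hgF⟩ - F.form (v n) ⟨g, hgF⟩ := by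
        simp only [map_sub, LinearMap.sub_apply]
      linarith
    have h2 : Tendsto (fun n => F.form u u +
        (F.form (v n - ⟨g, hgF⟩) (v n - ⟨g, hgF⟩) / (2 * ε) +
          ε / 2 * F.form ⟨g, hgF⟩ ⟨g, hgF⟩)) atTop
        (𝓝 (F.form u u + (0 / (2 * ε) + ε / 2 * F.form ⟨g, hgF⟩ ⟨g, hgF⟩))) :=
      ((hlim.div_const _).add_const _).const_add _
    have := ge_of_tendsto' h2 h1
    simpa using this
  set a := F.form ⟨g, hgF⟩ ⟨g, hgF⟩ with ha
  have ha0 : 0 ≤ a := hn _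
  by_contra! hlt
  have h1 := hε ((a - F.form u u) / (a + 1)) (div_pos (sub_pos.2 hlt) (by positivity))
  have h2 : (a - F.form u u) / (a + 1) / 2 * a < a - F.form u u := by
    rw [div_div, div_mul_eq_mul_div, div_lt_iff₀ (by positivity)]
    nlinarith [sub_pos.2 hlt]
  linarith

end FormOn

end Forms

end IntervalMarkov

/-! ### The Beurling–Deny correspondence -/

namespace IntervalMarkov

theorem cut_nonneg (t : ℝ) : 0 ≤ cut t := le_min (le_max_left _ _) zero_le_one

theorem cut_le_one (t : ℝ) : cut t ≤ 1 := min_le_right _ _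

theorem cut_of_mem {t : ℝ} (h0 : 0 ≤ t) (h1 : t ≤ 1) : cut t = t := by
  rw [cut, max_eq_right h0, min_eq_left h1]

theorem cut_of_nonpos {t : ℝ} (h : t ≤ 0) : cut t = 0 := by
  rw [cut, max_eq_left h, min_eq_left zero_le_one]

theorem cut_of_one_le {t : ℝ} (h : 1 ≤ t) : cut t = 1 := by
  rw [cut, max_eq_right (zero_le_one.trans h), min_eq_right h]

theorem sub_cut_mul_nonpos {k : ℝ} (h0 : 0 ≤ k) (h1 : k ≤ 1) (t : ℝ) :
    (k - cut t) * (t - cut t) ≤ 0 := by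
  rcases le_total t 0 with h | h
  · rw [cut_of_nonpos h]; nlinarith
  · rcases le_total t 1 with h' | h'
    · rw [cut_of_mem h h']; simp
    · rw [cut_of_one_le h']; nlinarith

section Band

variable {X : Type*} [MeasurableSpace X] {μ : Measure X}

/-- The set of the `u ∈ L²(X, μ)` such that `0 ≤ u ≤ 1` almost everywhere. -/
def unitBand (μ : Measure X) : Set (Lp ℝ 2 μ) := {u | ∀ᵐ x ∂μ, 0 ≤ u x ∧ u x ≤ 1}

theorem coeFn_sharpL2 (u : Lp ℝ 2 μ) : sharpL2 u =ᵐ[μ] fun x => cut (u x) :=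
  lipschitzWith_cut.coeFn_compLp cut_zero u

theorem sharpL2_mem_unitBand (u : Lp ℝ 2 μ) : sharpL2 u ∈ unitBand μ := by
  filter_upwards [coeFn_sharpL2 u] with x hx
  rw [hx]
  exact ⟨cut_nonneg _, cut_le_one _⟩

theorem sharpL2_eq_self_iff {u : Lp ℝ 2 μ} : sharpL2 u = u ↔ u ∈ unitBand μ := by
  refine ⟨fun h => h ▸ sharpL2_mem_unitBand u, fun h => Lp.ext ?_⟩
  filter_upwards [coeFn_sharpL2 u, h] with x hx h'
  rw [hx, cut_of_mem h'.1 h'.2]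

theorem continuous_sharpL2 : Continuous (sharpL2 : Lp ℝ 2 μ → Lp ℝ 2 μ) :=
  lipschitzWith_cut.continuous_compLp cut_zero

theorem isClosed_unitBand : IsClosed (unitBand μ) := by
  have : unitBand μ = {u | sharpL2 u = u} := by
    ext u
    exact sharpL2_eq_self_iff.symm
  rw [this]
  exact isClosed_eq continuous_sharpL2 continuous_id

theorem convex_unitBand : Convex ℝ (unitBand μ) := by
  intro u hu v hv a b ha hb hab
  filter_upwards [hu, hv, Lp.coeFn_add (a • u) (b • v), Lp.coeFn_smul a u, Lp.coeFn_smul b v]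
    with x hux hvx h1 h2 h3
  rw [h1, Pi.add_apply, h2, h3, Pi.smul_apply, Pi.smul_apply, smul_eq_mul, smul_eq_mul]
  constructor
  · have := mul_nonneg ha hux.1
    have := mul_nonneg hb hvx.1
    linarith
  · nlinarith [hux.2, hvx.2]

theorem inner_sub_sharpL2_nonpos (u k : Lp ℝ 2 μ) (hk : k ∈ unitBand μ) :
    ⟪k - sharpL2 u, u - sharpL2 u⟫ ≤ 0 := by
  rw [L2.inner_def]
  refine integral_nonpos_of_ae ?_
  filter_upwards [hk, coeFn_sharpL2 u, Lp.coeFn_sub k (sharpL2 u), Lp.coeFn_sub u (sharpL2 u)]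
    with x hx h1 h2 h3
  rw [h2, h3, Pi.sub_apply, Pi.sub_apply, h1]
  have := sub_cut_mul_nonpos hx.1 hx.2 (u x)
  simpa [mul_comm] using this

theorem norm_sharpL2_sub_le (u k : Lp ℝ 2 μ) (hk : k ∈ unitBand μ) :
    ‖sharpL2 u - k‖ ≤ ‖u - k‖ := by
  have h := inner_sub_sharpL2_nonpos u k hk
  have e : u - k = (u - sharpL2 u) - (k - sharpL2 u) := by abel
  have h1 : ‖sharpL2 u - k‖ ^ 2 ≤ ‖u - k‖ ^ 2 := by
    have h2 := norm_sub_sq_real (u - sharpL2 u) (k - sharpL2 u)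
    rw [← e, real_inner_comm] at h2
    rw [norm_sub_rev (sharpL2 u)]
    nlinarith [sq_nonneg ‖u - sharpL2 u‖]
  exact (pow_le_pow_iff_left₀ (norm_nonneg _) (norm_nonneg _) two_ne_zero).1 h1

end Band

section Beurling

namespace FormOn

theorem IsFormOfNeg.isDissipative {H : Type*} [NormedAddCommGroup H] [InnerProductSpace ℝ H]
    {A : H →ₗ.[ℝ] H} {F : FormOn H} (hF : F.IsFormOfNeg A) (hn : F.IsNonneg) :
    IsDissipative A := by
  intro u w h
  obtain ⟨hu, h1⟩ := (hF.2.2.2.2 _ _).1 h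
  have h2 := hn ⟨u, hu⟩
  rw [h1, inner_neg_left] at h2
  simpa using h2

/-- If `A ≤ 0`, then the associated form is positive on its whole domain: `F(u, u)` dominates
`l ⟨u - J u, u⟩` once `l` exceeds a lower bound of `F`. -/
theorem IsFormOfNeg.isNonneg {H : Type*} [NormedAddCommGroup H] [InnerProductSpace ℝ H]
    {A : H →ₗ.[ℝ] H} {F : FormOn H} (hF : F.IsFormOfNeg A) {J : ℝ → H →L[ℝ] H}
    (R : IsResolventFamily A J) : F.IsNonneg := by
  intro u
  obtain ⟨c, hc⟩ := hF.2.2.1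
  have hl : 0 < |c| + 1 := by positivity
  obtain ⟨hv, hvφ⟩ := hF.form_resolvent (R.resolvent _ hl (u : H))
  set v : F.domain := ⟨_, hv⟩ with hvdef
  have h1 := form_add_norm_sq hF.2.1 hvφ u
  have h2 := hc (u - v)
  have h3 : 0 ≤ F.form v v := by
    have h4 := R.dissipative _ _ (R.resolvent _ hl (u : H))
    rw [hvφ v, ← real_inner_smul_left, ← neg_sub, smul_neg, inner_neg_left]
    simpa using h4
  have h4 : c ≤ |c| := le_abs_self c
  have h5 : 0 ≤ (|c| + 1) * ‖(v : H) - u‖ ^ 2 := by positivity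
  rw [Submodule.coe_sub] at h2
  simp only [sub_self, norm_zero] at h1
  nlinarith [sq_nonneg ‖(u : H) - v‖]

variable {X : Type*} [MeasurableSpace X] {μ : Measure X} {A : Lp ℝ 2 μ →ₗ.[ℝ] Lp ℝ 2 μ}
  {F : FormOn (Lp ℝ 2 μ)}

/-- The first Beurling–Deny direction: a Markovian form generates a Markovian semigroup. -/
theorem IsFormOfNeg.isMarkovianOp (hF : F.IsFormOfNeg A) (hA : IsSelfAdjoint A)
    (hM : F.IsMarkovian sharpL2) : IsMarkovianOp A := by
  have hd := hF.isDissipative hM.2.1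
  obtain ⟨J, R⟩ := exists_isResolventFamily hA hd
  obtain ⟨T, hT, hTK⟩ := R.exists_semigroup
  refine ⟨hA, isDissipative_iff.1 hd, T, hT, fun u hu t ht => ?_⟩
  refine hTK (unitBand μ) convex_unitBand isClosed_unitBand (fun l hl k hk => ?_) t ht.le u hu
  rw [← sharpL2_eq_self_iff]
  exact hF.sharp_resolvent_eq hM hl (R.resolvent l hl k) (norm_sharpL2_sub_le _ _ hk)

/-- The second Beurling–Deny direction: the form of a Markovian operator is Markovian. -/
theorem IsFormOfNeg.isMarkovian_of_isMarkovianOp (hF : F.IsFormOfNeg A) (hA : IsMarkovianOp A) :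
    F.IsMarkovian sharpL2 := by
  obtain ⟨hsa, hd, T, hT, hTK⟩ := hA
  rw [← isDissipative_iff] at hd
  obtain ⟨J, R⟩ := exists_isResolventFamily hsa hd
  refine hF.isMarkovian (hF.isNonneg R) R (K := unitBand μ) sharpL2_mem_unitBand
    inner_sub_sharpL2_nonpos fun l hl k hk => ?_
  exact hT.resolvent_mem hd R.dense sharpL2_mem_unitBand inner_sub_sharpL2_nonpos
    (fun t ht k hk => hTK k hk t ht) hl (R.resolvent l hl k) hk

end FormOn

end Beurling

end IntervalMarkov

/-! ### Absolutely continuous representatives and integration by parts in `H¹(0, ℓ)` -/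

namespace IntervalMarkov

section AbsolutelyContinuous

theorem _root_.AbsolutelyContinuousOnInterval.cut_comp {h : ℝ → ℝ} {a b : ℝ}
    (hh : AbsolutelyContinuousOnInterval h a b) :
    AbsolutelyContinuousOnInterval (fun x => cut (h x)) a b := by
  rw [absolutelyContinuousOnInterval_iff] at hh ⊢
  intro ε hε
  obtain ⟨δ, hδ, H⟩ := hh ε hε
  refine ⟨δ, hδ, fun E hE hE' => (Finset.sum_le_sum fun i _ => ?_).trans_lt (H E hE hE')⟩
  simpa using lipschitzWith_cut.dist_le_mul (h (E.2 i).1) (h (E.2 i).2)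

theorem abs_deriv_cut_comp_le {h : ℝ → ℝ} {x : ℝ} (hx : DifferentiableAt ℝ h x) :
    |deriv (fun x => cut (h x)) x| ≤ |deriv h x| := by
  by_cases hc : DifferentiableAt ℝ (fun x => cut (h x)) x
  · have h1 := (hasDerivAt_iff_tendsto_slope.1 hc.hasDerivAt).abs
    have h2 := (hasDerivAt_iff_tendsto_slope.1 hx.hasDerivAt).abs
    refine le_of_tendsto_of_tendsto' h1 h2 fun y => ?_
    rw [slope_def_field, slope_def_field, abs_div, abs_div]
    refine div_le_div_of_nonneg_right ?_ (abs_nonneg _)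
    simpa [Real.dist_eq] using lipschitzWith_cut.dist_le_mul (h y) (h x)
  · rw [deriv_zero_of_not_differentiableAt hc, abs_zero]
    exact abs_nonneg _

end AbsolutelyContinuous

section Sobolev

variable {ℓ : ℝ}

theorem IsTest.apply_zero {φ : ℝ → ℝ} (hφ : IsTest ℓ φ) : φ 0 = 0 :=
  image_eq_zero_of_notMem_tsupport fun hx => lt_irrefl _ (hφ.tsupport_subset hx).1

theorem IsTest.apply_right {φ : ℝ → ℝ} (hφ : IsTest ℓ φ) : φ ℓ = 0 :=
  image_eq_zero_of_notMem_tsupport fun hx => lt_irrefl _ (hφ.tsupport_subset hx).2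

theorem IsTest.absolutelyContinuousOnInterval {φ : ℝ → ℝ} (hφ : IsTest ℓ φ) :
    AbsolutelyContinuousOnInterval φ 0 ℓ :=
  ((hφ.contDiff.of_le (by exact_mod_cast le_top)).contDiffOn).absolutelyContinuousOnInterval

theorem setIntegral_eq_intervalIntegral (hℓ : 0 < ℓ) (f : ℝ → ℝ) :
    ∫ x in Ioo 0 ℓ, f x = ∫ x in (0 : ℝ)..ℓ, f x := by
  rw [intervalIntegral.integral_of_le hℓ.le, integral_Ioc_eq_integral_Ioo]

theorem isWeakDeriv_of_absolutelyContinuous (hℓ : 0 < ℓ) {h : ℝ → ℝ}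
    (hh : AbsolutelyContinuousOnInterval h 0 ℓ) {u w : L2 ℓ}
    (hu : u =ᵐ[volume.restrict (Ioo 0 ℓ)] h) (hw : w =ᵐ[volume.restrict (Ioo 0 ℓ)] deriv h) :
    IsWeakDeriv ℓ u w := by
  intro φ hφ
  have e1 : ∫ x in Ioo 0 ℓ, u x * deriv φ x = ∫ x in Ioo 0 ℓ, h x * deriv φ x := by
    refine integral_congr_ae ?_
    filter_upwards [hu] with x hx
    rw [hx]
  have e2 : ∫ x in Ioo 0 ℓ, w x * φ x = ∫ x in Ioo 0 ℓ, deriv h x * φ x := by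
    refine integral_congr_ae ?_
    filter_upwards [hw] with x hx
    rw [hx]
  rw [e1, e2, setIntegral_eq_intervalIntegral hℓ, setIntegral_eq_intervalIntegral hℓ,
    hh.integral_mul_deriv_eq_deriv_mul hφ.absolutelyContinuousOnInterval, hφ.apply_zero,
    hφ.apply_right]
  ring

theorem inner_eq_integral (u v : L2 ℓ) : ⟪u, v⟫ = ∫ x in Ioo 0 ℓ, u x * v x := by
  rw [L2.inner_def]
  simp [mul_comm]

theorem inner_toLp_test (u : L2 ℓ) {φ : ℝ → ℝ} (hφ : IsTest ℓ φ) :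
    ⟪u, hφ.memLp.toLp⟫ = ∫ x in Ioo 0 ℓ, u x * φ x := by
  rw [inner_eq_integral]
  refine integral_congr_ae ?_
  filter_upwards [hφ.memLp.coeFn_toLp] with x hx
  rw [hx]

/-- Du Bois-Reymond's lemma. -/
theorem IsWeakDeriv.exists_const (hℓ : 0 < ℓ) {u : L2 ℓ} (h : IsWeakDeriv ℓ u 0) :
    ∃ c : ℝ, u =ᵐ[volume.restrict (Ioo 0 ℓ)] fun _ => c := by
  obtain ⟨ψ₀, hψ₀, hψ₀1⟩ := exists_test_integral_eq_one hℓ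
  set c : ℝ := ∫ x in Ioo 0 ℓ, u x * ψ₀ x with hc
  refine ⟨c, ?_⟩
  have key : (fun x => u x - c) =ᵐ[volume.restrict (Ioo 0 ℓ)] 0 := by
    refine ae_eq_zero_of_test ((integrableOn_coe u).sub (integrableOn_const (by simp))) ?_
    intro ψ hψ
    set m : ℝ := ∫ x, ψ x with hm
    have hψi : Integrable ψ := hψ.contDiff.continuous.integrable_of_hasCompactSupport
      hψ.hasCompactSupport
    have hψ₀i : Integrable ψ₀ := hψ₀.contDiff.continuous.integrable_of_hasCompactSupport
      hψ₀.hasCompactSupport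
    obtain ⟨φ, hφ, hφd⟩ := (hψ.add (hψ₀.const_smul (-m))).exists_primitive (by
      simp only [Pi.add_apply, Pi.smul_apply, smul_eq_mul]
      rw [integral_add hψi (hψ₀i.const_mul _), integral_const_mul, hψ₀1, ← hm]
      ring)
    have e1 := h φ hφ
    rw [integral_zero_mul, neg_zero, hφd] at e1
    have e2 : ∫ x in Ioo 0 ℓ, u x * (ψ + (-m) • ψ₀) x = (∫ x in Ioo 0 ℓ, u x * ψ x) - m * c := by
      rw [hc, ← integral_const_mul,
        ← integral_sub (integrable_mul_test u hψ) ((integrable_mul_test u hψ₀).const_mul m)]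
      congr 1
      funext x
      simp only [Pi.add_apply, Pi.smul_apply, smul_eq_mul]
      ring
    have e3 : ∫ x in Ioo 0 ℓ, (u x - c) * ψ x = (∫ x in Ioo 0 ℓ, u x * ψ x) - c * m := by
      rw [hm, ← hψ.setIntegral_eq, ← integral_const_mul,
        ← integral_sub (integrable_mul_test u hψ) (hψi.restrict.const_mul c)]
      congr 1
      funext x
      ring
    rw [e3]
    linarith
  filter_upwards [key] with x hx
  exact sub_eq_zero.1 hx

theorem memLp_of_continuousOn {h : ℝ → ℝ} (hh : ContinuousOn h (Icc 0 ℓ)) :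
    MemLp h 2 (volume.restrict (Ioo 0 ℓ)) := by
  obtain ⟨C, hC⟩ := isCompact_Icc.exists_bound_of_continuousOn hh
  refine MemLp.of_bound ((hh.mono Ioo_subset_Icc_self).aestronglyMeasurable measurableSet_Ioo) C ?_
  filter_upwards [ae_restrict_mem measurableSet_Ioo] with x hx
  exact hC x (Ioo_subset_Icc_self hx)

theorem dense_testSpace : Dense (testSpace ℓ : Set (L2 ℓ)) := by
  rw [Submodule.dense_iff_topologicalClosure_eq_top, Submodule.topologicalClosure_eq_top_iff,
    Submodule.eq_bot_iff]
  intro u hu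
  refine Lp.eq_zero_iff_ae_eq_zero.2 (ae_eq_zero_of_test (integrableOn_coe u) fun φ hφ => ?_)
  have h1 := (Submodule.mem_orthogonal _ _).1 hu (hφ.memLp.toLp)
    ⟨φ, hφ, hφ.memLp.coeFn_toLp⟩
  rwa [real_inner_comm, inner_toLp_test u hφ] at h1

variable [hℓ : Fact (0 < ℓ)]

theorem _root_.AbsolutelyContinuousOnInterval.continuousOn_Icc {h : ℝ → ℝ}
    (hh : AbsolutelyContinuousOnInterval h 0 ℓ) : ContinuousOn h (Icc 0 ℓ) := by
  simpa [uIcc_of_le hℓ.out.le] using hh.continuousOn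

/-- An absolutely continuous function whose derivative is square integrable is in `H¹(0, ℓ)`. -/
theorem exists_H1_of_absolutelyContinuous {h : ℝ → ℝ} (hh : AbsolutelyContinuousOnInterval h 0 ℓ)
    (hd : MemLp (deriv h) 2 (volume.restrict (Ioo 0 ℓ))) :
    ∃ u : H1 ℓ, (u : L2 ℓ) =ᵐ[volume.restrict (Ioo 0 ℓ)] h ∧
      weakDeriv ℓ u =ᵐ[volume.restrict (Ioo 0 ℓ)] deriv h ∧ EqOn (contRep u) h (Icc 0 ℓ) := by
  have hw := isWeakDeriv_of_absolutelyContinuous hℓ.out hh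
    (memLp_of_continuousOn hh.continuousOn_Icc).coeFn_toLp hd.coeFn_toLp
  have hu := (memLp_of_continuousOn hh.continuousOn_Icc).coeFn_toLp
  refine ⟨⟨_, _, hw⟩, hu, ?_, contRep_eq _ hh.continuousOn_Icc hu⟩
  rw [weakDeriv_eq _ hw]
  exact hd.coeFn_toLp

theorem exists_absolutelyContinuous_primitive (w : L2 ℓ) :
    ∃ W : ℝ → ℝ, AbsolutelyContinuousOnInterval W 0 ℓ ∧
      w =ᵐ[volume.restrict (Ioo 0 ℓ)] deriv W := by
  have hw : IntervalIntegrable (w : ℝ → ℝ) volume 0 ℓ :=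
    (intervalIntegrable_iff_integrableOn_Ioo_of_le hℓ.out.le).2 (integrableOn_coe w)
  refine ⟨fun x => ∫ t in (0 : ℝ)..x, w t,
    hw.absolutelyContinuousOnInterval_intervalIntegral left_mem_uIcc, ?_⟩
  refine (ae_restrict_iff' measurableSet_Ioo).2 ?_
  filter_upwards [hw.ae_hasDerivAt_integral] with x hx hx'
  have : x ∈ uIcc 0 ℓ := by
    rw [uIcc_of_le hℓ.out.le]
    exact Ioo_subset_Icc_self hx'
  rw [(hx this 0 left_mem_uIcc).deriv]

theorem exists_H1_weakDeriv_eq (w : L2 ℓ) : ∃ u : H1 ℓ, weakDeriv ℓ u = w := by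
  obtain ⟨W, hW, hd⟩ := exists_absolutelyContinuous_primitive w
  obtain ⟨u, -, hu, -⟩ := exists_H1_of_absolutelyContinuous hW ((Lp.memLp w).ae_eq hd)
  exact ⟨u, Lp.ext (hu.trans hd.symm)⟩

/-- The continuous representative of `u ∈ H¹(0, ℓ)` may be taken absolutely continuous, with the
weak derivative as its derivative. -/
theorem exists_absolutelyContinuous_rep (u : H1 ℓ) :
    ∃ h : ℝ → ℝ, AbsolutelyContinuousOnInterval h 0 ℓ ∧
      (u : L2 ℓ) =ᵐ[volume.restrict (Ioo 0 ℓ)] h ∧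
      weakDeriv ℓ u =ᵐ[volume.restrict (Ioo 0 ℓ)] deriv h ∧ EqOn (contRep u) h (Icc 0 ℓ) := by
  set w := weakDeriv ℓ u with hwdef
  obtain ⟨W, hac, hdW⟩ := exists_absolutelyContinuous_primitive w
  have hWL := memLp_of_continuousOn hac.continuousOn_Icc
  have h1 : IsWeakDeriv ℓ (hWL.toLp) w :=
    isWeakDeriv_of_absolutelyContinuous hℓ.out hac hWL.coeFn_toLp hdW
  have h2 : IsWeakDeriv ℓ ((u : L2 ℓ) + (-1 : ℝ) • hWL.toLp) 0 := by
    have := (isWeakDeriv_weakDeriv u).add (h1.smul (-1))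
    rwa [← hwdef, neg_one_smul, neg_one_smul, add_neg_cancel, ← neg_one_smul ℝ] at this
  obtain ⟨c, hc⟩ := h2.exists_const hℓ.out
  have hac' : AbsolutelyContinuousOnInterval (fun x => W x + c) 0 ℓ :=
    hac.add (LipschitzOnWith.absolutelyContinuousOnInterval (K := 0)
      ((LipschitzWith.const c).lipschitzOnWith))
  have hu : (u : L2 ℓ) =ᵐ[volume.restrict (Ioo 0 ℓ)] fun x => W x + c := by
    filter_upwards [hc, Lp.coeFn_add (u : L2 ℓ) ((-1 : ℝ) • hWL.toLp),
      Lp.coeFn_smul (-1 : ℝ) hWL.toLp, hWL.coeFn_toLp] with x hx h3 h4 h5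
    rw [h3, Pi.add_apply, h4, Pi.smul_apply, h5, smul_eq_mul] at hx
    linarith
  refine ⟨_, hac', hu, ?_, contRep_eq _ hac'.continuousOn_Icc hu⟩
  filter_upwards [hdW] with x hx
  rw [hx, deriv_add_const]

theorem γ₀_apply_zero (u : H1 ℓ) : γ₀ ℓ u 0 = contRep u 0 := rfl

theorem γ₀_apply_one (u : H1 ℓ) : γ₀ ℓ u 1 = contRep u ℓ := rfl

/-- Integration by parts in `H¹(0, ℓ)`. -/
theorem inner_weakDeriv_add (u v : H1 ℓ) :
    ⟪weakDeriv ℓ u, (v : L2 ℓ)⟫ + ⟪(u : L2 ℓ), weakDeriv ℓ v⟫ =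
      γ₀ ℓ u 1 * γ₀ ℓ v 1 - γ₀ ℓ u 0 * γ₀ ℓ v 0 := by
  obtain ⟨f, hf, huf, hdf, ef⟩ := exists_absolutelyContinuous_rep u
  obtain ⟨g, hg, hvg, hdg, eg⟩ := exists_absolutelyContinuous_rep v
  have h0 : (0 : ℝ) ∈ Icc 0 ℓ := left_mem_Icc.2 hℓ.out.le
  have h1 : ℓ ∈ Icc 0 ℓ := right_mem_Icc.2 hℓ.out.le
  have e1 : ⟪weakDeriv ℓ u, (v : L2 ℓ)⟫ = ∫ x in (0 : ℝ)..ℓ, deriv f x * g x := by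
    rw [inner_eq_integral, ← setIntegral_eq_intervalIntegral hℓ.out]
    refine integral_congr_ae ?_
    filter_upwards [hdf, hvg] with x hx hx'
    rw [hx, hx']
  have e2 : ⟪(u : L2 ℓ), weakDeriv ℓ v⟫ = ∫ x in (0 : ℝ)..ℓ, f x * deriv g x := by
    rw [inner_eq_integral, ← setIntegral_eq_intervalIntegral hℓ.out]
    refine integral_congr_ae ?_
    filter_upwards [huf, hdg] with x hx hx'
    rw [hx, hx']
  rw [e1, e2, hf.integral_mul_deriv_eq_deriv_mul hg, γ₀_apply_zero, γ₀_apply_zero, γ₀_apply_one,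
    γ₀_apply_one, ef h0, ef h1, eg h0, eg h1]
  ring

theorem exists_sharp_H1_of_rep (u : H1 ℓ) {h : ℝ → ℝ} (hh : AbsolutelyContinuousOnInterval h 0 ℓ)
    (huh : (u : L2 ℓ) =ᵐ[volume.restrict (Ioo 0 ℓ)] h)
    (hdh : weakDeriv ℓ u =ᵐ[volume.restrict (Ioo 0 ℓ)] deriv h) :
    ∃ v : H1 ℓ, (v : L2 ℓ) = sharpL2 (u : L2 ℓ) ∧ γ₀ ℓ v = sharpE2 (γ₀ ℓ u) ∧
      weakDeriv ℓ v =ᵐ[volume.restrict (Ioo 0 ℓ)] deriv (fun x => cut (h x)) ∧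
      ‖weakDeriv ℓ v‖ ≤ ‖weakDeriv ℓ u‖ := by
  have eh := contRep_eq u hh.continuousOn_Icc huh
  have hle : ∀ᵐ x ∂(volume.restrict (Ioo 0 ℓ)),
      ‖deriv (fun x => cut (h x)) x‖ ≤ ‖weakDeriv ℓ u x‖ := by
    have h1 : ∀ᵐ x ∂(volume.restrict (Ioo 0 ℓ)), DifferentiableAt ℝ h x := by
      refine (ae_restrict_iff' measurableSet_Ioo).2 ?_
      filter_upwards [hh.ae_differentiableAt] with x hx hx'
      refine hx ?_
      rw [uIcc_of_le hℓ.out.le]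
      exact Ioo_subset_Icc_self hx'
    filter_upwards [h1, hdh] with x hx hx'
    rw [hx']
    exact abs_deriv_cut_comp_le hx
  have hmem : MemLp (deriv fun x => cut (h x)) 2 (volume.restrict (Ioo 0 ℓ)) :=
    (Lp.memLp (weakDeriv ℓ u)).mono (measurable_deriv _).aestronglyMeasurable hle
  obtain ⟨v, hv, hdv, ev⟩ := exists_H1_of_absolutelyContinuous hh.cut_comp hmem
  refine ⟨v, Lp.ext ?_, ?_, hdv, ?_⟩
  · filter_upwards [hv, huh, coeFn_sharpL2 (u : L2 ℓ)] with x h1 h2 h3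
    rw [h1, h3, h2]
  · ext i
    fin_cases i
    · change contRep v 0 = cut (contRep u 0)
      rw [ev (left_mem_Icc.2 hℓ.out.le), eh (left_mem_Icc.2 hℓ.out.le)]
    · change contRep v ℓ = cut (contRep u ℓ)
      rw [ev (right_mem_Icc.2 hℓ.out.le), eh (right_mem_Icc.2 hℓ.out.le)]
  · refine Lp.norm_le_norm_of_ae_le ?_
    filter_upwards [hdv, hle] with x h1 h2
    rw [h1]
    exact h2

theorem exists_sharp_H1 (u : H1 ℓ) : ∃ v : H1 ℓ, (v : L2 ℓ) = sharpL2 (u : L2 ℓ) ∧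
    γ₀ ℓ v = sharpE2 (γ₀ ℓ u) ∧ ‖weakDeriv ℓ v‖ ≤ ‖weakDeriv ℓ u‖ := by
  obtain ⟨h, hh, huh, hdh, -⟩ := exists_absolutelyContinuous_rep u
  obtain ⟨v, h1, h2, -, h3⟩ := exists_sharp_H1_of_rep u hh huh hdh
  exact ⟨v, h1, h2, h3⟩

theorem γ₀_test {u : H1 ℓ} {φ : ℝ → ℝ} (hφ : IsTest ℓ φ)
    (hu : (u : L2 ℓ) =ᵐ[volume.restrict (Ioo 0 ℓ)] φ) : γ₀ ℓ u = 0 := by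
  have h := contRep_eq u hφ.contDiff.continuous.continuousOn hu
  ext i
  fin_cases i
  · change contRep u 0 = 0
    rw [h (left_mem_Icc.2 hℓ.out.le), hφ.apply_zero]
  · change contRep u ℓ = 0
    rw [h (right_mem_Icc.2 hℓ.out.le), hφ.apply_right]

end Sobolev

end IntervalMarkov

/-! ### Traces, Green's formula and the forms `F_N + f` -/

namespace IntervalMarkov

section Closed

variable {ℓ : ℝ}

/-- The weak derivative is a closed operator. -/
theorem IsWeakDeriv.of_tendsto {s w : ℕ → L2 ℓ} {u v : L2 ℓ}
    (h : ∀ n, IsWeakDeriv ℓ (s n) (w n)) (hs : Tendsto s atTop (𝓝 u))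
    (hw : Tendsto w atTop (𝓝 v)) : IsWeakDeriv ℓ u v := by
  intro φ hφ
  rw [← inner_toLp_test u hφ.derivTest, ← inner_toLp_test v hφ]
  refine tendsto_nhds_unique (hs.inner tendsto_const_nhds) ?_
  refine (hw.inner tendsto_const_nhds).neg.congr fun n => ?_
  rw [inner_toLp_test _ hφ.derivTest, inner_toLp_test _ hφ, h n φ hφ]

end Closed

section Traces

variable {ℓ : ℝ} [hℓ : Fact (0 < ℓ)]

theorem exists_H1_of_contDiff {h : ℝ → ℝ} (hh : ContDiff ℝ 1 h) :
    ∃ u : H1 ℓ, (u : L2 ℓ) =ᵐ[volume.restrict (Ioo 0 ℓ)] h ∧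
      weakDeriv ℓ u =ᵐ[volume.restrict (Ioo 0 ℓ)] deriv h ∧ EqOn (contRep u) h (Icc 0 ℓ) :=
  exists_H1_of_absolutelyContinuous hh.contDiffOn.absolutelyContinuousOnInterval
    (memLp_of_continuousOn (hh.continuous_deriv le_rfl).continuousOn)

theorem ext_E2 {ξ ζ : E2} (h0 : ξ 0 = ζ 0) (h1 : ξ 1 = ζ 1) : ξ = ζ := by
  ext i
  fin_cases i
  · exact h0
  · exact h1

theorem norm_sq_E2 (ξ : E2) : ‖ξ‖ ^ 2 = ξ 0 ^ 2 + ξ 1 ^ 2 := by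
  rw [EuclideanSpace.norm_sq_eq, Fin.sum_univ_two]
  simp

theorem inner_E2 (ξ ζ : E2) : ⟪ξ, ζ⟫ = ξ 0 * ζ 0 + ξ 1 * ζ 1 := by
  rw [PiLp.inner_apply, Fin.sum_univ_two]
  simp [mul_comm]

/-- The traces `γ₀` and `γ₁` are jointly surjective: cubic Hermite interpolation. -/
theorem exists_H2_traces (ξ η : E2) :
    ∃ u : H2 ℓ, γ₀ ℓ (H2toH1 ℓ u) = ξ ∧ γ₁ ℓ u = η := by
  have hℓ0 : ℓ ≠ 0 := hℓ.out.ne'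
  set c : ℝ := 3 * (ξ 1 - ξ 0) / ℓ ^ 2 - (2 * η 0 - η 1) / ℓ with hc
  set d : ℝ := 2 * (ξ 0 - ξ 1) / ℓ ^ 3 + (η 0 - η 1) / ℓ ^ 2 with hd
  set f : ℝ → ℝ := fun x => ξ 0 + η 0 * x + c * x ^ 2 + d * x ^ 3 with hf
  set g : ℝ → ℝ := fun x => η 0 + 2 * c * x + 3 * d * x ^ 2 with hg
  have hfg : deriv f = g := by
    funext x
    have h1 : HasDerivAt f (0 + η 0 * 1 + c * (2 * x ^ 1) + d * (3 * x ^ 2)) x :=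
      (((hasDerivAt_const x (ξ 0)).add ((hasDerivAt_id x).const_mul (η 0))).add
        ((hasDerivAt_pow 2 x).const_mul c)).add ((hasDerivAt_pow 3 x).const_mul d)
    rw [h1.deriv, hg]
    ring
  obtain ⟨u, hu, hdu, eu⟩ := exists_H1_of_contDiff (ℓ := ℓ) (h := f) (by fun_prop)
  obtain ⟨v, hv, hdv, ev⟩ := exists_H1_of_contDiff (ℓ := ℓ) (h := g) (by fun_prop)
  have huv : weakDeriv ℓ u = v := by
    refine Lp.ext ?_
    filter_upwards [hdu, hv] with x h1 h2
    rw [h1, h2, hfg]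
  have hu2 : (u : L2 ℓ) ∈ H2 ℓ := ⟨u, by
    change weakDeriv ℓ u ∈ H1 ℓ
    rw [huv]
    exact v.2, rfl⟩
  have hD : derivH2 ℓ ⟨u, hu2⟩ = v := Subtype.ext huv
  have h0 : (0 : ℝ) ∈ Icc 0 ℓ := left_mem_Icc.2 hℓ.out.le
  have h1 : ℓ ∈ Icc 0 ℓ := right_mem_Icc.2 hℓ.out.le
  refine ⟨⟨u, hu2⟩, ext_E2 ?_ ?_, ext_E2 ?_ ?_⟩
  · change contRep u 0 = _
    rw [eu h0]
    simp [hf]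
  · change contRep u ℓ = _
    rw [eu h1, hf, hc, hd]
    field_simp
    ring
  · change contRep (derivH2 ℓ ⟨u, hu2⟩) 0 = _
    rw [hD, ev h0]
    simp [hg]
  · change -contRep (derivH2 ℓ ⟨u, hu2⟩) ℓ = _
    rw [hD, ev h1, hg, hc, hd]
    field_simp
    ring

/-- A prescribed trace is attained by functions of arbitrarily small `L²` norm, since test functions
have vanishing trace and are dense. -/
theorem exists_H1_trace_norm_lt (ξ : E2) {ε : ℝ} (hε : 0 < ε) :
    ∃ m : H1 ℓ, γ₀ ℓ m = ξ ∧ ‖(m : L2 ℓ)‖ < ε := by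
  obtain ⟨u, hu, -⟩ := exists_H2_traces (ℓ := ℓ) ξ 0
  obtain ⟨φ, hφ, hd⟩ := (dense_testSpace (ℓ := ℓ)).exists_dist_lt (u : L2 ℓ) hε
  obtain ⟨f, hf, hφf⟩ := id hφ
  refine ⟨H2toH1 ℓ u - ⟨φ, H2_le_H1 ℓ (testSpace_le_H2 ℓ hφ)⟩, ?_, ?_⟩
  · rw [map_sub, hu, γ₀_test hf hφf, sub_zero]
  · rwa [dist_eq_norm] at hd

/-- The trace inequality: `γ₀` is bounded by the derivative with arbitrarily small relative
bound. -/
theorem exists_norm_γ₀_sq_le {ε : ℝ} (hε : 0 < ε) : ∃ C : ℝ, 0 ≤ C ∧ ∀ u : H1 ℓ,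
    ‖γ₀ ℓ u‖ ^ 2 ≤ ε * ‖weakDeriv ℓ u‖ ^ 2 + C * ‖(u : L2 ℓ)‖ ^ 2 := by
  obtain ⟨m, hm, hmε⟩ := exists_H1_trace_norm_lt (ℓ := ℓ) !₂[1, 0]
    (show 0 < √ε / 2 by positivity)
  obtain ⟨n, hn, hnε⟩ := exists_H1_trace_norm_lt (ℓ := ℓ) !₂[0, 1]
    (show 0 < √ε / 2 by positivity)
  refine ⟨2 * ‖weakDeriv ℓ m‖ ^ 2 + 2 * ‖weakDeriv ℓ n‖ ^ 2, by positivity, fun u => ?_⟩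
  have key : ∀ (k : H1 ℓ), ‖(k : L2 ℓ)‖ < √ε / 2 →
      (⟪weakDeriv ℓ u, (k : L2 ℓ)⟫ + ⟪(u : L2 ℓ), weakDeriv ℓ k⟫) ^ 2 ≤
        ε / 2 * ‖weakDeriv ℓ u‖ ^ 2 + 2 * ‖weakDeriv ℓ k‖ ^ 2 * ‖(u : L2 ℓ)‖ ^ 2 := by
    intro k hk
    have h1 := sq_le_sq.2 ((abs_real_inner_le_norm (weakDeriv ℓ u) (k : L2 ℓ)).trans
      (le_abs_self _))
    have h2 := sq_le_sq.2 ((abs_real_inner_le_norm (u : L2 ℓ) (weakDeriv ℓ k)).trans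
      (le_abs_self _))
    have h3 : ‖(k : L2 ℓ)‖ ^ 2 ≤ ε / 4 := by
      have : ‖(k : L2 ℓ)‖ ^ 2 ≤ (√ε / 2) ^ 2 := by gcongr
      rw [div_pow, Real.sq_sqrt hε.le] at this
      linarith
    have h4 : ‖weakDeriv ℓ u‖ ^ 2 * ‖(k : L2 ℓ)‖ ^ 2 ≤ ‖weakDeriv ℓ u‖ ^ 2 * (ε / 4) := by gcongr
    rw [mul_pow] at h1 h2
    nlinarith [sq_nonneg (⟪weakDeriv ℓ u, (k : L2 ℓ)⟫ - ⟪(u : L2 ℓ), weakDeriv ℓ k⟫)]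
  have e0 := inner_weakDeriv_add u m
  have e1 := inner_weakDeriv_add u n
  have k0 := key m hmε
  have k1 := key n hnε
  rw [e0, hm] at k0
  rw [e1, hn] at k1
  rw [norm_sq_E2]
  simp at k0 k1
  nlinarith

/-- Green's formula in `H²(0, ℓ)`. -/
theorem inner_secondDeriv (u : H2 ℓ) (v : H1 ℓ) :
    ⟪secondDeriv ℓ u, (v : L2 ℓ)⟫ =
      -⟪weakDeriv ℓ (H2toH1 ℓ u), weakDeriv ℓ v⟫ - ⟪γ₁ ℓ u, γ₀ ℓ v⟫ := by
  have h := inner_weakDeriv_add (derivH2 ℓ u) v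
  have e : ⟪γ₁ ℓ u, γ₀ ℓ v⟫ = γ₀ ℓ (derivH2 ℓ u) 0 * γ₀ ℓ v 0 +
      -γ₀ ℓ (derivH2 ℓ u) 1 * γ₀ ℓ v 1 := inner_E2 _ _
  have e1 : weakDeriv ℓ (derivH2 ℓ u) = secondDeriv ℓ u := rfl
  have e2 : (derivH2 ℓ u : L2 ℓ) = weakDeriv ℓ (H2toH1 ℓ u) := rfl
  rw [e1, e2] at h
  linarith

/-- The second Green's formula. -/
theorem inner_secondDeriv_sub (u v : H2 ℓ) :
    ⟪secondDeriv ℓ u, (v : L2 ℓ)⟫ - ⟪(u : L2 ℓ), secondDeriv ℓ v⟫ =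
      ⟪γ₀ ℓ (H2toH1 ℓ u), γ₁ ℓ v⟫ - ⟪γ₁ ℓ u, γ₀ ℓ (H2toH1 ℓ v)⟫ := by
  have h1 := inner_secondDeriv u (H2toH1 ℓ v)
  have h2 := inner_secondDeriv v (H2toH1 ℓ u)
  have e1 : (H2toH1 ℓ u : L2 ℓ) = u := rfl
  have e2 : (H2toH1 ℓ v : L2 ℓ) = v := rfl
  rw [e2] at h1
  rw [e1] at h2
  have c1 := real_inner_comm (u : L2 ℓ) (secondDeriv ℓ v)
  have c2 := real_inner_comm (weakDeriv ℓ (H2toH1 ℓ v)) (weakDeriv ℓ (H2toH1 ℓ u))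
  have c3 := real_inner_comm (γ₀ ℓ (H2toH1 ℓ u)) (γ₁ ℓ v)
  linarith

end Traces

section TraceForm

variable {ℓ : ℝ} [hℓ : Fact (0 < ℓ)]

theorem mem_traceDomain_iff {f : FormOn E2} {u : L2 ℓ} :
    u ∈ traceDomain ℓ f ↔ ∃ h : u ∈ H1 ℓ, γ₀ ℓ ⟨u, h⟩ ∈ f.domain := by
  constructor
  · rintro ⟨u, hu, rfl⟩
    exact ⟨u.2, hu⟩
  · rintro ⟨h, hu⟩
    exact ⟨⟨u, h⟩, hu, rfl⟩

theorem neumannPlusTrace_apply (f : FormOn E2) (u v : (neumannPlusTrace ℓ f).domain) :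
    (neumannPlusTrace ℓ f).form u v =
      ⟪weakDeriv ℓ (traceDomainToH1 ℓ f u), weakDeriv ℓ (traceDomainToH1 ℓ f v)⟫ +
        f.form (traceToDomain ℓ f u) (traceToDomain ℓ f v) := rfl

namespace Couple

variable (p : Couple)

theorem form_apply (ξ ζ : p.form.domain) :
    p.form.form ξ ζ = ⟪(p.op ξ : E2), (ζ : E2)⟫ := rfl

theorem form_isSymm : p.form.IsSymm := by
  intro ξ ζ
  exact (p.isSymmetric ξ ζ).trans (real_inner_comm _ _)

theorem exists_abs_form_le : ∃ C : ℝ, 0 ≤ C ∧ ∀ ξ : p.form.domain,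
    |p.form.form ξ ξ| ≤ C * ‖(ξ : E2)‖ ^ 2 := by
  refine ⟨‖LinearMap.toContinuousLinearMap p.op‖, ContinuousLinearMap.opNorm_nonneg _, fun ξ => ?_⟩
  change |⟪p.op ξ, ξ⟫| ≤ _
  refine (abs_real_inner_le_norm _ _).trans ?_
  have := (LinearMap.toContinuousLinearMap p.op).le_opNorm ξ
  rw [sq, ← mul_assoc]
  exact mul_le_mul_of_nonneg_right this (norm_nonneg _)

theorem neumannPlusTrace_isSymm : (neumannPlusTrace ℓ p.form).IsSymm := by
  intro u v
  rw [neumannPlusTrace_apply, neumannPlusTrace_apply, real_inner_comm, p.form_isSymm]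

theorem form_isClosed : p.form.IsClosed := by
  intro s u hs _
  have hcl : IsClosed (p.proj.range : Set E2) := Submodule.closed_of_finiteDimensional _
  have hu : u ∈ p.form.domain := hcl.mem_of_tendsto hs (Eventually.of_forall fun n => (s n).2)
  obtain ⟨C, -, hC⟩ := p.exists_abs_form_le
  refine ⟨hu, squeeze_zero_norm (fun n => hC _) ?_⟩
  have h1 : Tendsto (fun n => C * ‖(s n : E2) - u‖ ^ 2) atTop (𝓝 (C * ‖u - u‖ ^ 2)) :=
    ((hs.sub_const u).norm.pow 2).const_mul C
  simpa using h1

variable (ℓ)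

/-- The form controls half of the Dirichlet integral up to the `L²` norm. -/
theorem exists_half_norm_sq_le : ∃ C : ℝ, 0 ≤ C ∧ ∀ u : (neumannPlusTrace ℓ p.form).domain,
    1 / 2 * ‖weakDeriv ℓ (traceDomainToH1 ℓ p.form u)‖ ^ 2 ≤
      (neumannPlusTrace ℓ p.form).form u u + C * ‖(u : L2 ℓ)‖ ^ 2 := by
  obtain ⟨C, hC0, hC⟩ := p.exists_abs_form_le
  obtain ⟨D, hD0, hD⟩ := exists_norm_γ₀_sq_le (ℓ := ℓ) (show 0 < 1 / (2 * (C + 1)) by positivity)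
  refine ⟨C * D, by positivity, fun u => ?_⟩
  rw [neumannPlusTrace_apply, real_inner_self_eq_norm_sq]
  have h1 := neg_le_of_abs_le (hC (traceToDomain ℓ p.form u))
  have h2 := hD (traceDomainToH1 ℓ p.form u)
  have e1 : (traceToDomain ℓ p.form u : E2) = γ₀ ℓ (traceDomainToH1 ℓ p.form u) := rfl
  have e2 : (traceDomainToH1 ℓ p.form u : L2 ℓ) = u := rfl
  rw [e1] at h1
  rw [e2] at h2
  set a := ‖weakDeriv ℓ (traceDomainToH1 ℓ p.form u)‖ ^ 2
  have ha : 0 ≤ a := by positivity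
  have h3 : C * (1 / (2 * (C + 1)) * a) ≤ 1 / 2 * a := by
    have : C * (1 / (2 * (C + 1))) ≤ 1 / 2 := by
      rw [mul_one_div, div_le_div_iff₀ (by positivity) (by positivity)]
      linarith
    rw [← mul_assoc]
    exact mul_le_mul_of_nonneg_right this ha
  have h4 := mul_le_mul_of_nonneg_left h2 hC0
  rw [mul_add] at h4
  linarith

theorem neumannPlusTrace_isLowerBounded : (neumannPlusTrace ℓ p.form).IsLowerBounded := by
  obtain ⟨C, -, hC⟩ := p.exists_half_norm_sq_le ℓ
  refine ⟨C, fun u => ?_⟩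
  have := hC u
  have h2 : 0 ≤ 1 / 2 * ‖weakDeriv ℓ (traceDomainToH1 ℓ p.form u)‖ ^ 2 := by positivity
  linarith

theorem neumannPlusTrace_isClosed : (neumannPlusTrace ℓ p.form).IsClosed := by
  intro s u hs hF
  set D : (neumannPlusTrace ℓ p.form).domain →ₗ[ℝ] L2 ℓ :=
    (weakDeriv ℓ).comp (traceDomainToH1 ℓ p.form) with hDdef
  obtain ⟨C, hC0, hC⟩ := p.exists_half_norm_sq_le ℓ
  -- the derivatives form a Cauchy sequence
  have hcau : CauchySeq fun n => D (s n) := by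
    have hs2 : Tendsto (fun q : ℕ × ℕ => ‖(s q.1 : L2 ℓ) - s q.2‖ ^ 2) atTop (𝓝 0) := by
      have h1 : Tendsto (fun q : ℕ × ℕ => (s q.1 : L2 ℓ)) atTop (𝓝 u) := by
        rw [← prod_atTop_atTop_eq]
        exact hs.comp tendsto_fst
      have h2 : Tendsto (fun q : ℕ × ℕ => (s q.2 : L2 ℓ)) atTop (𝓝 u) := by
        rw [← prod_atTop_atTop_eq]
        exact hs.comp tendsto_snd
      simpa using (h1.sub h2).norm.pow 2
    have h3 : Tendsto (fun q : ℕ × ℕ => ‖D (s q.1) - D (s q.2)‖ ^ 2) atTop (𝓝 0) := by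
      have h4 := (hF.add (hs2.const_mul C)).const_mul 2
      rw [mul_zero, add_zero, mul_zero] at h4
      refine squeeze_zero (fun q => by positivity) (fun q => ?_) h4
      have h5 := hC (s q.1 - s q.2)
      have e : weakDeriv ℓ (traceDomainToH1 ℓ p.form (s q.1 - s q.2)) = D (s q.1) - D (s q.2) :=
        map_sub D _ _
      rw [e, Submodule.coe_sub] at h5
      linarith
    rw [cauchySeq_iff_tendsto_dist_atTop_0]
    simpa [dist_eq_norm] using h3.sqrt
  obtain ⟨w, hw⟩ := cauchySeq_tendsto_of_complete hcau
  have huw : IsWeakDeriv ℓ u w :=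
    IsWeakDeriv.of_tendsto (fun n => isWeakDeriv_weakDeriv (traceDomainToH1 ℓ p.form (s n))) hs hw
  set u' : H1 ℓ := ⟨u, w, huw⟩ with hu'
  have hu'w : weakDeriv ℓ u' = w := weakDeriv_eq _ huw
  have hDn : Tendsto (fun n => ‖D (s n) - w‖ ^ 2) atTop (𝓝 0) := by
    simpa using (hw.sub_const w).norm.pow 2
  have hsn : Tendsto (fun n => ‖(s n : L2 ℓ) - u‖ ^ 2) atTop (𝓝 0) := by
    simpa using (hs.sub_const u).norm.pow 2
  -- the traces converge
  obtain ⟨K, hK0, hK⟩ := exists_norm_γ₀_sq_le (ℓ := ℓ) one_pos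
  have hγ : Tendsto (fun n => ‖γ₀ ℓ (traceDomainToH1 ℓ p.form (s n)) - γ₀ ℓ u'‖ ^ 2) atTop
      (𝓝 0) := by
    have h4 := (hDn.const_mul 1).add (hsn.const_mul K)
    rw [mul_zero, mul_zero, add_zero] at h4
    refine squeeze_zero (fun n => by positivity) (fun n => ?_) h4
    have h5 := hK (traceDomainToH1 ℓ p.form (s n) - u')
    rw [map_sub, map_sub, hu'w] at h5
    exact h5
  have hγ' : Tendsto (fun n => γ₀ ℓ (traceDomainToH1 ℓ p.form (s n))) atTop (𝓝 (γ₀ ℓ u')) := by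
    rw [tendsto_iff_norm_sub_tendsto_zero]
    have := hγ.sqrt
    simpa using this
  have hcl : IsClosed (p.proj.range : Set E2) := Submodule.closed_of_finiteDimensional _
  have hmem : γ₀ ℓ u' ∈ p.form.domain :=
    hcl.mem_of_tendsto hγ' (Eventually.of_forall fun n => γ₀_mem_domain ℓ p.form (s n))
  have hu : u ∈ (neumannPlusTrace ℓ p.form).domain := mem_traceDomain_iff.2 ⟨u'.2, hmem⟩
  refine ⟨hu, ?_⟩
  obtain ⟨B, -, hB⟩ := p.exists_abs_form_le
  have h7 := hDn.add (hγ.const_mul B)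
  rw [mul_zero, add_zero] at h7
  refine squeeze_zero_norm (fun n => ?_) h7
  have e1 : weakDeriv ℓ (traceDomainToH1 ℓ p.form
      (s n - (⟨u, hu⟩ : (neumannPlusTrace ℓ p.form).domain))) = D (s n) - w := by
    rw [← hu'w]
    exact map_sub D (s n) ⟨u, hu⟩
  have e2 : (traceToDomain ℓ p.form (s n - (⟨u, hu⟩ : (neumannPlusTrace ℓ p.form).domain)) : E2) =
      γ₀ ℓ (traceDomainToH1 ℓ p.form (s n)) - γ₀ ℓ u' :=
    map_sub ((γ₀ ℓ).comp (traceDomainToH1 ℓ p.form)) (s n) ⟨u, hu⟩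
  have h8 := hB (traceToDomain ℓ p.form (s n - (⟨u, hu⟩ : (neumannPlusTrace ℓ p.form).domain)))
  rw [e2] at h8
  rw [neumannPlusTrace_apply, real_inner_self_eq_norm_sq, e1]
  refine (norm_add_le _ _).trans (add_le_add ?_ h8)
  rw [Real.norm_of_nonneg (by positivity)]

end Couple

end TraceForm

end IntervalMarkov

/-! ### Interior regularity -/

namespace IntervalMarkov

section Regularity

variable {ℓ : ℝ}

theorem mem_H2_of_isWeakDeriv {u v w : L2 ℓ} (h1 : IsWeakDeriv ℓ u v) (h2 : IsWeakDeriv ℓ v w) :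
    ∃ h : u ∈ H2 ℓ, weakDeriv ℓ (H2toH1 ℓ ⟨u, h⟩) = v ∧ secondDeriv ℓ ⟨u, h⟩ = w := by
  have e1 : weakDeriv ℓ ⟨u, v, h1⟩ = v := weakDeriv_eq _ h1
  have h : u ∈ H2 ℓ := ⟨⟨u, v, h1⟩, by
    change weakDeriv ℓ ⟨u, v, h1⟩ ∈ H1 ℓ
    rw [e1]
    exact ⟨w, h2⟩, rfl⟩
  have e2 : (derivH2 ℓ ⟨u, h⟩ : L2 ℓ) = v := e1
  refine ⟨h, e1, weakDeriv_eq _ ?_⟩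
  rw [e2]
  exact h2

variable [hℓ : Fact (0 < ℓ)]

/-- A distributional solution `u ∈ L²(0, ℓ)` of `u'' = w` is in `H²(0, ℓ)`: if `Z' = w`, then
`η ↦ ∫ u η' + ∫ Z η` vanishes on derivatives of test functions, so `u' = Z - κ` for a
constant `κ`. -/
theorem mem_H2_of_test {u w : L2 ℓ} (h : ∀ φ, IsTest ℓ φ →
    ∫ x in Ioo 0 ℓ, u x * deriv (deriv φ) x = ∫ x in Ioo 0 ℓ, w x * φ x) :
    ∃ hu : u ∈ H2 ℓ, secondDeriv ℓ ⟨u, hu⟩ = w := by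
  obtain ⟨Z, hZ⟩ := exists_H1_weakDeriv_eq w
  obtain ⟨ψ₀, hψ₀, hψ₀1⟩ := exists_test_integral_eq_one hℓ.out
  set κ : ℝ := (∫ x in Ioo 0 ℓ, u x * deriv ψ₀ x) + ∫ x in Ioo 0 ℓ, (Z : L2 ℓ) x * ψ₀ x with hκ
  obtain ⟨k, hk, hdk, -⟩ := exists_H1_of_contDiff (ℓ := ℓ) (h := fun _ => -κ) contDiff_const
  have hdk0 : weakDeriv ℓ k = 0 := by
    refine Lp.ext (hdk.trans ?_)
    rw [deriv_const']
    exact (Lp.coeFn_zero _ _ _).symm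
  have h2 : IsWeakDeriv ℓ (Z + k : H1 ℓ) w := by
    have := isWeakDeriv_weakDeriv (Z + k)
    rwa [map_add, hZ, hdk0, add_zero] at this
  have h1 : IsWeakDeriv ℓ u (Z + k : H1 ℓ) := by
    intro η hη
    set m : ℝ := ∫ x, η x with hm
    have hηi : Integrable η := hη.contDiff.continuous.integrable_of_hasCompactSupport
      hη.hasCompactSupport
    have hψ₀i : Integrable ψ₀ := hψ₀.contDiff.continuous.integrable_of_hasCompactSupport
      hψ₀.hasCompactSupport
    obtain ⟨φ, hφ, hφd⟩ := (hη.add (hψ₀.const_smul (-m))).exists_primitive (by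
      simp only [Pi.add_apply, Pi.smul_apply, smul_eq_mul]
      rw [integral_add hηi (hψ₀i.const_mul _), integral_const_mul, hψ₀1, ← hm]
      ring)
    have e0 := h φ hφ
    have e0' := isWeakDeriv_weakDeriv Z φ hφ
    rw [hZ, ← e0, hφd] at e0'
    have hdη : deriv (η + (-m) • ψ₀) = fun x => deriv η x - m * deriv ψ₀ x := by
      funext x
      have d1 : HasDerivAt η (deriv η x) x := (hη.contDiff.differentiable (by simp) x).hasDerivAt
      have d2 : HasDerivAt ψ₀ (deriv ψ₀ x) x :=
        (hψ₀.contDiff.differentiable (by simp) x).hasDerivAt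
      rw [(d1.add (d2.const_smul (-m))).deriv, smul_eq_mul]
      ring
    have e1 : ∫ x in Ioo 0 ℓ, u x * deriv (η + (-m) • ψ₀) x =
        (∫ x in Ioo 0 ℓ, u x * deriv η x) - m * ∫ x in Ioo 0 ℓ, u x * deriv ψ₀ x := by
      rw [hdη, ← integral_const_mul, ← integral_sub (integrable_mul_test u hη.derivTest)
        ((integrable_mul_test u hψ₀.derivTest).const_mul m)]
      congr 1
      funext x
      ring
    have e2 : ∫ x in Ioo 0 ℓ, (Z : L2 ℓ) x * (η + (-m) • ψ₀) x =
        (∫ x in Ioo 0 ℓ, (Z : L2 ℓ) x * η x) - m * ∫ x in Ioo 0 ℓ, (Z : L2 ℓ) x * ψ₀ x := by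
      rw [← integral_const_mul, ← integral_sub (integrable_mul_test _ hη)
        ((integrable_mul_test _ hψ₀).const_mul m)]
      congr 1
      funext x
      simp only [Pi.add_apply, Pi.smul_apply, smul_eq_mul]
      ring
    have e3 : ∫ x in Ioo 0 ℓ, ((Z + k : H1 ℓ) : L2 ℓ) x * η x =
        (∫ x in Ioo 0 ℓ, (Z : L2 ℓ) x * η x) - κ * m := by
      rw [hm, ← hη.setIntegral_eq, ← integral_const_mul, ← integral_sub (integrable_mul_test _ hη)
        (hηi.restrict.const_mul κ)]
      refine integral_congr_ae ?_
      filter_upwards [hk, Lp.coeFn_add (Z : L2 ℓ) (k : L2 ℓ)] with x hx hx'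
      rw [Submodule.coe_add, hx', Pi.add_apply, hx]
      ring
    rw [e1, e2] at e0'
    rw [e3, hκ]
    linarith
  obtain ⟨hu, -, h3⟩ := mem_H2_of_isWeakDeriv h1 h2
  exact ⟨hu, h3⟩

end Regularity

end IntervalMarkov

/-! ### Boundary conditions and self-adjoint extensions -/

namespace IntervalMarkov

namespace Couple

variable (p : Couple)

theorem proj_apply_of_mem {ξ : E2} (h : ξ ∈ p.proj.range) : p.proj ξ = ξ := by
  obtain ⟨ζ, rfl⟩ := h
  exact DFunLike.congr_fun p.isStarProjection.isIdempotentElem ζ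

theorem proj_mem (ξ : E2) : p.proj ξ ∈ p.proj.range := ⟨ξ, rfl⟩

theorem inner_proj_left (ξ ζ : E2) : ⟪p.proj ξ, ζ⟫ = ⟪ξ, p.proj ζ⟫ := by
  have h : IsSelfAdjoint p.proj := p.isStarProjection.isSelfAdjoint
  exact (ContinuousLinearMap.isSelfAdjoint_iff_isSymmetric.1 h) ξ ζ

theorem inner_proj_right_of_mem {ξ ζ : E2} (h : ζ ∈ p.proj.range) : ⟪p.proj ξ, ζ⟫ = ⟪ξ, ζ⟫ := by
  rw [inner_proj_left, p.proj_apply_of_mem h]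

/-- The boundary condition `ξ ∈ R(Π)`, `Π η = B ξ`. -/
def BoundaryRel (ξ η : E2) : Prop := ∃ h : ξ ∈ p.proj.range, p.proj η = p.op ⟨ξ, h⟩

variable {p} in
theorem BoundaryRel.inner_comm {ξ η ξ' η' : E2} (h : p.BoundaryRel ξ η)
    (h' : p.BoundaryRel ξ' η') : ⟪η', ξ⟫ = ⟪ξ', η⟫ := by
  obtain ⟨hξ, e⟩ := h
  obtain ⟨hξ', e'⟩ := h'
  rw [← p.inner_proj_right_of_mem hξ, e', real_inner_comm η, ← p.inner_proj_right_of_mem hξ', e,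
    real_inner_comm ξ']
  exact p.isSymmetric ⟨ξ', hξ'⟩ ⟨ξ, hξ⟩

theorem eq_proj_of_inner_eq {z η : E2} (hz : z ∈ p.proj.range)
    (h : ∀ ζ ∈ p.proj.range, ⟪z, ζ⟫ = ⟪η, ζ⟫) : p.proj η = z := by
  have h1 : ⟪p.proj η - z, p.proj η - z⟫ = 0 := by
    have hm : p.proj η - z ∈ p.proj.range := sub_mem (p.proj_mem η) hz
    rw [inner_sub_left, h _ hm, p.inner_proj_right_of_mem hm, sub_self]
  exact sub_eq_zero.1 (inner_self_eq_zero.1 h1)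

/-- The boundary condition is a Lagrangian relation: it is its own orthogonal complement for the
symplectic form `⟨η', ξ⟩ - ⟨ξ', η⟩`. -/
theorem boundaryRel_iff (ξ η : E2) :
    p.BoundaryRel ξ η ↔ ∀ ξ' η', p.BoundaryRel ξ' η' → ⟪η', ξ⟫ = ⟪ξ', η⟫ := by
  refine ⟨fun h ξ' η' h' => h.inner_comm h', fun h => ?_⟩
  have hξ : ξ ∈ p.proj.range := by
    -- pair with `(0, ξ - Π ξ)`
    have h1 : p.BoundaryRel 0 (ξ - p.proj ξ) := by
      refine ⟨zero_mem _, ?_⟩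
      rw [map_sub, p.proj_apply_of_mem (p.proj_mem ξ), sub_self]
      have : (⟨0, zero_mem _⟩ : p.proj.range) = 0 := rfl
      rw [this, map_zero, Submodule.coe_zero]
    have h2 := h _ _ h1
    have h3 : ⟪ξ - p.proj ξ, ξ - p.proj ξ⟫ = 0 := by
      rw [inner_sub_right, h2, inner_zero_left, zero_sub, ← inner_proj_left, map_sub,
        p.proj_apply_of_mem (p.proj_mem ξ), sub_self, inner_zero_left, neg_zero]
    rw [sub_eq_zero.1 (inner_self_eq_zero.1 h3)]
    exact p.proj_mem ξ
  refine ⟨hξ, p.eq_proj_of_inner_eq (p.op ⟨ξ, hξ⟩).2 fun ζ hζ => ?_⟩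
  have h1 : p.BoundaryRel ζ (p.op ⟨ζ, hζ⟩) := ⟨hζ, p.proj_apply_of_mem (p.op ⟨ζ, hζ⟩).2⟩
  have h2 := h _ _ h1
  rw [real_inner_comm ζ η, ← h2]
  exact (p.isSymmetric ⟨ξ, hξ⟩ ⟨ζ, hζ⟩).trans (real_inner_comm _ _)

/-- Every Lagrangian subspace of `ℝ² × ℝ²` is the boundary condition of a couple `(Π, B)`. -/
theorem exists_of_lagrangian (L : Submodule ℝ (E2 × E2))
    (hL : ∀ ξ η, (ξ, η) ∈ L ↔ ∀ ξ' η', (ξ', η') ∈ L → ⟪η', ξ⟫ = ⟪ξ', η⟫) :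
    ∃ p : Couple, ∀ ξ η, (ξ, η) ∈ L ↔ p.BoundaryRel ξ η := by
  set M : Submodule ℝ E2 := L.map (LinearMap.fst ℝ E2 E2) with hM
  set P : E2 →L[ℝ] E2 := M.starProjection with hP
  have hPr : P.range = M := Submodule.range_starProjection M
  have hmem : ∀ ξ, ξ ∈ P.range ↔ ∃ η, (ξ, η) ∈ L := by
    intro ξ
    rw [hPr, hM]
    simp
  have hzero : ∀ η, (0, η) ∈ L ↔ P η = 0 := by
    intro η
    rw [hL, hP, Submodule.starProjection_apply_eq_zero_iff, Submodule.mem_orthogonal, ← hPr]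
    constructor
    · intro h ξ' hξ'
      obtain ⟨η', h'⟩ := (hmem _).1 hξ'
      rw [← h _ _ h', inner_zero_right]
    · intro h ξ' η' h'
      rw [h ξ' ((hmem _).2 ⟨η', h'⟩), inner_zero_right]
  have hPP : ∀ η, P (P η) = P η := fun η =>
    DFunLike.congr_fun (Submodule.isIdempotentElem_starProjection M) η
  have hproj : ∀ ξ η, (ξ, η) ∈ L → (ξ, P η) ∈ L := by
    intro ξ η h
    have h1 : (0, P η - η) ∈ L := (hzero _).2 (by rw [map_sub, hPP, sub_self])
    have := L.add_mem h h1
    rwa [Prod.mk_add_mk, add_zero, add_sub_cancel] at this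
  have huniq : ∀ ξ, ∀ η η' : P.range, (ξ, (η : E2)) ∈ L → (ξ, (η' : E2)) ∈ L → η = η' := by
    intro ξ η η' h h'
    have h1 := L.sub_mem h h'
    rw [Prod.mk_sub_mk, sub_self, hzero, map_sub] at h1
    obtain ⟨⟨_, a, rfl⟩, ⟨_, b, rfl⟩⟩ := η, η'
    have h2 : P a - P b = 0 := by
      have := h1
      change P (P a) - P (P b) = 0 at this
      rwa [hPP, hPP] at this
    exact Subtype.ext (sub_eq_zero.1 h2)
  have hex : ∀ ξ : P.range, ∃ η : P.range, ((ξ : E2), (η : E2)) ∈ L := by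
    intro ξ
    obtain ⟨η, h⟩ := (hmem _).1 ξ.2
    exact ⟨⟨P η, η, rfl⟩, hproj _ _ h⟩
  choose B hB using hex
  let B' : P.range →ₗ[ℝ] P.range :=
    { toFun := B
      map_add' := fun ξ ζ => huniq _ _ _ (hB _) (L.add_mem (hB ξ) (hB ζ))
      map_smul' := fun c ξ => huniq _ _ _ (hB _) (L.smul_mem c (hB ξ)) }
  have hsymm : B'.IsSymmetric := by
    intro ξ ζ
    exact (hL _ _).1 (hB ζ) _ _ (hB ξ)
  refine ⟨⟨P, isStarProjection_starProjection, B', hsymm⟩, fun ξ η => ⟨fun h => ?_, ?_⟩⟩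
  · have hξ : ξ ∈ P.range := (hmem _).2 ⟨η, h⟩
    refine ⟨hξ, ?_⟩
    have := huniq ξ ⟨P η, η, rfl⟩ (B ⟨ξ, hξ⟩) (hproj _ _ h) (hB ⟨ξ, hξ⟩)
    exact congrArg Subtype.val this
  · rintro ⟨hξ, h⟩
    change P η = (B ⟨ξ, hξ⟩ : E2) at h
    have h1 : (0, η - P η) ∈ L := (hzero _).2 (by rw [map_sub, hPP, sub_self])
    have h2 := L.add_mem (hB ⟨ξ, hξ⟩) h1
    rwa [← h, Prod.mk_add_mk, add_zero, add_sub_cancel] at h2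

end Couple

section Extensions

variable {ℓ : ℝ}

theorem mem_graph_minimalOp {φ : ℝ → ℝ} (hφ : IsTest ℓ φ) :
    (hφ.memLp.toLp, hφ.derivTest.derivTest.memLp.toLp) ∈ (minimalOp ℓ).graph := by
  rw [LinearPMap.mem_graph_iff]
  have h1 : IsWeakDeriv ℓ hφ.memLp.toLp hφ.derivTest.memLp.toLp :=
    hφ.isWeakDeriv (MemLp.coeFn_toLp _) (MemLp.coeFn_toLp _)
  have h2 : IsWeakDeriv ℓ hφ.derivTest.memLp.toLp hφ.derivTest.derivTest.memLp.toLp :=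
    hφ.derivTest.isWeakDeriv (MemLp.coeFn_toLp _) (MemLp.coeFn_toLp _)
  obtain ⟨h, -, h3⟩ := mem_H2_of_isWeakDeriv h1 h2
  exact ⟨⟨_, φ, hφ, MemLp.coeFn_toLp _⟩, rfl, h3⟩

variable [hℓ : Fact (0 < ℓ)]

theorem mem_graph_extension_iff (p : Couple) (u w : L2 ℓ) :
    (u, w) ∈ (p.extension ℓ).graph ↔ ∃ h : u ∈ H2 ℓ,
      p.BoundaryRel (γ₀ ℓ (H2toH1 ℓ ⟨u, h⟩)) (γ₁ ℓ ⟨u, h⟩) ∧ secondDeriv ℓ ⟨u, h⟩ = w := by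
  rw [LinearPMap.mem_graph_iff]
  constructor
  · rintro ⟨⟨_, u, hu, rfl⟩, rfl, rfl⟩
    exact ⟨u.2, hu, rfl⟩
  · rintro ⟨h, hb, rfl⟩
    exact ⟨⟨u, ⟨u, h⟩, hb, rfl⟩, rfl, rfl⟩

theorem traces_test {u : H2 ℓ} {φ : ℝ → ℝ} (hφ : IsTest ℓ φ)
    (hu : (u : L2 ℓ) =ᵐ[volume.restrict (Ioo 0 ℓ)] φ) :
    γ₀ ℓ (H2toH1 ℓ u) = 0 ∧ γ₁ ℓ u = 0 := by
  have h1 : weakDeriv ℓ (H2toH1 ℓ u) = hφ.derivTest.memLp.toLp :=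
    weakDeriv_eq _ (hφ.isWeakDeriv hu (MemLp.coeFn_toLp _))
  have h2 : (derivH2 ℓ u : L2 ℓ) =ᵐ[volume.restrict (Ioo 0 ℓ)] deriv φ := by
    change (weakDeriv ℓ (H2toH1 ℓ u) : ℝ → ℝ) =ᵐ[_] _
    rw [h1]
    exact MemLp.coeFn_toLp _
  have h3 := γ₀_test hφ.derivTest h2
  refine ⟨γ₀_test (u := H2toH1 ℓ u) hφ hu, ext_E2 ?_ ?_⟩
  · change γ₀ ℓ (derivH2 ℓ u) 0 = 0
    rw [h3]
    rfl
  · change -γ₀ ℓ (derivH2 ℓ u) 1 = 0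
    rw [h3]
    simp

theorem minimalOp_le_extension (p : Couple) : minimalOp ℓ ≤ p.extension ℓ := by
  refine LinearPMap.le_of_le_graph ?_
  rintro ⟨u, w⟩ h
  rw [LinearPMap.mem_graph_iff] at h
  obtain ⟨⟨_, φ, hφ, e⟩, rfl, rfl⟩ := h
  rw [mem_graph_extension_iff]
  refine ⟨testSpace_le_H2 ℓ ⟨φ, hφ, e⟩, ?_, rfl⟩
  obtain ⟨h0, h1⟩ := traces_test (u := ⟨_, testSpace_le_H2 ℓ ⟨φ, hφ, e⟩⟩) hφ e
  rw [h0, h1]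
  refine ⟨zero_mem _, ?_⟩
  have : (⟨0, zero_mem _⟩ : p.proj.range) = 0 := rfl
  rw [this, map_zero, map_zero, Submodule.coe_zero]

/-- The adjoint of the minimal operator is `d²/dx²` on `H²(0, ℓ)`. -/
theorem mem_H2_of_minimalOp_le {A : L2 ℓ →ₗ.[ℝ] L2 ℓ} (hA : minimalOp ℓ ≤ A) {u w : L2 ℓ}
    (h : ∀ a b, (a, b) ∈ A.graph → ⟪b, u⟫ = ⟪a, w⟫) :
    ∃ hu : u ∈ H2 ℓ, secondDeriv ℓ ⟨u, hu⟩ = w := by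
  refine mem_H2_of_test fun φ hφ => ?_
  have h1 := h _ _ (LinearPMap.le_graph_of_le hA (mem_graph_minimalOp hφ))
  rwa [real_inner_comm, inner_toLp_test u hφ.derivTest.derivTest, real_inner_comm,
    inner_toLp_test w hφ] at h1

theorem isSelfAdjoint_extension (p : Couple) : IsSelfAdjoint (p.extension ℓ) := by
  have hle := minimalOp_le_extension (ℓ := ℓ) p
  refine isSelfAdjoint_of_mem_graph_iff ((dense_testSpace (ℓ := ℓ)).mono hle.1) fun u w => ?_
  constructor
  · intro h a b hab
    obtain ⟨hu, hbu, rfl⟩ := (mem_graph_extension_iff p u w).1 h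
    obtain ⟨ha, hba, rfl⟩ := (mem_graph_extension_iff p a b).1 hab
    have h1 := inner_secondDeriv_sub ⟨a, ha⟩ ⟨u, hu⟩
    have h2 := hbu.inner_comm hba
    simp only at h1
    linarith
  · intro h
    obtain ⟨hu, rfl⟩ := mem_H2_of_minimalOp_le hle h
    refine (mem_graph_extension_iff p u _).2 ⟨hu, ?_, rfl⟩
    rw [p.boundaryRel_iff]
    intro ξ' η' h'
    obtain ⟨a, ha0, ha1⟩ := exists_H2_traces (ℓ := ℓ) ξ' η'
    have h1 := inner_secondDeriv_sub a ⟨u, hu⟩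
    have h2 := h a (secondDeriv ℓ a) ((mem_graph_extension_iff p _ _).2
      ⟨a.2, by rw [ha0, ha1]; exact h', rfl⟩)
    rw [ha0, ha1] at h1
    simp only at h1
    linarith

/-- Every self-adjoint extension of the minimal operator is given by a couple `(Π, B)`: the
boundary values of its domain form a Lagrangian subspace. -/
theorem exists_eq_extension {A : L2 ℓ →ₗ.[ℝ] L2 ℓ} (hA : A ∈ selfAdjointExt (minimalOp ℓ)) :
    ∃ p : Couple, A = p.extension ℓ := by
  obtain ⟨hle, hsa⟩ := hA
  have hH2 : ∀ u w, (u, w) ∈ A.graph → ∃ hu : u ∈ H2 ℓ, secondDeriv ℓ ⟨u, hu⟩ = w := fun u w h =>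
    mem_H2_of_minimalOp_le hle ((mem_graph_iff_of_isSelfAdjoint hsa u w).1 h)
  set tr : H2 ℓ →ₗ[ℝ] E2 × E2 := ((γ₀ ℓ).comp (H2toH1 ℓ)).prod (γ₁ ℓ) with htr
  set L : Submodule ℝ (E2 × E2) := (A.domain.comap (H2 ℓ).subtype).map tr with hLdef
  have hgr : ∀ u : H2 ℓ, (u : L2 ℓ) ∈ A.domain → ((u : L2 ℓ), secondDeriv ℓ u) ∈ A.graph := by
    intro u hu
    obtain ⟨hu2, e⟩ := hH2 _ _ (A.mem_graph ⟨u, hu⟩)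
    rw [e]
    exact A.mem_graph ⟨u, hu⟩
  have hdom : ∀ u : H2 ℓ,
      (∀ ξ' η', (ξ', η') ∈ L → ⟪η', γ₀ ℓ (H2toH1 ℓ u)⟫ = ⟪ξ', γ₁ ℓ u⟫) →
      ((u : L2 ℓ), secondDeriv ℓ u) ∈ A.graph := by
    intro u h
    rw [mem_graph_iff_of_isSelfAdjoint hsa]
    intro a b hab
    obtain ⟨ha, rfl⟩ := hH2 _ _ hab
    have h1 := inner_secondDeriv_sub ⟨a, ha⟩ u
    have h2 := h _ _ ⟨⟨a, ha⟩, LinearPMap.mem_domain_of_mem_graph hab, rfl⟩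
    simp only [LinearMap.comp_apply] at h1 h2
    linarith
  have hL : ∀ ξ η, (ξ, η) ∈ L ↔ ∀ ξ' η', (ξ', η') ∈ L → ⟪η', ξ⟫ = ⟪ξ', η⟫ := by
    intro ξ η
    constructor
    · rintro ⟨u, hu, e⟩ ξ' η' ⟨a, ha, e'⟩
      obtain ⟨rfl, rfl⟩ := Prod.mk.inj e
      obtain ⟨rfl, rfl⟩ := Prod.mk.inj e'
      have h1 := inner_secondDeriv_sub a u
      have h2 := (mem_graph_iff_of_isSelfAdjoint hsa _ _).1 (hgr u hu) _ _ (hgr a ha)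
      simp only [LinearMap.comp_apply]
      linarith
    · intro h
      obtain ⟨u, rfl, rfl⟩ := exists_H2_traces (ℓ := ℓ) ξ η
      exact ⟨u, LinearPMap.mem_domain_of_mem_graph (hdom u h), rfl⟩
  obtain ⟨p, hp⟩ := Couple.exists_of_lagrangian L hL
  refine ⟨p, LinearPMap.eq_of_eq_graph ?_⟩
  ext ⟨u, w⟩
  rw [mem_graph_extension_iff]
  constructor
  · intro h
    obtain ⟨hu, e⟩ := hH2 _ _ h
    exact ⟨hu, (hp _ _).1 ⟨⟨u, hu⟩, LinearPMap.mem_domain_of_mem_graph h, rfl⟩, e⟩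
  · rintro ⟨hu, hb, rfl⟩
    exact hdom ⟨u, hu⟩ ((hL _ _).1 ((hp _ _).2 hb))

theorem isFormOfNeg_extension (p : Couple) :
    (neumannPlusTrace ℓ p.form).IsFormOfNeg (p.extension ℓ) := by
  refine ⟨(dense_testSpace (ℓ := ℓ)).mono ?_, p.neumannPlusTrace_isSymm,
    p.neumannPlusTrace_isLowerBounded ℓ, p.neumannPlusTrace_isClosed ℓ, fun u w => ?_⟩
  · rintro u ⟨φ, hφ, e⟩
    refine mem_traceDomain_iff.2 ⟨H2_le_H1 ℓ (testSpace_le_H2 ℓ ⟨φ, hφ, e⟩), ?_⟩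
    rw [γ₀_test hφ e]
    exact zero_mem _
  rw [mem_graph_extension_iff]
  constructor
  · rintro ⟨hu, ⟨hb, e⟩, rfl⟩
    refine ⟨mem_traceDomain_iff.2 ⟨H2_le_H1 ℓ hu, hb⟩, fun v => ?_⟩
    have h1 := inner_secondDeriv ⟨u, hu⟩ (traceDomainToH1 ℓ p.form v)
    have hv := γ₀_mem_domain ℓ p.form v
    rw [← p.inner_proj_right_of_mem hv, e] at h1
    rw [neumannPlusTrace_apply, inner_neg_left, p.form_apply]
    have e1 : (traceDomainToH1 ℓ p.form v : L2 ℓ) = v := rfl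
    rw [e1] at h1
    rw [h1, neg_sub, sub_neg_eq_add, add_comm]
    rfl
  · rintro ⟨hu, h⟩
    obtain ⟨hu1, hb⟩ := mem_traceDomain_iff.1 hu
    have h1 : IsWeakDeriv ℓ (weakDeriv ℓ ⟨u, hu1⟩) w := by
      intro φ hφ
      have ht : hφ.memLp.toLp ∈ H1 ℓ :=
        H2_le_H1 ℓ (testSpace_le_H2 ℓ ⟨φ, hφ, hφ.memLp.coeFn_toLp⟩)
      have h0 : γ₀ ℓ ⟨_, ht⟩ = 0 := γ₀_test hφ hφ.memLp.coeFn_toLp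
      have hd : weakDeriv ℓ ⟨_, ht⟩ = hφ.derivTest.memLp.toLp :=
        weakDeriv_eq _ (hφ.isWeakDeriv hφ.memLp.coeFn_toLp hφ.derivTest.memLp.coeFn_toLp)
      have h2 : ⟪weakDeriv ℓ ⟨u, hu1⟩, weakDeriv ℓ ⟨_, ht⟩⟫ +
          ⟪(p.op ⟨_, hb⟩ : E2), γ₀ ℓ ⟨_, ht⟩⟫ = -⟪w, hφ.memLp.toLp⟫ :=
        (h ⟨_, mem_traceDomain_iff.2 ⟨ht, by rw [h0]; exact zero_mem _⟩⟩).trans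
          (inner_neg_left _ _)
      rwa [h0, hd, inner_zero_right, add_zero, inner_toLp_test _ hφ.derivTest,
        inner_toLp_test w hφ] at h2
    obtain ⟨hu2, -, e⟩ := mem_H2_of_isWeakDeriv (isWeakDeriv_weakDeriv ⟨u, hu1⟩) h1
    refine ⟨hu2, ⟨hb, ?_⟩, e⟩
    refine p.eq_proj_of_inner_eq (p.op ⟨_, hb⟩).2 fun ζ hζ => ?_
    obtain ⟨v, hv, -⟩ := exists_H2_traces (ℓ := ℓ) ζ 0
    have hvd : (v : L2 ℓ) ∈ traceDomain ℓ p.form :=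
      mem_traceDomain_iff.2 ⟨H2_le_H1 ℓ v.2, by
        change γ₀ ℓ (H2toH1 ℓ v) ∈ _
        rw [hv]
        exact hζ⟩
    have h2 : ⟪weakDeriv ℓ (H2toH1 ℓ ⟨u, hu2⟩), weakDeriv ℓ (H2toH1 ℓ v)⟫ +
        ⟪(p.op ⟨_, hb⟩ : E2), γ₀ ℓ (H2toH1 ℓ v)⟫ = -⟪w, (v : L2 ℓ)⟫ :=
      (h ⟨v, hvd⟩).trans (inner_neg_left _ _)
    have h3 := inner_secondDeriv ⟨u, hu2⟩ (H2toH1 ℓ v)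
    have h4 : (H2toH1 ℓ v : L2 ℓ) = v := rfl
    rw [e, h4, hv] at h3
    rw [hv] at h2
    change ⟪(p.op ⟨_, hb⟩ : E2), ζ⟫ = _
    linarith

end Extensions

end IntervalMarkov

/-! ### Markovian forms on `ℝ²` and admissible couples -/

namespace IntervalMarkov

theorem cut_sq_le (t : ℝ) : cut t ^ 2 ≤ t ^ 2 := by
  have h := lipschitzWith_cut.dist_le_mul t 0
  rw [cut_zero] at h
  simp only [NNReal.coe_one, one_mul, Real.dist_eq, sub_zero] at h
  exact sq_le_sq.2 h

theorem cut_sub_cut_sq_le (s t : ℝ) : (cut s - cut t) ^ 2 ≤ (s - t) ^ 2 := by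
  have h := lipschitzWith_cut.dist_le_mul s t
  simp only [NNReal.coe_one, one_mul, Real.dist_eq] at h
  exact sq_le_sq.2 h

theorem sharpE2_apply (ξ : E2) (i : Fin 2) : sharpE2 ξ i = cut (ξ i) := rfl

/-- A nonnegative function of order `2 a s + O(s²)` on `(0, 1]` has `a ≥ 0`. -/
theorem nonneg_of_forall_add_sq_nonneg {a K : ℝ}
    (h : ∀ s : ℝ, 0 < s → s ≤ 1 → 0 ≤ 2 * a * s + K * s ^ 2) : 0 ≤ a := by
  by_contra! ha
  have hK := abs_nonneg K
  have hpos : 0 < -a / (|K| + 1) := div_pos (by linarith) (by linarith)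
  set s := min 1 (-a / (|K| + 1)) with hs
  have hs0 : 0 < s := lt_min one_pos hpos
  have h1 := h s hs0 (min_le_left _ _)
  have h2 : s * (|K| + 1) ≤ -a := by
    have := min_le_right 1 (-a / (|K| + 1))
    rwa [← hs, le_div_iff₀ (by linarith)] at this
  have h3 : K * s ^ 2 ≤ |K| * s * s := by
    have := mul_le_mul_of_nonneg_right (le_abs_self K) (sq_nonneg s)
    nlinarith
  nlinarith

namespace Couple

/-- The line spanned by `e i`, as a condition on the coordinates. -/
def OnLine (i : Fin 3) (ξ : E2) : Prop := (![ξ 0 = ξ 1, ξ 1 = 0, ξ 0 = 0] : Fin 3 → Prop) i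

theorem rankOne_e_eq_self_iff (i : Fin 3) (ξ : E2) :
    InnerProductSpace.rankOne ℝ (e i) (e i) ξ = ξ ↔ OnLine i ξ := by
  have h2 : √2 * √2 = (2 : ℝ) := Real.mul_self_sqrt zero_le_two
  have h0 : √2 ≠ (0 : ℝ) := by positivity
  rw [InnerProductSpace.rankOne_apply, inner_E2]
  have key : ∀ x y : ℝ, (1 / √2 * x + 1 / √2 * y) * (1 / √2) = (x + y) / 2 := by
    intro x y
    field_simp
    rw [Real.sq_sqrt zero_le_two]
    ring
  constructor
  · intro h
    have e0 := congrArg (fun ζ : E2 => ζ 0) h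
    have e1 := congrArg (fun ζ : E2 => ζ 1) h
    fin_cases i
    · simp [e, OnLine] at e0 e1 ⊢
      linarith
    · simpa [e, OnLine] using e1.symm
    · simpa [e, OnLine] using e0.symm
  · intro h
    fin_cases i
    · have h' : ξ 0 = ξ 1 := h
      refine ext_E2 ?_ ?_
      · have := key (ξ 0) (ξ 1)
        simp [e] at this ⊢
        rw [this]; linarith
      · have := key (ξ 0) (ξ 1)
        simp [e] at this ⊢
        rw [this]; linarith
    · have h' : ξ 1 = 0 := h
      refine ext_E2 ?_ ?_ <;> simp [e, h']
    · have h' : ξ 0 = 0 := h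
      refine ext_E2 ?_ ?_ <;> simp [e, h']

theorem OnLine.sharpE2 {i : Fin 3} {ξ : E2} (h : OnLine i ξ) : OnLine i (sharpE2 ξ) := by
  fin_cases i
  · change cut (ξ 0) = cut (ξ 1)
    rw [show ξ 0 = ξ 1 from h]
  · change cut (ξ 1) = 0
    rw [show ξ 1 = 0 from h, cut_zero]
  · change cut (ξ 0) = 0
    rw [show ξ 0 = 0 from h, cut_zero]

variable (p : Couple)

theorem mem_range_iff (ξ : E2) : ξ ∈ p.proj.range ↔ p.proj ξ = ξ :=
  ⟨p.proj_apply_of_mem, fun h => h ▸ p.proj_mem ξ⟩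

variable {p} in
theorem form_eq_of_matrix {b₁₁ b₁₂ b₂₂ : ℝ} (hb : ∀ ξ : p.proj.range, (p.op ξ : E2) =
      !₂[b₁₁ * (ξ : E2) 0 + b₁₂ * (ξ : E2) 1, b₁₂ * (ξ : E2) 0 + b₂₂ * (ξ : E2) 1])
    (ξ : p.form.domain) : p.form.form ξ ξ =
      b₁₁ * (ξ : E2) 0 ^ 2 + 2 * b₁₂ * ((ξ : E2) 0 * (ξ : E2) 1) + b₂₂ * (ξ : E2) 1 ^ 2 := by
  refine (congrArg (fun z : E2 => ⟪z, (ξ : E2)⟫) (hb ξ)).trans ?_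
  simp only [inner_E2]
  simp
  ring

variable {p} in
theorem form_eq_of_smul {b : ℝ} (hb : ∀ ξ : p.proj.range, p.op ξ = b • ξ) (ξ : p.form.domain) :
    p.form.form ξ ξ = b * ‖(ξ : E2)‖ ^ 2 := by
  refine (congrArg (fun z : p.proj.range => ⟪(z : E2), (ξ : E2)⟫) (hb ξ)).trans ?_
  rw [← real_inner_self_eq_norm_sq, ← real_inner_smul_left]
  rfl

theorem form_isMarkovian_of_isAdmissible (h : p.IsAdmissible) : p.form.IsMarkovian sharpE2 := by
  suffices H : p.form.IsNonneg ∧ ∀ ξ : p.form.domain, ∃ h : sharpE2 ξ ∈ p.form.domain,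
      p.form.form ⟨sharpE2 ξ, h⟩ ⟨sharpE2 ξ, h⟩ ≤ p.form.form ξ ξ from ⟨p.form_isSymm, H⟩
  rcases h with h | ⟨h, b₁₁, b₁₂, b₂₂, hb, h1, h2, h3⟩ | ⟨i, h, b, hb0, hb⟩
  · have hz : ∀ ξ : p.form.domain, ξ = 0 := by
      intro ξ
      have := (p.mem_range_iff ξ).1 ξ.2
      rw [h] at this
      exact Subtype.ext this.symm
    refine ⟨fun ξ => ?_, fun ξ => ?_⟩
    · rw [hz ξ, map_zero]
    · have e : sharpE2 ((0 : p.form.domain) : E2) = 0 := ext_E2 cut_zero cut_zero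
      rw [hz ξ]
      refine ⟨by rw [e]; exact zero_mem _, ?_⟩
      rw [hz ⟨_, _⟩]
  · have hf : ∀ ξ : p.form.domain, p.form.form ξ ξ = (b₁₁ + b₁₂) * (ξ : E2) 0 ^ 2 +
        (b₁₂ + b₂₂) * (ξ : E2) 1 ^ 2 - b₁₂ * ((ξ : E2) 0 - (ξ : E2) 1) ^ 2 := by
      intro ξ
      rw [form_eq_of_matrix hb]
      ring
    refine ⟨fun ξ => ?_, fun ξ => ?_⟩
    · rw [hf]
      have := mul_nonneg (neg_nonneg.2 h3) (sq_nonneg ((ξ : E2) 0 - (ξ : E2) 1))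
      have := mul_nonneg h1 (sq_nonneg ((ξ : E2) 0))
      have := mul_nonneg h2 (sq_nonneg ((ξ : E2) 1))
      linarith
    · refine ⟨(p.mem_range_iff _).2 (by rw [h]; rfl), ?_⟩
      rw [hf, hf]
      simp only [sharpE2_apply]
      have := mul_le_mul_of_nonneg_left (cut_sub_cut_sq_le ((ξ : E2) 0) ((ξ : E2) 1))
        (neg_nonneg.2 h3)
      have := mul_le_mul_of_nonneg_left (cut_sq_le ((ξ : E2) 0)) h1
      have := mul_le_mul_of_nonneg_left (cut_sq_le ((ξ : E2) 1)) h2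
      linarith
  · have hf : ∀ ξ : p.form.domain, p.form.form ξ ξ = b * ((ξ : E2) 0 ^ 2 + (ξ : E2) 1 ^ 2) := by
      intro ξ
      rw [form_eq_of_smul hb, norm_sq_E2]
    have hmem : ∀ ξ, ξ ∈ p.form.domain ↔ OnLine i ξ := by
      intro ξ
      rw [← rankOne_e_eq_self_iff, ← h]
      exact p.mem_range_iff ξ
    refine ⟨fun ξ => ?_, fun ξ => ⟨(hmem _).2 ((hmem _).1 ξ.2).sharpE2, ?_⟩⟩
    · rw [hf]
      positivity
    · rw [hf, hf]
      simp only [sharpE2_apply]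
      have := cut_sq_le ((ξ : E2) 0)
      have := cut_sq_le ((ξ : E2) 1)
      gcongr

theorem form_isDirichlet_of_isAdmissible (h : p.IsAdmissible) : p.form.IsDirichlet sharpE2 :=
  ⟨p.form_isMarkovian_of_isAdmissible h, p.form_isClosed⟩

/-- The Markov property up to a multiple of `‖ξ - ξ_#‖²`. The error is of second order in the
distance of `ξ` to the unit square, so that it does not affect admissibility, which is a first order
condition. -/
def IsAlmostMarkovian : Prop := ∃ C : ℝ, ∀ ξ : p.form.domain, ∃ hs : sharpE2 ξ ∈ p.form.domain,
  p.form.form ⟨sharpE2 ξ, hs⟩ ⟨sharpE2 ξ, hs⟩ ≤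
    p.form.form ξ ξ + C * ‖(ξ : E2) - sharpE2 ξ‖ ^ 2

theorem isAdmissible_of_range_eq_top (h : p.IsAlmostMarkovian) (ht : p.proj.range = ⊤) :
    p.IsAdmissible := by
  obtain ⟨C, hC⟩ := h
  have hmem : ∀ ξ : E2, ξ ∈ p.proj.range := fun ξ => ht ▸ Submodule.mem_top
  set x₁ : p.proj.range := ⟨!₂[1, 0], hmem _⟩ with hx₁
  set x₂ : p.proj.range := ⟨!₂[0, 1], hmem _⟩ with hx₂
  have hx : ∀ ξ : p.proj.range, ξ = (ξ : E2) 0 • x₁ + (ξ : E2) 1 • x₂ := by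
    intro ξ
    refine Subtype.ext (ext_E2 ?_ ?_) <;> simp [hx₁, hx₂]
  set b₁₁ := (p.op x₁ : E2) 0 with hb₁₁
  set b₁₂ := (p.op x₁ : E2) 1 with hb₁₂
  set b₂₂ := (p.op x₂ : E2) 1 with hb₂₂
  have hb₂₁ : (p.op x₂ : E2) 0 = b₁₂ := by
    have h1 : ⟪(p.op x₂ : E2), (x₁ : E2)⟫ = ⟪(x₂ : E2), (p.op x₁ : E2)⟫ := p.isSymmetric x₂ x₁
    rw [inner_E2, inner_E2] at h1
    simpa [hx₁, hx₂] using h1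
  have hop : ∀ ξ : p.proj.range, (p.op ξ : E2) =
      !₂[b₁₁ * (ξ : E2) 0 + b₁₂ * (ξ : E2) 1, b₁₂ * (ξ : E2) 0 + b₂₂ * (ξ : E2) 1] := by
    intro ξ
    have h1 : p.op ξ = (ξ : E2) 0 • p.op x₁ + (ξ : E2) 1 • p.op x₂ := by
      conv_lhs => rw [hx ξ]
      rw [map_add, map_smul, map_smul]
    rw [h1]
    refine ext_E2 ?_ ?_
    · simp [hb₂₁, ← hb₁₁]
      ring
    · simp [← hb₁₂, ← hb₂₂]
      ring
  have key : ∀ x y : ℝ, b₁₁ * cut x ^ 2 + 2 * b₁₂ * (cut x * cut y) + b₂₂ * cut y ^ 2 ≤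
      b₁₁ * x ^ 2 + 2 * b₁₂ * (x * y) + b₂₂ * y ^ 2 +
        C * ((x - cut x) ^ 2 + (y - cut y) ^ 2) := by
    intro x y
    obtain ⟨hs, hle⟩ := hC ⟨!₂[x, y], hmem _⟩
    rw [form_eq_of_matrix hop, form_eq_of_matrix hop, norm_sq_E2] at hle
    simp [sharpE2_apply] at hle
    linarith
  refine Or.inr (Or.inl ⟨?_, b₁₁, b₁₂, b₂₂, hop, ?_, ?_, ?_⟩)
  · ext1 ξ
    exact p.proj_apply_of_mem (hmem ξ)
  -- test with `(1 + s, 1)`, `(1, 1 + s)` and `(1, -s)`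
  · refine nonneg_of_forall_add_sq_nonneg (K := b₁₁ + C) fun s hs _ => ?_
    have := key (1 + s) 1
    rw [cut_of_one_le (by linarith), cut_of_one_le le_rfl] at this
    nlinarith
  · refine nonneg_of_forall_add_sq_nonneg (K := b₂₂ + C) fun s hs _ => ?_
    have := key 1 (1 + s)
    rw [cut_of_one_le (t := 1 + s) (by linarith), cut_of_one_le le_rfl] at this
    nlinarith
  · refine neg_nonneg.1 (nonneg_of_forall_add_sq_nonneg (K := b₂₂ + C) fun s hs _ => ?_)
    have := key 1 (-s)
    rw [cut_of_one_le le_rfl, cut_of_nonpos (by linarith)] at this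
    nlinarith

/-- A line that is invariant under `ξ ↦ ξ_#` contains one of the vectors `(1, 1)`, `(1, 0)`,
`(0, 1)`. -/
theorem exists_onLine_of_sharp {M : Submodule ℝ E2} (hM : ∀ ξ ∈ M, sharpE2 ξ ∈ M)
    (hne : M ≠ ⊤) {ζ : E2} (hζ : ζ ∈ M) (hζ0 : ζ ≠ 0) : ∃ i, ∀ ξ, ξ ∈ M ↔ OnLine i ξ := by
  -- two vectors with nonvanishing determinant span the plane
  have hdet : ∀ ξ ∈ M, ∀ η ∈ M, ξ 0 * η 1 = ξ 1 * η 0 := by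
    intro ξ hξ η hη
    by_contra hd
    refine hne (Submodule.eq_top_iff'.2 fun θ => ?_)
    have hd' : ξ 0 * η 1 - ξ 1 * η 0 ≠ 0 := sub_ne_zero.2 hd
    have : θ = ((θ 0 * η 1 - θ 1 * η 0) / (ξ 0 * η 1 - ξ 1 * η 0)) • ξ +
        ((ξ 0 * θ 1 - ξ 1 * θ 0) / (ξ 0 * η 1 - ξ 1 * η 0)) • η := by
      refine ext_E2 ?_ ?_
      · simp only [PiLp.add_apply, PiLp.smul_apply, smul_eq_mul]
        rw [div_mul_eq_mul_div, div_mul_eq_mul_div, ← add_div, eq_div_iff hd']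
        ring
      · simp only [PiLp.add_apply, PiLp.smul_apply, smul_eq_mul]
        rw [div_mul_eq_mul_div, div_mul_eq_mul_div, ← add_div, eq_div_iff hd']
        ring
    rw [this]
    exact M.add_mem (M.smul_mem _ hξ) (M.smul_mem _ hη)
  have hscale : ∀ ξ η : E2, ξ 0 * η 1 = ξ 1 * η 0 → (ξ ≠ 0) → ξ ∈ M → η ∈ M := by
    intro ξ η h h0 hξ
    by_cases h1 : ξ 0 = 0
    · have h2 : ξ 1 ≠ 0 := fun h2 => h0 (ext_E2 h1 h2)
      have : η = (η 1 / ξ 1) • ξ := by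
        refine ext_E2 ?_ ?_
        · rw [h1, zero_mul] at h
          have := (mul_eq_zero.1 h.symm).resolve_left h2
          simp [h1, this]
        · simp [h2]
      rw [this]
      exact M.smul_mem _ hξ
    · have : η = (η 0 / ξ 0) • ξ := by
        refine ext_E2 ?_ ?_
        · simp [h1]
        · simp
          field_simp
          linarith
      rw [this]
      exact M.smul_mem _ hξ
  have hiff : ∀ η, η ∈ M ↔ ζ 0 * η 1 = ζ 1 * η 0 := fun η =>
    ⟨fun h => hdet ζ hζ η h, fun h => hscale ζ η h hζ0 hζ⟩
  by_cases h0 : ζ 0 = 0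
  · have h1 : ζ 1 ≠ 0 := fun h1 => hζ0 (ext_E2 h0 h1)
    refine ⟨2, fun ξ => ?_⟩
    rw [hiff, h0, zero_mul, eq_comm, mul_eq_zero, or_iff_right h1]
    rfl
  by_cases h1 : ζ 1 = 0
  · refine ⟨1, fun ξ => ?_⟩
    rw [hiff, h1, zero_mul, mul_eq_zero, or_iff_right h0]
    rfl
  refine ⟨0, fun ξ => ?_⟩
  -- the multiples `t ζ` with `t = 1 / ζ 0` or `t = 1 / ζ 1` are cut to a vector of the same line
  -- having one coordinate equal to `1`
  have hsc : ∀ t : ℝ, cut (t * ζ 0) * ζ 1 = cut (t * ζ 1) * ζ 0 := by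
    intro t
    have := (hiff _).1 (hM _ (M.smul_mem t hζ))
    simp only [sharpE2_apply, PiLp.smul_apply, smul_eq_mul] at this
    linarith
  have heq : ζ 0 = ζ 1 := by
    have h3 := hsc (1 / ζ 0)
    rw [one_div_mul_cancel h0, cut_of_one_le le_rfl, one_mul] at h3
    have h4 := hsc (1 / ζ 1)
    rw [one_div_mul_cancel h1, cut_of_one_le le_rfl, one_mul] at h4
    rcases le_total (1 / ζ 0 * ζ 1) 1 with h5 | h5
    · rcases le_total (1 / ζ 0 * ζ 1) 0 with h6 | h6
      · rw [cut_of_nonpos h6, zero_mul] at h3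
        exact absurd h3 h1
      · have h7 : 1 ≤ 1 / ζ 1 * ζ 0 := by
          have h8 : (1 / ζ 0 * ζ 1) * (1 / ζ 1 * ζ 0) = 1 := by field_simp
          by_contra! h9
          have : 0 < 1 / ζ 0 * ζ 1 := lt_of_le_of_ne h6 (by
            intro h10
            rw [← h10, zero_mul] at h8
            exact zero_ne_one h8)
          nlinarith
        rw [cut_of_one_le h7, one_mul] at h4
        exact h4.symm
    · rw [cut_of_one_le h5, one_mul] at h3
      exact h3.symm
  rw [hiff, heq, mul_right_inj' h1, eq_comm]
  rfl

theorem onLine_e (i : Fin 3) : OnLine i (e i) := by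
  fin_cases i <;> simp [OnLine, e]

theorem inner_e_self (i : Fin 3) : ⟪e i, e i⟫ = 1 := by
  have h2 : √2 * √2 = (2 : ℝ) := Real.mul_self_sqrt zero_le_two
  rw [inner_E2]
  fin_cases i
  · simp [e]
    rw [← mul_inv, h2]
    norm_num
  · simp [e]
  · simp [e]

theorem exists_onLine_sharp_add (i : Fin 3) : ∃ ν : E2, OnLine i ν ∧ ν ≠ 0 ∧
    ∀ s : ℝ, 0 < s → sharpE2 ((1 + s) • ν) = ν := by
  have hc : ∀ s : ℝ, 0 < s → cut (1 + s) = 1 := fun s hs => cut_of_one_le (by linarith)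
  fin_cases i
  · refine ⟨!₂[1, 1], by simp [OnLine], fun h => ?_, fun s hs => ext_E2 ?_ ?_⟩
    · simpa using congrArg (fun ζ : E2 => ζ 0) h
    · simp [sharpE2_apply, hc s hs]
    · simp [sharpE2_apply, hc s hs]
  · refine ⟨!₂[1, 0], by simp [OnLine], fun h => ?_, fun s hs => ext_E2 ?_ ?_⟩
    · simpa using congrArg (fun ζ : E2 => ζ 0) h
    · simp [sharpE2_apply, hc s hs]
    · simp [sharpE2_apply, cut_zero]
  · refine ⟨!₂[0, 1], by simp [OnLine], fun h => ?_, fun s hs => ext_E2 ?_ ?_⟩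
    · simpa using congrArg (fun ζ : E2 => ζ 1) h
    · simp [sharpE2_apply, cut_zero]
    · simp [sharpE2_apply, hc s hs]

theorem isAdmissible_of_onLine (h : p.IsAlmostMarkovian) {i : Fin 3}
    (hi : ∀ ξ, ξ ∈ p.proj.range ↔ OnLine i ξ) : p.IsAdmissible := by
  obtain ⟨C, hC⟩ := h
  have hline : ∀ ξ, ξ ∈ p.proj.range → ξ = ⟪e i, ξ⟫ • e i := by
    intro ξ hξ
    have := (rankOne_e_eq_self_iff i ξ).2 ((hi ξ).1 hξ)
    rw [InnerProductSpace.rankOne_apply] at this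
    exact this.symm
  have he : e i ∈ p.proj.range := (hi _).2 (onLine_e i)
  have hproj : p.proj = InnerProductSpace.rankOne ℝ (e i) (e i) := by
    ext1 ξ
    rw [InnerProductSpace.rankOne_apply]
    refine p.eq_proj_of_inner_eq (Submodule.smul_mem _ _ he) fun ζ hζ => ?_
    rw [hline ζ hζ, real_inner_smul_left, real_inner_smul_right, real_inner_smul_right, inner_e_self,
      real_inner_comm ξ (e i)]
    ring
  set b := ⟪e i, (p.op ⟨e i, he⟩ : E2)⟫ with hb
  have hop : ∀ ξ : p.proj.range, p.op ξ = b • ξ := by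
    intro ξ
    have h1 : ξ = ⟪e i, (ξ : E2)⟫ • (⟨e i, he⟩ : p.proj.range) := Subtype.ext (hline ξ ξ.2)
    have h2 : p.op ⟨e i, he⟩ = b • (⟨e i, he⟩ : p.proj.range) :=
      Subtype.ext (hline _ (p.op ⟨e i, he⟩).2)
    rw [h1, map_smul, h2, smul_comm]
  have hf : ∀ ξ : p.form.domain, p.form.form ξ ξ = b * ‖(ξ : E2)‖ ^ 2 :=
    form_eq_of_smul hop
  refine Or.inr (Or.inr ⟨i, hproj, b, ?_, hop⟩)
  obtain ⟨ν, hν, hν0, hνs⟩ := exists_onLine_sharp_add i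
  refine nonneg_of_forall_add_sq_nonneg (K := b + C) fun s hs _ => ?_
  obtain ⟨hsm, hle⟩ := hC ⟨(1 + s) • ν, Submodule.smul_mem _ _ ((hi ν).2 hν)⟩
  rw [hf, hf] at hle
  simp only [hνs s hs] at hle
  have h1 : (1 + s) • ν - ν = s • ν := by rw [add_smul, one_smul, add_sub_cancel_left]
  rw [h1, norm_smul, norm_smul, Real.norm_of_nonneg hs.le, Real.norm_of_nonneg (by linarith)] at hle
  have h2 : 0 < ‖ν‖ ^ 2 := by positivity
  by_contra! h3
  nlinarith [mul_neg_of_neg_of_pos h3 h2]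

theorem IsAlmostMarkovian.isAdmissible {p : Couple} (h : p.IsAlmostMarkovian) :
    p.IsAdmissible := by
  by_cases ht : p.proj.range = ⊤
  · exact p.isAdmissible_of_range_eq_top h ht
  by_cases h0 : ∀ ζ ∈ p.proj.range, ζ = 0
  · refine Or.inl ?_
    ext1 ξ
    exact h0 _ (p.proj_mem ξ)
  push Not at h0
  obtain ⟨ζ, hζ, hζ0⟩ := h0
  obtain ⟨i, hi⟩ := exists_onLine_of_sharp (M := p.proj.range) (fun ξ hξ => by
    obtain ⟨C, hC⟩ := h
    exact (hC ⟨ξ, hξ⟩).1) ht hζ hζ0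
  exact p.isAdmissible_of_onLine h hi

theorem form_isDirichlet_iff : p.form.IsDirichlet sharpE2 ↔ p.IsAdmissible := by
  refine ⟨fun h => IsAlmostMarkovian.isAdmissible ⟨0, fun ξ => ?_⟩,
    p.form_isDirichlet_of_isAdmissible⟩
  obtain ⟨hs, hle⟩ := h.1.2.2 ξ
  exact ⟨hs, by rwa [zero_mul, add_zero]⟩

end Couple

end IntervalMarkov

/-! ### Dirichlet forms on the interval -/

namespace IntervalMarkov

section Dirichlet

variable {ℓ : ℝ}

theorem norm_sq_eq_integral (w : L2 ℓ) : ‖w‖ ^ 2 = ∫ x in Ioo 0 ℓ, w x ^ 2 := by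
  rw [← real_inner_self_eq_norm_sq, inner_eq_integral]
  simp only [sq]

variable [hℓ : Fact (0 < ℓ)]

theorem neumannPlusTrace_self_eq {f : FormOn E2} (x : (neumannPlusTrace ℓ f).domain) {u : H1 ℓ}
    {ξ : f.domain} (hu : (u : L2 ℓ) = x) (hξ : γ₀ ℓ u = ξ) :
    (neumannPlusTrace ℓ f).form x x = ‖weakDeriv ℓ u‖ ^ 2 + f.form ξ ξ := by
  have e1 : traceDomainToH1 ℓ f x = u := Subtype.ext hu.symm
  have e2 : traceToDomain ℓ f x = ξ := Subtype.ext ((congrArg (γ₀ ℓ) e1).trans hξ)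
  rw [neumannPlusTrace_apply, e1, e2, real_inner_self_eq_norm_sq]

theorem neumannPlusTrace_isDirichlet_of_form (p : Couple) (h : p.form.IsDirichlet sharpE2) :
    (neumannPlusTrace ℓ p.form).IsDirichlet sharpL2 := by
  obtain ⟨⟨-, hn, hM⟩, -⟩ := h
  refine ⟨⟨p.neumannPlusTrace_isSymm, fun u => ?_, fun u => ?_⟩, p.neumannPlusTrace_isClosed ℓ⟩
  · rw [neumannPlusTrace_apply, real_inner_self_eq_norm_sq]
    exact add_nonneg (by positivity) (hn _)
  · obtain ⟨v, hv, hγ, hle⟩ := exists_sharp_H1 (traceDomainToH1 ℓ p.form u)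
    obtain ⟨hs, hfle⟩ := hM (traceToDomain ℓ p.form u)
    have hv' : (v : L2 ℓ) = sharpL2 (u : L2 ℓ) := hv
    have hmem : sharpL2 (u : L2 ℓ) ∈ traceDomain ℓ p.form := by
      rw [← hv']
      exact mem_traceDomain_iff.2 ⟨v.2, hγ ▸ hs⟩
    refine ⟨hmem, ?_⟩
    have e1 := neumannPlusTrace_self_eq (f := p.form) ⟨_, hmem⟩ hv' (ξ := ⟨_, hs⟩) hγ
    have e2 := neumannPlusTrace_self_eq (f := p.form) u (u := traceDomainToH1 ℓ p.form u)
      (ξ := traceToDomain ℓ p.form u) rfl rfl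
    refine e1.trans_le (le_of_le_of_eq ?_ e2.symm)
    gcongr

/-- A function with trace `ξ` that is cheap to cut: it is affine on the three thirds of the
interval, with values `ξ 0`, `(ξ_#) 0`, `(ξ_#) 1`, `ξ 1` at the nodes, so that cutting it only affects
the outer thirds. -/
theorem exists_H1_sharp_cheap (ξ : E2) : ∃ u v : H1 ℓ, (v : L2 ℓ) = sharpL2 (u : L2 ℓ) ∧
    γ₀ ℓ u = ξ ∧ γ₀ ℓ v = sharpE2 ξ ∧
    ‖weakDeriv ℓ u‖ ^ 2 ≤ ‖weakDeriv ℓ v‖ ^ 2 + 9 / ℓ * ‖ξ - sharpE2 ξ‖ ^ 2 := by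
  have hℓ0 : 0 < ℓ := hℓ.out
  set a : ℝ := cut (ξ 0) with ha
  set b : ℝ := cut (ξ 1) with hb
  set c : ℝ := 3 / ℓ with hc
  have hc0 : 0 < c := by positivity
  have hcℓ : c * ℓ = 3 := by rw [hc]; field_simp
  set h : ℝ → ℝ := fun x =>
    (a + (ξ 0 - a) * cut (1 - c * x)) + ((b - a) * cut (c * x - 1) + (ξ 1 - b) * cut (c * x - 2))
    with hh
  have hac : AbsolutelyContinuousOnInterval h 0 ℓ := by
    have h1 : ∀ f : ℝ → ℝ, ContDiff ℝ 1 f → AbsolutelyContinuousOnInterval f 0 ℓ :=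
      fun f hf => hf.contDiffOn.absolutelyContinuousOnInterval
    exact ((h1 (fun _ => a) contDiff_const).add
      ((h1 (fun x => 1 - c * x) (by fun_prop)).cut_comp.const_mul _)).add
      (((h1 (fun x => c * x - 1) (by fun_prop)).cut_comp.const_mul _).add
      ((h1 (fun x => c * x - 2) (by fun_prop)).cut_comp.const_mul _))
  -- the function on the three thirds
  have hleft : ∀ x, 0 ≤ c * x → c * x ≤ 1 → h x = a + (ξ 0 - a) * (1 - c * x) := by
    intro x h0 h1
    simp only [hh]
    rw [cut_of_mem (t := 1 - c * x) (by linarith) (by linarith), cut_of_nonpos (t := c * x - 1)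
      (by linarith), cut_of_nonpos (t := c * x - 2) (by linarith)]
    ring
  have hmid : ∀ x, 1 ≤ c * x → c * x ≤ 2 → h x = a + (b - a) * (c * x - 1) := by
    intro x h0 h1
    simp only [hh]
    rw [cut_of_nonpos (t := 1 - c * x) (by linarith), cut_of_mem (t := c * x - 1)
      (by linarith) (by linarith), cut_of_nonpos (t := c * x - 2) (by linarith)]
    ring
  have hright : ∀ x, 2 ≤ c * x → c * x ≤ 3 → h x = b + (ξ 1 - b) * (c * x - 2) := by
    intro x h0 h1
    simp only [hh]
    rw [cut_of_nonpos (t := 1 - c * x) (by linarith), cut_of_one_le (t := c * x - 1)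
      (by linarith), cut_of_mem (t := c * x - 2) (by linarith) (by linarith)]
    ring
  have hloc : ∀ (f : ℝ → ℝ) (r s y : ℝ), r < c * y → c * y < s →
      (∀ x, r < c * x → c * x < s → h x = f x) → h =ᶠ[𝓝 y] f := by
    intro f r s y hr hs hf
    have hcont : Continuous fun x : ℝ => c * x := by fun_prop
    filter_upwards [hcont.continuousAt.eventually (lt_mem_nhds hr),
      hcont.continuousAt.eventually (gt_mem_nhds hs)] with x h1 h2
    exact hf x h1 h2
  have hdaff : ∀ p q r y : ℝ, HasDerivAt (fun x => p + q * (c * x - r)) (q * c) y := by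
    intro p q r y
    have := ((((hasDerivAt_id y).const_mul c).sub_const r).const_mul q).const_add p
    simpa using this
  have hdleft : ∀ x, 0 < c * x → c * x < 1 → deriv h x = -(ξ 0 - a) * c := by
    intro x h0 h1
    have e := hloc (fun x => a + -(ξ 0 - a) * (c * x - 1)) 0 1 x h0 h1 fun y h2 h3 => by
      rw [hleft y h2.le h3.le]; ring
    rw [e.deriv_eq, (hdaff _ _ _ _).deriv]
  have hdright : ∀ x, 2 < c * x → c * x < 3 → deriv h x = (ξ 1 - b) * c := by
    intro x h0 h1
    have e := hloc (fun x => b + (ξ 1 - b) * (c * x - 2)) 2 3 x h0 h1 fun y h2 h3 =>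
      hright y h2.le h3.le
    rw [e.deriv_eq, (hdaff _ _ _ _).deriv]
  have hmidloc : ∀ x, 1 < c * x → c * x < 2 → h =ᶠ[𝓝 x] fun x => a + (b - a) * (c * x - 1) :=
    fun x h0 h1 => hloc _ 1 2 x h0 h1 fun y h2 h3 => hmid y h2.le h3.le
  have hdmid : ∀ x, 1 < c * x → c * x < 2 → deriv h x = (b - a) * c := fun x h0 h1 => by
    rw [(hmidloc x h0 h1).deriv_eq, (hdaff _ _ _ _).deriv]
  have hcutmid : ∀ x, 1 < c * x → c * x < 2 → deriv (fun x => cut (h x)) x = deriv h x := by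
    intro x h0 h1
    refine Filter.EventuallyEq.deriv_eq (hloc (fun x => cut (h x)) 1 2 x h0 h1 fun y h2 h3 => ?_).symm
    rw [hmid y h2.le h3.le, cut_of_mem]
    · nlinarith [cut_nonneg (ξ 0), cut_nonneg (ξ 1)]
    · nlinarith [cut_le_one (ξ 0), cut_le_one (ξ 1)]
  have hae : ∀ᵐ x ∂(volume.restrict (Ioo 0 ℓ)), (0 < c * x ∧ c * x < 1) ∨
      (1 < c * x ∧ c * x < 2) ∨ (2 < c * x ∧ c * x < 3) := by
    have h1 : ∀ᵐ x : ℝ, x ≠ 1 / c := Measure.ae_ne volume _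
    have h2 : ∀ᵐ x : ℝ, x ≠ 2 / c := Measure.ae_ne volume _
    filter_upwards [ae_restrict_mem measurableSet_Ioo, ae_restrict_of_ae h1, ae_restrict_of_ae h2]
      with x hx hx1 hx2
    have k0 : 0 < c * x := mul_pos hc0 hx.1
    have k3 : c * x < 3 := by
      rw [← hcℓ]
      exact mul_lt_mul_of_pos_left hx.2 hc0
    have k1 : c * x ≠ 1 := fun e => hx1 (by field_simp; linarith)
    have k2 : c * x ≠ 2 := fun e => hx2 (by field_simp; linarith)
    rcases lt_or_gt_of_ne k1 with k | k
    · exact Or.inl ⟨k0, k⟩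
    rcases lt_or_gt_of_ne k2 with k' | k'
    · exact Or.inr (Or.inl ⟨k, k'⟩)
    · exact Or.inr (Or.inr ⟨k', k3⟩)
  have hmem : MemLp (deriv h) 2 (volume.restrict (Ioo 0 ℓ)) := by
    refine MemLp.of_bound (measurable_deriv _).aestronglyMeasurable
      (|-(ξ 0 - a) * c| + |(b - a) * c| + |(ξ 1 - b) * c|) ?_
    have k1 := abs_nonneg (-(ξ 0 - a) * c)
    have k2 := abs_nonneg ((b - a) * c)
    have k3 := abs_nonneg ((ξ 1 - b) * c)
    filter_upwards [hae] with x hx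
    rw [Real.norm_eq_abs]
    rcases hx with hx | hx | hx
    · rw [hdleft x hx.1 hx.2]; linarith
    · rw [hdmid x hx.1 hx.2]; linarith
    · rw [hdright x hx.1 hx.2]; linarith
  obtain ⟨u, hu, hdu, eu⟩ := exists_H1_of_absolutelyContinuous hac hmem
  obtain ⟨v, hv, hγv, hdv, -⟩ := exists_sharp_H1_of_rep u hac hu hdu
  have hγu : γ₀ ℓ u = ξ := by
    refine ext_E2 ?_ ?_
    · rw [γ₀_apply_zero, eu (left_mem_Icc.2 hℓ0.le), hleft 0 (by simp) (by simp)]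
      ring
    · rw [γ₀_apply_one, eu (right_mem_Icc.2 hℓ0.le), hright ℓ (by linarith) (by linarith), hcℓ]
      ring
  refine ⟨u, v, hv, hγu, by rw [hγv, hγu], ?_⟩
  have hN : ‖ξ - sharpE2 ξ‖ ^ 2 = (ξ 0 - a) ^ 2 + (ξ 1 - b) ^ 2 := norm_sq_E2 _
  set N := ‖ξ - sharpE2 ξ‖ ^ 2 with hNdef
  have hpt : ∀ᵐ x ∂(volume.restrict (Ioo 0 ℓ)),
      weakDeriv ℓ u x ^ 2 ≤ weakDeriv ℓ v x ^ 2 + c ^ 2 * N := by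
    have hcN0 : 0 ≤ c ^ 2 * (ξ 0 - a) ^ 2 := by positivity
    have hcN1 : 0 ≤ c ^ 2 * (ξ 1 - b) ^ 2 := by positivity
    filter_upwards [hae, hdu, hdv] with x hx h1 h2
    rw [h1, h2, hN]
    have h3 := sq_nonneg (deriv (fun x => cut (h x)) x)
    rcases hx with hx | hx | hx
    · rw [hdleft x hx.1 hx.2]; nlinarith
    · rw [hcutmid x hx.1 hx.2]; nlinarith
    · rw [hdright x hx.1 hx.2]; nlinarith
  have hiu := (Lp.memLp (weakDeriv ℓ u)).integrable_sq
  have hiv := (Lp.memLp (weakDeriv ℓ v)).integrable_sq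
  have hic : Integrable (fun _ : ℝ => c ^ 2 * N) (volume.restrict (Ioo 0 ℓ)) :=
    integrableOn_const (by simp)
  have hint := integral_mono_ae hiu (hiv.add hic) hpt
  rw [integral_add' hiv hic, ← norm_sq_eq_integral, ← norm_sq_eq_integral, setIntegral_const] at hint
  have hvol : volume.real (Ioo 0 ℓ) = ℓ := by
    rw [Real.volume_real_Ioo_of_le hℓ0.le, sub_zero]
  rw [hvol, smul_eq_mul] at hint
  refine hint.trans_eq ?_
  rw [hc]
  field_simp
  ring

/-- The form `f` inherits the Markov property from `F_N + f` up to the cost of cutting a function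
with prescribed trace. -/
theorem isAlmostMarkovian_of_neumannPlusTrace (p : Couple)
    (h : (neumannPlusTrace ℓ p.form).IsMarkovian sharpL2) : p.IsAlmostMarkovian := by
  refine ⟨9 / ℓ, fun ξ => ?_⟩
  obtain ⟨u, v, hv, hγu, hγv, hle⟩ := exists_H1_sharp_cheap (ℓ := ℓ) (ξ : E2)
  have hu : (u : L2 ℓ) ∈ traceDomain ℓ p.form :=
    mem_traceDomain_iff.2 ⟨u.2, by
      change γ₀ ℓ u ∈ _
      rw [hγu]
      exact ξ.2⟩
  obtain ⟨hs, hF⟩ := h.2.2 ⟨u, hu⟩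
  have hmem : sharpE2 (ξ : E2) ∈ p.form.domain := by
    have e : traceDomainToH1 ℓ p.form ⟨_, hs⟩ = v := Subtype.ext hv.symm
    rw [← hγv, ← e]
    exact γ₀_mem_domain ℓ p.form ⟨_, hs⟩
  refine ⟨hmem, ?_⟩
  have e1 := neumannPlusTrace_self_eq (f := p.form) ⟨_, hs⟩ hv (ξ := ⟨_, hmem⟩) hγv
  have e2 := neumannPlusTrace_self_eq (f := p.form) ⟨_, hu⟩ rfl (ξ := ξ) hγu
  have hF' := e1.symm.trans_le (hF.trans_eq e2)
  linarith

theorem neumannPlusTrace_isDirichlet_iff (p : Couple) :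
    (neumannPlusTrace ℓ p.form).IsDirichlet sharpL2 ↔ p.form.IsDirichlet sharpE2 :=
  ⟨fun h => p.form_isDirichlet_iff.2 (isAlmostMarkovian_of_neumannPlusTrace p h.1).isAdmissible,
    neumannPlusTrace_isDirichlet_of_form p⟩

theorem extension_mem_markovianExt_iff (p : Couple) :
    p.extension ℓ ∈ markovianExt (minimalOp ℓ) ↔ p.IsAdmissible := by
  have hF := isFormOfNeg_extension (ℓ := ℓ) p
  have hsa := isSelfAdjoint_extension (ℓ := ℓ) p
  constructor
  · rintro ⟨-, hM⟩
    exact (isAlmostMarkovian_of_neumannPlusTrace p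
      (hF.isMarkovian_of_isMarkovianOp hM)).isAdmissible
  · intro h
    refine ⟨⟨minimalOp_le_extension p, hsa⟩, hF.isMarkovianOp hsa ?_⟩
    exact (neumannPlusTrace_isDirichlet_of_form p (p.form_isDirichlet_iff.2 h)).1

end Dirichlet

end IntervalMarkov

theorem mainTheorem12 (ℓ : ℝ) [Fact (0 < ℓ)] :
    (∀ A : L2 ℓ →ₗ.[ℝ] L2 ℓ,
      A ∈ markovianExt (minimalOp ℓ) ↔ ∃ p : Couple, A = p.extension ℓ ∧ p.IsAdmissible) ∧
    (∀ p : Couple,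
      (p.extension ℓ ∈ markovianExt (minimalOp ℓ) ↔ p.IsAdmissible) ∧
      (neumannPlusTrace ℓ p.form).IsFormOfNeg (p.extension ℓ) ∧
      ((neumannPlusTrace ℓ p.form).IsDirichlet sharpL2 ↔ p.form.IsDirichlet sharpE2) ∧
      (p.form.IsDirichlet sharpE2 ↔ p.IsAdmissible)) := by
  refine ⟨fun A => ⟨fun hA => ?_, ?_⟩, fun p => ⟨extension_mem_markovianExt_iff p,
    isFormOfNeg_extension p, neumannPlusTrace_isDirichlet_iff p, p.form_isDirichlet_iff⟩⟩
  · obtain ⟨p, rfl⟩ := exists_eq_extension hA.1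
    exact ⟨p, rfl, (extension_mem_markovianExt_iff p).1 hA⟩
  · rintro ⟨p, rfl, hp⟩
    exact (extension_mem_markovianExt_iff p).2 hp
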